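/- Let $\Omega=\mathbb T^3=(-\pi,\pi)^3$ with periodic boundary conditions, $H=L^2(\Omega;\mathbb C)$, $\mathbb R_-=(-\infty,0]$. For $N\in\mathbb N$ let $H_N\subset H$ be the finite-dimensional span of all eigenvectors of $-\Delta$ (with periodic boundary conditions) with eigenvalue at most $N$, and let $P_N$ be the orthogonal projector of $H$ onto $H_N$. For $\theta\in\mathbb R$ let $\mathcal H^-_\theta=L^2_{e^{\theta t}}(\mathbb R_-,H)$, with norm $\|v\|_{\mathcal H_\theta^-}^2=\int_{-\infty}^0e^{2\theta t}\|v(t)\|_H^2\,dt$. **Theorem.** For every $K\ge 0$ there is a constant $C=C(K)$, and for every real $\omega\neq0$ there is an infinite set $S=S(K,\omega)\subset\mathbb N$, such that the following holds for every $N\in S$, with $\theta=N+\frac12$. Let $a,b:\mathbb R\times\mathbb T^3\to\mathbb C$ be $C^1$ functions with $$\|a\|_{C^1_b(\mathbb R\times\mathbb T^3)}+\|b\|_{C^1_b(\mathbb R\times\mathbb T^3)}\le K,\qquad \frac1{(2\pi)^3}\int_\Omega a(t,x)\,dx=0\quad\text{for all }t\in\mathbb R.$$ Then for every $h\in\mathcal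 H^-_\theta$ and every $v_+\in H_N$ the problem $$\partial_t v-(1+i\omega)\Delta v+a(t,x)v+b(t,x)\bar v=h(t),\quad t\le0,\qquad P_Nv\big|_{t=0}=v_+,$$ has a unique solution $v\in\mathcal H^-_\theta$, and $$\|v\|_{\mathcal H^-_\theta}\le C\big(\|h\|_{\mathcal H^-_\theta}+\|v_+\|_H\big).$$ Here the equation is understood in the sense of distributions on $(-\infty,0)\times\mathbb T^3$, and the condition at $t=0$ means that $P_Nv$ has a continuous representative on $\mathbb R_-$ with value $v_+$ at $t=0$. -/

import Mathlib

open MeasureTheory Set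
open scoped ENNReal NNReal ComplexConjugate

noncomputable section

namespace CGL

/-- Euclidean three-space. -/
abbrev E3 : Type := EuclideanSpace ℝ (Fin 3)

/-- The fundamental cell `Ω = (-π, π)³` of the torus `𝕋³`. -/
def cell : Set E3 := {x | ∀ i, x i ∈ Ioo (-Real.pi) Real.pi}

/-- Functions on `𝕋³`, seen as functions on `ℝ³` that are `2π`-periodic in each coordinate. -/
def IsPeriodic (f : E3 → ℂ) : Prop :=
  ∀ (x : E3) (i : Fin 3), f (x + EuclideanSpace.single i (2 * Real.pi)) = f x

/-- The Hilbert space `H = L²(Ω)` of complex-valued square integrable functions. -/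
abbrev H : Type := Lp ℂ 2 (volume.restrict cell)

/-- The exponential `x ↦ exp (i k·x)`, `k ∈ ℤ³`. These are the eigenfunctions of `-Δ` with
periodic boundary conditions; the eigenvalue is `|k|²`. -/
def expMode (k : Fin 3 → ℤ) (x : E3) : ℂ :=
  Complex.exp (Complex.I * ((∑ i, (k i : ℝ) * x i : ℝ) : ℂ))

/-- The eigenvalue `|k|²` of `-Δ` that belongs to `expMode k`. -/
def eigenvalue (k : Fin 3 → ℤ) : ℤ := ∑ i, k i ^ 2

theorem volume_cell_lt_top : volume cell < ∞ := by
  have hb : Bornology.IsBounded cell := by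
    refine (Metric.isBounded_iff_subset_closedBall 0).2 ⟨√(3 * Real.pi ^ 2), fun x hx => ?_⟩
    rw [mem_closedBall_zero_iff, EuclideanSpace.norm_eq]
    apply Real.sqrt_le_sqrt
    have h : ∀ i ∈ (Finset.univ : Finset (Fin 3)), ‖x i‖ ^ 2 ≤ Real.pi ^ 2 := by
      intro i _
      rw [Real.norm_eq_abs, sq_abs]
      exact sq_le_sq' (hx i).1.le (hx i).2.le
    calc _ ≤ _ := Finset.sum_le_sum h
      _ = _ := by simp
  exact hb.measure_lt_top

instance : IsFiniteMeasure ((volume : Measure E3).restrict cell) :=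
  ⟨by simpa using volume_cell_lt_top⟩

theorem continuous_expMode (k : Fin 3 → ℤ) : Continuous (expMode k) := by
  unfold expMode
  fun_prop

theorem memLp_expMode (k : Fin 3 → ℤ) : MemLp (expMode k) 2 (volume.restrict cell) := by
  refine MemLp.of_bound (continuous_expMode k).aestronglyMeasurable 1 (ae_of_all _ fun x => ?_)
  rw [expMode, mul_comm, Complex.norm_exp_ofReal_mul_I]

/-- The exponential `exp (i k·x)` as an element of `H`. -/
def eigenvector (k : Fin 3 → ℤ) : H := (memLp_expMode k).toLp

/-- `H_N`: the span of all eigenvectors of `-Δ` with eigenvalue at most `N`. -/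
def HN (N : ℕ) : Submodule ℂ H :=
  Submodule.span ℂ (eigenvector '' {k | eigenvalue k ≤ N})

theorem finite_modes (N : ℕ) : {k : Fin 3 → ℤ | eigenvalue k ≤ N}.Finite := by
  refine (Set.finite_Icc (fun _ => -(N : ℤ)) (fun _ => (N : ℤ))).subset fun k hk => ?_
  have h : ∀ i, k i ^ 2 ≤ N := fun i =>
    (Finset.single_le_sum (fun j _ => sq_nonneg (k j)) (Finset.mem_univ i)).trans hk
  constructor <;> intro i <;> have := h i <;> simp only <;> nlinarith

instance (N : ℕ) : FiniteDimensional ℂ (HN N) :=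
  FiniteDimensional.span_of_finite ℂ ((finite_modes N).image eigenvector)

/-- The orthogonal projector `P_N` of `H` onto `H_N`. -/
def P (N : ℕ) : H →L[ℂ] H := (HN N).starProjection

/-- The measure `e^{2θt} dt` on the half-line `ℝ₋ = (-∞, 0]`. -/
def weight (θ : ℝ) : Measure ℝ :=
  (volume.restrict (Iic 0)).withDensity fun t => ENNReal.ofReal (Real.exp (2 * θ * t))

/-- The weighted space `L²_{e^{θt}}(ℝ₋, H)`, with norm
`‖v‖² = ∫_{t ≤ 0} e^{2θt} ‖v(t)‖²_H dt`. -/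
abbrev WeightedL2 (θ : ℝ) : Type := Lp H 2 (weight θ)

/-- `a` is a continuously differentiable function on `ℝ × 𝕋³`. -/
def IsC1 (a : ℝ → E3 → ℂ) : Prop :=
  ContDiff ℝ 1 (fun p : ℝ × E3 => a p.1 p.2) ∧ ∀ t, IsPeriodic (a t)

/-- The norm of `C¹_b(ℝ × 𝕋³)`: supremum of the function plus supremum of its derivative in
`(t, x)` (infinite if one of them is unbounded). -/
def c1Norm (a : ℝ → E3 → ℂ) : ℝ≥0∞ :=
  (⨆ p : ℝ × E3, ‖a p.1 p.2‖ₑ) +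
    ⨆ p : ℝ × E3, ‖fderiv ℝ (fun q : ℝ × E3 => a q.1 q.2) p‖ₑ

/-- The spatial mean `⟨f⟩ = (2π)⁻³ ∫_Ω f(x) dx`. -/
def mean (f : E3 → ℂ) : ℂ := 1 / (2 * (Real.pi : ℂ)) ^ 3 * ∫ x in cell, f x

/-- Test functions: smooth complex-valued functions on `ℝ × 𝕋³` with compact support in
`(-∞, 0) × 𝕋³`. -/
structure IsTestFunction (φ : ℝ → E3 → ℂ) : Prop where
  smooth : ContDiff ℝ ((⊤ : ℕ∞) : WithTop ℕ∞) (fun p : ℝ × E3 => φ p.1 p.2)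
  periodic : ∀ t, IsPeriodic (φ t)
  support : ∃ s r : ℝ, r < 0 ∧ ∀ t x, φ t x ≠ 0 → t ∈ Icc s r

/-- `v` solves `∂ₜv - (1 + iω)Δv + a v + b v̄ = h` on `(-∞, 0) × 𝕋³` in the sense of
distributions. -/
def SolvesEquation (ω : ℝ) (a b : ℝ → E3 → ℂ) {θ : ℝ} (h v : WeightedL2 θ) : Prop :=
  ∀ φ : ℝ → E3 → ℂ, IsTestFunction φ →
    ∫ t in Iio (0 : ℝ), ∫ x in cell,
        (v t x * (-deriv (fun s => φ s x) t - (1 + Complex.I * ω) * Laplacian.laplacian (φ t) x)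
          + (a t x * v t x + b t x * conj (v t x)) * φ t x)
      = ∫ t in Iio (0 : ℝ), ∫ x in cell, h t x * φ t x

/-- The condition `P_N v|_{t=0} = u`: the function `P_N v` agrees almost everywhere on `ℝ₋`
with a continuous `H`-valued function on `(-∞, 0]` whose value at `0` is `u`. -/
def HasFinalValue (N : ℕ) {θ : ℝ} (v : WeightedL2 θ) (u : H) : Prop :=
  ∃ p : ℝ → H, ContinuousOn p (Iic 0) ∧ p 0 = u ∧
    ∀ᵐ t ∂(volume.restrict (Iic (0 : ℝ))), P N (v t) = p t

/-- `v` is a solution in `L²_{e^{θt}}(ℝ₋, H)` of the backward problem. -/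
def IsBackwardSolution (ω : ℝ) (a b : ℝ → E3 → ℂ) (N : ℕ) {θ : ℝ} (h : WeightedL2 θ) (u : H)
    (v : WeightedL2 θ) : Prop :=
  SolvesEquation ω a b h v ∧ HasFinalValue N v u

end CGL

end

/-!
The problem is a bounded perturbation `B v = a v + b v̄` of a problem that is diagonal in the Fourier
basis `e_k` of `L²(Ω)`. On the mode `k` the unperturbed problem is the scalar equation
`y' + μ_k y = f` on `(-∞, 0]` with `μ_k = (1 + iω)|k|²`. As `θ = N + 1/2` lies in the gap between
the possible values of `|k|²`, exactly one solution in the weighted space has a given final value if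
`|k|² ≤ N`, and exactly one solution exists at all otherwise; the solution operator has norm at most
`2 / ||k|² - θ| ≤ 4`. Summation over the modes gives a bounded solution operator `L` (`solve`), and
pairing with Fourier coefficients of test functions shows that `v` solves the problem if and only if
`v = f - L B v`, where `f` is the unperturbed solution (`weakSol_and_hasFinalValue_iff`,
`solvesEquation_iff`). For large `K` the operator `L B` is not small, but its square is, for suitable
`N`; this is enough for existence, uniqueness and the bound (`existsUnique_of_sq_contraction`).

It remains to see that `L B L` is small (`norm_solve_perturbation_solve_le`). Let `I` be the projector
onto the modes of the window `||k|² - N| ≤ κ`.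

* Outside the window `L` has norm at most `2 / (κ + 1/2)`, so that only `L I B I L` matters.
* The multiplication by `a` has matrix elements `⟨e_k, a e_l⟩`, which are Fourier coefficients of `a`
  at the frequency `k - l`. They vanish for `k = l`, since `a` has zero mean. If distinct lattice
  points of the window have distance larger than `√R`, only high frequencies of `a` contribute. By the
  compactness of the set of admissible `a` in the uniform norm they are uniformly small
  (`spatial_averaging`). Such windows exist for infinitely many `N` (`infinite_setOf_separated`): two
  points `k = l + m` of the window with `|m|² ≤ R` put `l` on one of finitely many planes `l·m = c`,
  and the numbers `|l|²` on such a plane are values of a binary quadratic form, which omits a residue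
  class modulo `p²` for suitable primes `p`; the Chinese remainder theorem combines these obstructions.
* The term with `v̄` is small because of oscillations in time (`temporal_averaging`). If `Y = L I g`,
  then the modes `μ_k - conj μ_l = 2iωN + O(κ)` of `I b Ȳ` rotate rapidly: `I b Ȳ` solves an
  unperturbed problem whose right-hand side is `2iωN I b Ȳ` up to terms bounded independently of `N`.
  Hence `L I b Ȳ` is of order `1 / (|ω| N)`.
-/

noncomputable section

namespace CGL

/-! ### Well separated lattice points in spherical shells -/

/-- For `p ≡ -1` modulo `4D`, the number `-D` is a quadratic non-residue modulo `p`. -/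
theorem not_isSquare_neg_of_modEq {D p : ℕ} (hD : 0 < D) (hp : p.Prime)
    (h : p ≡ 4 * D - 1 [MOD 4 * D]) : ¬ IsSquare ((-(D : ℤ) : ℤ) : ZMod p) := by
  have : Fact p.Prime := ⟨hp⟩
  rw [← legendreSym.eq_neg_one_iff, jacobiSym.legendreSym.to_jacobiSym]
  have hpm : p % (4 * D) = 4 * D - 1 := by
    rw [h, Nat.mod_eq_of_lt (by omega)]
  have hodd : Odd p := by
    have h4 : p % 4 = 3 := by
      have := Nat.mod_mod_of_dvd p (Dvd.intro D rfl : 4 ∣ 4 * D)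
      omega
    exact Nat.odd_iff.2 (by omega)
  have hodd' : Odd (4 * D - 1) := Nat.odd_iff.2 (by omega)
  have h1 : jacobiSym (-(D : ℤ)) p = jacobiSym (-(D : ℤ)) (4 * D - 1) := by
    rw [jacobiSym.mod_right _ hodd]
    simp [hpm]
  have h4 : jacobiSym (4 : ℤ) (4 * D - 1) = 1 := by
    have := jacobiSym.sq_one (a := 2) (b := 4 * D - 1) (by
      rw [Int.gcd_eq_natAbs]
      simpa using (Nat.coprime_two_left.2 hodd'))
    rw [← this, ← jacobiSym.pow_left]
    norm_num
  have h2 : jacobiSym (-(D : ℤ)) (4 * D - 1) = jacobiSym (-1) (4 * D - 1) := by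
    have : (4 * -(D : ℤ)) = -1 + ((4 * D - 1 : ℕ) : ℤ) * (-1) := by
      push_cast [Nat.cast_sub (by omega : 1 ≤ 4 * D)]
      ring
    calc jacobiSym (-(D : ℤ)) (4 * D - 1)
        = jacobiSym 4 (4 * D - 1) * jacobiSym (-(D : ℤ)) (4 * D - 1) := by rw [h4, one_mul]
      _ = jacobiSym (-1) (4 * D - 1) := by
        rw [← jacobiSym.mul_left, jacobiSym.mod_left, this, Int.add_mul_emod_self_left,
          ← jacobiSym.mod_left]
  rw [h1, h2, jacobiSym.at_neg_one hodd', ZMod.χ₄_nat_three_mod_four (by omega)]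

/-- If `-D` is a non-residue modulo `p`, then `p ∣ x² + D y²` forces `p² ∣ x² + D y²`. -/
theorem sq_dvd_of_dvd_sq_add_mul_sq {D p : ℕ} (hp : p.Prime)
    (h : ¬ IsSquare ((-(D : ℤ) : ℤ) : ZMod p)) {x y : ℤ} (hd : (p : ℤ) ∣ x ^ 2 + D * y ^ 2) :
    (p : ℤ) ^ 2 ∣ x ^ 2 + D * y ^ 2 := by
  have : Fact p.Prime := ⟨hp⟩
  have h0 : (x : ZMod p) ^ 2 + D * (y : ZMod p) ^ 2 = 0 := by
    have := (ZMod.intCast_zmod_eq_zero_iff_dvd _ p).2 hd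
    simpa using this
  have hy : (y : ZMod p) = 0 := by
    by_contra hy
    apply h
    refine ⟨x / y, ?_⟩
    field_simp
    push_cast
    linear_combination -h0
  have hx : (x : ZMod p) = 0 := by
    simpa [hy] using h0
  have hx' := (ZMod.intCast_zmod_eq_zero_iff_dvd _ p).1 hx
  have hy' := (ZMod.intCast_zmod_eq_zero_iff_dvd _ p).1 hy
  exact dvd_add (pow_dvd_pow_of_dvd hx' 2) (Dvd.dvd.mul_left (pow_dvd_pow_of_dvd hy' 2) _)

theorem eigenvalue_pos {m : Fin 3 → ℤ} (hm : m ≠ 0) : 0 < eigenvalue m := by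
  obtain ⟨i, hi⟩ := Function.ne_iff.1 hm
  exact Finset.sum_pos' (fun j _ => sq_nonneg (m j)) ⟨i, Finset.mem_univ i, by
    have : m i ≠ 0 := hi
    positivity⟩

/-- On a plane `k·m = c`, the squared length is essentially a binary quadratic form of
discriminant `-4|m|²`. The vectors `p ⟂ m` and `m × p` provide the two coordinates. -/
theorem exists_binary_form (m : Fin 3 → ℤ) :
    ∃ A : ℤ, 0 < A ∧ ∀ k : Fin 3 → ℤ, ∃ x y : ℤ,
      A * (eigenvalue m * eigenvalue k - (∑ i, k i * m i) ^ 2) = x ^ 2 + eigenvalue m * y ^ 2 := by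
  have key : ∀ p : Fin 3 → ℤ, p 0 * m 0 + p 1 * m 1 + p 2 * m 2 = 0 → ∀ k : Fin 3 → ℤ, ∃ x y : ℤ,
      eigenvalue p * (eigenvalue m * eigenvalue k - (∑ i, k i * m i) ^ 2)
        = x ^ 2 + eigenvalue m * y ^ 2 := by
    intro p hpm k
    refine ⟨k 0 * (m 1 * p 2 - m 2 * p 1) + k 1 * (m 2 * p 0 - m 0 * p 2)
      + k 2 * (m 0 * p 1 - m 1 * p 0), k 0 * p 0 + k 1 * p 1 + k 2 * p 2, ?_⟩
    simp only [eigenvalue, Fin.sum_univ_three]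
    linear_combination ((k 0 ^ 2 + k 1 ^ 2 + k 2 ^ 2) * (p 0 * m 0 + p 1 * m 1 + p 2 * m 2)
      - 2 * (k 0 * m 0 + k 1 * m 1 + k 2 * m 2) * (k 0 * p 0 + k 1 * p 1 + k 2 * p 2)) * hpm
  by_cases h : m 0 = 0 ∧ m 1 = 0
  · refine ⟨_, eigenvalue_pos (m := ![1, 0, 0]) (fun h => by simpa using congrFun h 0), key _ ?_⟩
    simp [h.1]
  · refine ⟨_, eigenvalue_pos (m := ![m 1, -m 0, 0]) (fun h' => h ?_), key _ ?_⟩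
    · exact ⟨by simpa using congrFun h' 1, by simpa using congrFun h' 0⟩
    · simp
      ring

/-- There are arbitrarily large primes `p` such that a residue class modulo `p²` contains no `n`
for which `n + i` is a squared length `|k|²` of a point of the plane `k·m = c`: it is enough that
`p` divides `|m|²(n + i) - c²` exactly once. -/
theorem exists_prime_obstruction {m : Fin 3 → ℤ} (hm : m ≠ 0) (c i : ℤ) (B : ℕ) :
    ∃ p > B, p.Prime ∧ ∃ r : ℕ, ∀ n : ℕ, n ≡ r [MOD p ^ 2] →
      ∀ k : Fin 3 → ℤ, eigenvalue k = n + i → ∑ j, k j * m j ≠ c := by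
  obtain ⟨A, hA, hform⟩ := exists_binary_form m
  obtain ⟨D, hD⟩ := Int.eq_ofNat_of_zero_le (eigenvalue_pos hm).le
  have hD0 : 0 < D := by
    have := eigenvalue_pos hm
    omega
  obtain ⟨p, hpB, hp, hpm⟩ := Nat.forall_exists_prime_gt_and_modEq (B + D + A.natAbs)
    (q := 4 * D) (a := 4 * D - 1) (by omega)
    ((Nat.coprime_self_sub_left (by omega)).2 (Nat.coprime_one_left _))
  have hpA : ¬ (p : ℤ) ∣ A := fun h => by
    have := Int.le_of_dvd hA h
    omega
  have hpD : Nat.Coprime D (p ^ 2) :=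
    Nat.Coprime.pow_right 2 (((Nat.Prime.coprime_iff_not_dvd hp).2 (fun h => by
      have := Nat.le_of_dvd hD0 h
      omega)).symm)
  have hres := not_isSquare_neg_of_modEq hD0 hp hpm
  -- a solution of `D (r + i) - c² ≡ p` modulo `p²`
  obtain ⟨u, hu⟩ : ∃ u : ℤ, (D * u : ℤ) ≡ 1 [ZMOD (p ^ 2 : ℕ)] :=
    Int.mod_coprime hpD
  set s : ℤ := u * (p + c ^ 2) - i with hs
  have hpp : (0 : ℤ) < (p ^ 2 : ℕ) := by exact_mod_cast pow_pos hp.pos 2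
  refine ⟨p, by omega, hp, (s % (p ^ 2 : ℕ)).toNat, fun n hn k hk hkc => ?_⟩
  have hns : (n : ℤ) ≡ s [ZMOD (p ^ 2 : ℕ)] := by
    have h1 := (Int.natCast_modEq_iff).2 hn
    rw [Int.toNat_of_nonneg (Int.emod_nonneg _ hpp.ne')] at h1
    exact h1.trans (Int.mod_modEq _ _)
  have hval : D * (n + i) - c ^ 2 ≡ p [ZMOD (p ^ 2 : ℕ)] := by
    have h1 : D * ((n : ℤ) + i) - c ^ 2 ≡ D * (s + i) - c ^ 2 [ZMOD (p ^ 2 : ℕ)] :=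
      ((hns.add_right i).mul_left _).sub_right _
    have h2 : D * (s + i) - c ^ 2 = (D * u) * (p + c ^ 2) - c ^ 2 := by
      rw [hs]; ring
    have h3 : (D * u) * (p + c ^ 2) - c ^ 2 ≡ 1 * (p + c ^ 2) - c ^ 2 [ZMOD (p ^ 2 : ℕ)] :=
      (hu.mul_right _).sub_right _
    rw [h2] at h1
    simpa using h1.trans h3
  obtain ⟨x, y, hxy⟩ := hform k
  rw [hkc, hk, hD] at hxy
  obtain ⟨q, hq⟩ := (Int.modEq_iff_dvd.1 hval.symm)
  push_cast at hq
  have hval' : (D : ℤ) * (n + i) - c ^ 2 = p * (1 + p * q) := by linear_combination hq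
  have hp' : Prime (p : ℤ) := Nat.prime_iff_prime_int.1 hp
  have hd1 : (p : ℤ) ∣ x ^ 2 + D * y ^ 2 := by
    rw [← hxy, hval']
    exact Dvd.dvd.mul_left (dvd_mul_right _ _) _
  have hd2 := sq_dvd_of_dvd_sq_add_mul_sq hp hres hd1
  rw [← hxy, hval'] at hd2
  obtain ⟨z, hz⟩ := hd2
  have h5 : A * (1 + p * q) = p * z := by
    apply mul_left_cancel₀ hp'.ne_zero
    linear_combination hz
  rcases hp'.dvd_or_dvd (Dvd.intro z h5.symm) with h6 | h6
  · exact hpA h6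
  · have : (p : ℤ) ∣ 1 := (dvd_add_left (dvd_mul_right _ q)).1 h6
    exact hp'.not_isUnit (isUnit_of_dvd_one this)

/-- Finitely many obstructions of the previous kind can be imposed at the same time. -/
theorem exists_modulus_avoiding {ι : Type*} (t : Finset ι) (bad : ι → ℕ → Prop)
    (h : ∀ j ∈ t, ∀ B : ℕ, ∃ p > B, p.Prime ∧ ∃ r : ℕ, ∀ n : ℕ, n ≡ r [MOD p ^ 2] → ¬ bad j n) :
    ∃ Q > 0, ∃ r : ℕ, ∀ n : ℕ, n ≡ r [MOD Q] → ∀ j ∈ t, ¬ bad j n := by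
  classical
  induction t using Finset.induction_on with
  | empty => exact ⟨1, one_pos, 0, by simp⟩
  | insert j t hj ih =>
    obtain ⟨Q, hQ, r, hr⟩ := ih fun j hj' => h j (Finset.mem_insert_of_mem hj')
    obtain ⟨p, hpQ, hp, s, hs⟩ := h j (Finset.mem_insert_self _ _) Q
    have hco : Nat.Coprime Q (p ^ 2) :=
      Nat.Coprime.pow_right 2 (Nat.coprime_of_lt_prime hQ.ne' hpQ hp).symm
    obtain ⟨z, hz1, hz2⟩ := Nat.chineseRemainder hco r s
    refine ⟨Q * p ^ 2, Nat.mul_pos hQ (pow_pos hp.pos 2), z, fun n hn j' hj' => ?_⟩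
    rcases Finset.mem_insert.1 hj' with rfl | hj'
    · exact hs n ((Nat.ModEq.of_mul_left _ hn).trans hz2)
    · exact hr n ((Nat.ModEq.of_mul_right _ hn).trans hz1) j' hj'

/-- `N` is separated if distinct lattice points `k`, `l` with `|k|²` and `|l|²` in the window
`[N - κ, N + κ]` satisfy `|k - l|² > R`. -/
def Separated (κ R N : ℕ) : Prop :=
  ∀ k l : Fin 3 → ℤ, k ≠ l → |eigenvalue k - N| ≤ κ → |eigenvalue l - N| ≤ κ →
    (R : ℤ) < eigenvalue (k - l)

/-- The arithmetic input of the spatial averaging principle: separated windows of any width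
occur infinitely often. -/
theorem infinite_setOf_separated (κ R : ℕ) : {N | Separated κ R N}.Infinite := by
  classical
  set t : Finset ((Fin 3 → ℤ) × ℤ × ℤ) :=
    ((finite_modes R).toFinset.filter (· ≠ 0)) ×ˢ
      Finset.Icc (-(2 * κ + R : ℤ)) (2 * κ + R) ×ˢ Finset.Icc (-(κ : ℤ)) κ with ht
  obtain ⟨Q, hQ, r, hr⟩ := exists_modulus_avoiding t
    (fun j n => ∃ k : Fin 3 → ℤ, eigenvalue k = n + j.2.2 ∧ ∑ i, k i * j.1 i = j.2.1) (by
      intro j hj B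
      have hm : j.1 ≠ 0 := by
        simp only [ht, Finset.mem_product, Finset.mem_filter] at hj
        exact hj.1.2
      obtain ⟨p, hpB, hp, r, hr⟩ := exists_prime_obstruction hm j.2.1 j.2.2 B
      exact ⟨p, hpB, hp, r, fun n hn ⟨k, hk, hk'⟩ => hr n hn k hk hk'⟩)
  refine Set.infinite_of_forall_exists_gt fun B => ⟨r + Q * (B + 1), ?_, by nlinarith⟩
  intro k l hkl hk hl
  by_contra hR
  push Not at hR
  refine hr (r + Q * (B + 1)) (by simp [Nat.ModEq])
    (k - l, ∑ i, l i * (k i - l i), eigenvalue l - (r + Q * (B + 1) : ℕ)) ?_ ⟨l, ?_, ?_⟩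
  · have hid : eigenvalue k = eigenvalue l + 2 * ∑ i, l i * (k i - l i) + eigenvalue (k - l) := by
      simp only [eigenvalue, Fin.sum_univ_three, Pi.sub_apply]
      ring
    have h0 := eigenvalue_pos (sub_ne_zero.2 hkl)
    rw [abs_le] at hk hl
    simp only [ht, Finset.mem_product, Finset.mem_filter, Set.Finite.mem_toFinset, mem_ofPred_eq,
      Finset.mem_Icc]
    refine ⟨⟨hR, sub_ne_zero.2 hkl⟩, ⟨?_, ?_⟩, hl.1, hl.2⟩ <;> omega
  · simp
  · simp

/-! ### The Fourier basis of `L²(Ω)` -/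

section Torus

/-- The circle `ℝ/ℤ` carries the probability Haar measure, as in the theory of `mFourierBasis`. -/
local instance : MeasureSpace UnitAddCircle := ⟨AddCircle.haarAddCircle⟩

local instance : IsProbabilityMeasure (volume : Measure UnitAddCircle) :=
  inferInstanceAs (IsProbabilityMeasure AddCircle.haarAddCircle)

/-- The covering map `ℝ³ → (ℝ/ℤ)³`, `x ↦ x / 2π`. -/
def toTorus (x : E3) : UnitAddTorus (Fin 3) := fun i => ((x i / (2 * Real.pi) : ℝ) : UnitAddCircle)

theorem continuous_toTorus : Continuous toTorus := by
  refine continuous_pi fun i => (AddCircle.continuous_mk' 1).comp ?_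
  fun_prop

theorem mFourier_toTorus (k : Fin 3 → ℤ) (x : E3) :
    UnitAddTorus.mFourier k (toTorus x) = expMode k x := by
  simp only [UnitAddTorus.mFourier, toTorus, ContinuousMap.coe_mk, fourier_coe_apply, expMode]
  rw [← Complex.exp_sum]
  congr 1
  push_cast
  rw [Finset.mul_sum]
  refine Finset.sum_congr rfl fun i _ => ?_
  have : (Real.pi : ℂ) ≠ 0 := by exact_mod_cast Real.pi_ne_zero
  field_simp

/-- A measurable section of the covering map, inverse to it on the cell. -/
def ofTorus (z : UnitAddTorus (Fin 3)) : E3 :=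
  WithLp.toLp 2 fun i => 2 * Real.pi * (AddCircle.equivIoc 1 (-(1 / 2) : ℝ) (z i)).1

theorem measurable_ofTorus : Measurable ofTorus := by
  refine (WithLp.measurable_toLp 2 _).comp (measurable_pi_lambda _ fun i => ?_)
  exact (measurable_subtype_coe.comp
    ((AddCircle.measurableEquivIoc 1 (-(1 / 2) : ℝ)).measurable.comp
      (measurable_pi_apply i))).const_mul _

theorem ofTorus_toTorus {x : E3} (hx : x ∈ cell) : ofTorus (toTorus x) = x := by
  ext i
  have hπ := Real.pi_pos
  have h : x i / (2 * Real.pi) ∈ Ioc (-(1 / 2) : ℝ) (-(1 / 2) + 1) := by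
    constructor
    · rw [lt_div_iff₀ (by positivity)]
      linarith [(hx i).1]
    · rw [div_le_iff₀ (by positivity)]
      linarith [(hx i).2]
  simp only [ofTorus, toTorus]
  rw [AddCircle.equivIoc_coe_of_mem h]
  field_simp

theorem measurableSet_cell : MeasurableSet cell := by
  have : cell = (fun x : E3 => WithLp.ofLp x) ⁻¹' (univ.pi fun _ => Ioo (-Real.pi) Real.pi) := by
    ext x
    simp [cell]
  rw [this]
  exact (MeasurableSet.univ_pi fun _ => measurableSet_Ioo).preimage (WithLp.measurable_ofLp 2 _)

theorem map_circle :
    Measure.map (fun t : ℝ => ((t / (2 * Real.pi) : ℝ) : UnitAddCircle))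
      (volume.restrict (Ioo (-Real.pi) Real.pi)) = ENNReal.ofReal (2 * Real.pi) • volume := by
  have hπ := Real.pi_pos
  have h1 : Measure.map (fun t : ℝ => (2 * Real.pi)⁻¹ * t)
      (volume.restrict (Ioo (-Real.pi) Real.pi))
      = ENNReal.ofReal (2 * Real.pi) • volume.restrict (Ioc (-(1 / 2) : ℝ) (-(1 / 2) + 1)) := by
    have he : Ioo (-Real.pi) Real.pi
        = (fun t : ℝ => (2 * Real.pi)⁻¹ * t) ⁻¹' Ioo (-(1 / 2) : ℝ) (-(1 / 2) + 1) := by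
      ext t
      simp only [mem_Ioo, mem_preimage, inv_mul_eq_div]
      rw [lt_div_iff₀ (by positivity), div_lt_iff₀ (by positivity)]
      constructor <;> rintro ⟨h, h'⟩ <;> constructor <;> linarith
    rw [he, ← Measure.restrict_map (measurable_const_mul _) measurableSet_Ioo,
      Real.map_volume_mul_left (by positivity), Measure.restrict_smul,
      restrict_Ioo_eq_restrict_Ioc]
    congr 2
    rw [inv_inv, abs_of_pos (by positivity)]
  have h2 : (volume : Measure UnitAddCircle)
      = Measure.map (fun t : ℝ => (t : UnitAddCircle))
        (volume.restrict (Ioc (-(1 / 2) : ℝ) (-(1 / 2) + 1))) := by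
    have := (AddCircle.measurePreserving_mk 1 (-(1 / 2) : ℝ)).map_eq
    rw [AddCircle.volume_eq_smul_haarAddCircle, ENNReal.ofReal_one, one_smul] at this
    exact this.symm
  rw [h2, ← Measure.map_smul, ← h1, Measure.map_map AddCircle.measurable_mk'
    (measurable_const_mul _)]
  congr 1
  ext t
  simp [Function.comp, div_eq_inv_mul]

/-- The covering map takes Lebesgue measure on the cell to `(2π)³` times Haar measure. -/
theorem map_toTorus :
    Measure.map toTorus (volume.restrict cell)
      = ENNReal.ofReal ((2 * Real.pi) ^ 3) • (volume : Measure (UnitAddTorus (Fin 3))) := by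
  have h1 : Measure.map (fun x : E3 => WithLp.ofLp x) (volume.restrict cell)
      = Measure.pi fun _ : Fin 3 => volume.restrict (Ioo (-Real.pi) Real.pi) := by
    rw [← Measure.restrict_pi_pi, ← volume_pi]
    have := (PiLp.volume_preserving_ofLp (Fin 3)).restrict_preimage
      (MeasurableSet.univ_pi fun _ : Fin 3 => measurableSet_Ioo (a := -Real.pi) (b := Real.pi))
    rw [← this.map_eq]
    congr 2
    ext x
    simp [cell]
  have : IsFiniteMeasure (ENNReal.ofReal (2 * Real.pi) • (volume : Measure UnitAddCircle)) :=
    Measure.smul_finite _ ENNReal.ofReal_ne_top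
  have h2 := measurePreserving_pi (fun _ : Fin 3 => volume.restrict (Ioo (-Real.pi) Real.pi))
    (fun _ : Fin 3 => ENNReal.ofReal (2 * Real.pi) • (volume : Measure UnitAddCircle))
    (f := fun _ t => ((t / (2 * Real.pi) : ℝ) : UnitAddCircle))
    (fun _ => ⟨AddCircle.measurable_mk'.comp (measurable_id.div_const _), map_circle⟩)
  have h3 : (Measure.pi fun _ : Fin 3 =>
      ENNReal.ofReal (2 * Real.pi) • (volume : Measure UnitAddCircle))
      = ENNReal.ofReal ((2 * Real.pi) ^ 3) • (volume : Measure (UnitAddTorus (Fin 3))) := by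
    refine Measure.pi_eq fun s hs => ?_
    rw [Measure.smul_apply, volume_pi, Measure.pi_pi]
    simp only [Measure.smul_apply, smul_eq_mul, Finset.prod_mul_distrib, Finset.prod_const,
      Finset.card_univ, Fintype.card_fin]
    rw [ENNReal.ofReal_pow (by positivity)]
  rw [← h3, ← h2.map_eq, ← h1, Measure.map_map h2.measurable (WithLp.measurable_ofLp 2 _)]
  rfl

theorem measurable_toTorus : Measurable toTorus := continuous_toTorus.measurable

theorem integral_cell_toTorus (F : UnitAddTorus (Fin 3) → ℂ) (hF : Measurable F) :
    ∫ x in cell, F (toTorus x) = (2 * Real.pi : ℝ) ^ 3 * ∫ z, F z := by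
  rw [← integral_map measurable_toTorus.aemeasurable hF.aestronglyMeasurable, map_toTorus,
    integral_smul_measure, ENNReal.toReal_ofReal (by positivity)]
  simp

theorem orthonormal_integral (k l : Fin 3 → ℤ) :
    ∫ x in cell, conj (expMode k x) * expMode l x
      = if k = l then ((2 * Real.pi : ℝ) : ℂ) ^ 3 else 0 := by
  have h1 : ∀ x, conj (expMode k x) * expMode l x
      = UnitAddTorus.mFourier (-k + l) (toTorus x) := fun x => by
    rw [UnitAddTorus.mFourier_add, UnitAddTorus.mFourier_neg, mFourier_toTorus, mFourier_toTorus]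
  simp_rw [h1]
  rw [integral_cell_toTorus _ (UnitAddTorus.mFourier (-k + l)).continuous.measurable]
  have h2 := orthonormal_iff_ite.1 (UnitAddTorus.orthonormal_mFourier (d := Fin 3)) k l
  rw [ContinuousMap.inner_toLp] at h2
  have h3 : (∫ z, UnitAddTorus.mFourier (-k + l) z : ℂ) = if k = l then 1 else 0 := by
    rw [← h2]
    refine integral_congr_ae (ae_of_all _ fun z => ?_)
    simp only
    rw [UnitAddTorus.mFourier_add, UnitAddTorus.mFourier_neg, mul_comm]
  rw [h3]
  split_ifs <;> simp

/-- A square integrable function on the cell that is orthogonal to all exponentials vanishes. -/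
theorem ae_eq_zero_of_orthogonal {f : E3 → ℂ} (hf : Measurable f)
    (hf2 : MemLp f 2 (volume.restrict cell))
    (h : ∀ k, ∫ x in cell, conj (expMode k x) * f x = 0) : ∀ᵐ x ∂(volume.restrict cell), f x = 0 := by
  set F : UnitAddTorus (Fin 3) → ℂ := fun z => f (ofTorus z) with hFdef
  have hFm : Measurable F := hf.comp measurable_ofTorus
  have hcell : ∀ᵐ x ∂(volume.restrict cell), ofTorus (toTorus x) = x :=
    (ae_restrict_mem measurableSet_cell).mono fun x hx => ofTorus_toTorus hx
  have hc0 : ENNReal.ofReal ((2 * Real.pi) ^ 3) ≠ 0 := by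
    simp [Real.pi_pos]
  have hF2 : MemLp F 2 volume := by
    have h1 : MemLp F 2 (Measure.map toTorus (volume.restrict cell)) := by
      rw [memLp_map_measure_iff hFm.aestronglyMeasurable measurable_toTorus.aemeasurable]
      refine (memLp_congr_ae ?_).2 hf2
      filter_upwards [hcell] with x hx
      simp [hFdef, hx]
    rw [map_toTorus] at h1
    have h2 := h1.smul_measure (c := (ENNReal.ofReal ((2 * Real.pi) ^ 3))⁻¹) (by simp [hc0])
    rwa [smul_smul, ENNReal.inv_mul_cancel hc0 ENNReal.ofReal_ne_top, one_smul] at h2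
  have hcoef : ∀ k, UnitAddTorus.mFourierCoeff F k = 0 := by
    intro k
    have h1 := integral_cell_toTorus (fun z => UnitAddTorus.mFourier (-k) z • F z)
      ((UnitAddTorus.mFourier (-k)).continuous.measurable.smul hFm)
    have h2 : ∫ x in cell, UnitAddTorus.mFourier (-k) (toTorus x) • F (toTorus x) = 0 := by
      rw [← h k]
      refine integral_congr_ae ?_
      filter_upwards [hcell] with x hx
      rw [UnitAddTorus.mFourier_neg, mFourier_toTorus, hFdef]
      simp [hx]
    rw [h2] at h1
    have h3 : (((2 * Real.pi : ℝ) : ℂ) ^ 3) ≠ 0 := by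
      exact pow_ne_zero 3 (by exact_mod_cast Real.two_pi_pos.ne')
    exact (mul_eq_zero.1 h1.symm).resolve_left h3
  have hzero : hF2.toLp F = 0 := by
    apply (UnitAddTorus.mFourierBasis (d := Fin 3)).repr.injective
    ext k
    rw [UnitAddTorus.mFourierBasis_repr, map_zero]
    rw [show UnitAddTorus.mFourierCoeff (hF2.toLp F) k = UnitAddTorus.mFourierCoeff F k from
      integral_congr_ae (hF2.coeFn_toLp.mono fun z hz => by simp only [hz])]
    simpa using hcoef k
  have hF0 : ∀ᵐ z ∂(volume : Measure (UnitAddTorus (Fin 3))), F z = 0 := by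
    have := hF2.coeFn_toLp
    rw [hzero] at this
    filter_upwards [this, Lp.coeFn_zero ℂ 2 (volume : Measure (UnitAddTorus (Fin 3)))] with z h1 h2
    rw [← h1, h2]
    rfl
  have hF0' : ∀ᵐ z ∂(Measure.map toTorus (volume.restrict cell)), F z = 0 := by
    rw [map_toTorus]
    exact Measure.ae_smul_measure hF0 _
  filter_upwards [ae_of_ae_map measurable_toTorus.aemeasurable hF0', hcell] with x h1 h2
  simpa [hFdef, h2] using h1

/-- Every continuous periodic function is a uniform limit of trigonometric polynomials. -/
theorem exists_trigPoly_near {f : E3 → ℂ} (hf : Continuous f) (hp : IsPeriodic f) {ε : ℝ}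
    (hε : 0 < ε) : ∃ c : (Fin 3 → ℤ) →₀ ℂ, ∀ x, ‖f x - c.sum fun k z => z * expMode k x‖ < ε := by
  -- periodic functions descend to the torus
  have hadd : ∀ (i : Fin 3) (s t : ℝ), EuclideanSpace.single i s + EuclideanSpace.single i t
      = (EuclideanSpace.single i (s + t) : E3) := fun i s t => by
    ext j
    by_cases h : j = i
    · subst h; simp
    · simp [h]
  have hpz : ∀ (i : Fin 3) (n : ℤ) (x : E3),
      f (x + EuclideanSpace.single i (n * (2 * Real.pi))) = f x := by
    intro i n
    induction n using Int.induction_on with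
    | zero =>
      intro x
      rw [show (EuclideanSpace.single i (((0 : ℤ) : ℝ) * (2 * Real.pi)) : E3) = 0 by
        ext j; simp, add_zero]
    | succ n ih =>
      intro x
      rw [← ih x, ← hp (x + EuclideanSpace.single i (((n : ℕ) : ℤ) * (2 * Real.pi))) i, add_assoc,
        hadd]
      congr 3
      push_cast
      ring
    | pred n ih =>
      intro x
      rw [← ih x, ← hp (x + EuclideanSpace.single i _) i, add_assoc, hadd]
      congr 3
      push_cast
      ring
  have hq : IsOpenQuotientMap toTorus := by
    have h1 : IsOpenQuotientMap
        (Pi.map fun _ : Fin 3 => fun t : ℝ => ((t / (2 * Real.pi) : ℝ) : UnitAddCircle)) :=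
      IsOpenQuotientMap.piMap fun _ => IsOpenQuotientMap.comp
        (QuotientAddGroup.isOpenQuotientMap_mk (N := AddSubgroup.zmultiples (1 : ℝ)))
        (by
          simp only [div_eq_mul_inv]
          exact (Homeomorph.mulRight₀ (2 * Real.pi)⁻¹
          (inv_ne_zero Real.two_pi_pos.ne')).isOpenQuotientMap)
    exact h1.comp (EuclideanSpace.equiv (Fin 3) ℝ).toHomeomorph.isOpenQuotientMap
  have hlift : ∀ x y, toTorus x = toTorus y → f x = f y := by
    intro x y hxy
    have h1 : ∀ i, ∃ n : ℤ, y i = x i + n * (2 * Real.pi) := by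
      intro i
      have h2 := congrFun hxy i
      simp only [toTorus] at h2
      obtain ⟨n, hn⟩ := AddSubgroup.mem_zmultiples_iff.1 (QuotientAddGroup.eq.1 h2)
      refine ⟨n, ?_⟩
      have hπ := Real.pi_pos
      simp only [zsmul_eq_mul, mul_one] at hn
      rw [hn]
      field_simp
      ring
    choose n hn using h1
    have h2 : y = x + EuclideanSpace.single 0 (n 0 * (2 * Real.pi))
        + EuclideanSpace.single 1 (n 1 * (2 * Real.pi))
        + EuclideanSpace.single 2 (n 2 * (2 * Real.pi)) := by
      ext i
      fin_cases i <;> simp [hn]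
    rw [h2, hpz, hpz, hpz]
  obtain ⟨F, hF⟩ : ∃ F : UnitAddTorus (Fin 3) → ℂ, ∀ x, F (toTorus x) = f x :=
    ⟨fun z => f (Function.surjInv hq.surjective z), fun x =>
      hlift _ _ (Function.surjInv_eq hq.surjective _)⟩
  have hFc : Continuous F := by
    rw [hq.isQuotientMap.continuous_iff]
    exact hf.congr fun x => (hF x).symm
  have hmem : (⟨F, hFc⟩ : C(UnitAddTorus (Fin 3), ℂ)) ∈
      (Submodule.span ℂ (range (UnitAddTorus.mFourier (d := Fin 3)))).topologicalClosure := by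
    rw [UnitAddTorus.span_mFourier_closure_eq_top]
    trivial
  obtain ⟨q, hq, hqF⟩ := Metric.mem_closure_iff.1 hmem ε hε
  obtain ⟨c, rfl⟩ := (Finsupp.mem_span_range_iff_exists_finsupp).1 hq
  refine ⟨c, fun x => ?_⟩
  rw [dist_eq_norm] at hqF
  have := (ContinuousMap.norm_coe_le_norm _ (toTorus x)).trans_lt hqF
  simpa [Finsupp.sum, ContinuousMap.sum_apply, hF, mFourier_toTorus] using this

end Torus

theorem inner_H (f g : H) : inner ℂ f g = ∫ x in cell, conj (f x) * g x := by
  rw [L2.inner_def]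
  refine integral_congr_ae (ae_of_all _ fun x => ?_)
  simp [RCLike.inner_apply, mul_comm]

theorem coeFn_eigenvector (k : Fin 3 → ℤ) : eigenvector k =ᵐ[volume.restrict cell] expMode k :=
  (memLp_expMode k).coeFn_toLp

theorem inner_eigenvector (k : Fin 3 → ℤ) (f : H) :
    inner ℂ (eigenvector k) f = ∫ x in cell, conj (expMode k x) * f x := by
  rw [inner_H]
  exact integral_congr_ae ((coeFn_eigenvector k).mono fun x hx => by simp only [hx])

/-- The constant `(2π)^{-3/2}` that normalizes the exponentials in `L²(Ω)`. -/
def normConst : ℝ := (√((2 * Real.pi) ^ 3))⁻¹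

theorem normConst_pos : 0 < normConst := by
  unfold normConst
  positivity

theorem normConst_sq : normConst ^ 2 * (2 * Real.pi) ^ 3 = 1 := by
  unfold normConst
  rw [inv_pow, Real.sq_sqrt (by positivity)]
  field_simp

theorem orthonormal_eigenvector :
    Orthonormal ℂ fun k => (normConst : ℂ) • eigenvector k := by
  rw [orthonormal_iff_ite]
  intro k l
  rw [inner_smul_left, inner_smul_right, inner_eigenvector,
    integral_congr_ae ((coeFn_eigenvector l).mono fun x hx => by
      show conj (expMode k x) * eigenvector l x = conj (expMode k x) * expMode l x
      rw [hx]), orthonormal_integral]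
  split_ifs
  · rw [Complex.conj_ofReal]
    have := normConst_sq
    exact_mod_cast (by linear_combination this : normConst * (normConst * (2 * Real.pi) ^ 3) = 1)
  · simp

theorem span_eigenvector_orthogonal :
    (Submodule.span ℂ (range fun k => (normConst : ℂ) • eigenvector k))ᗮ = ⊥ := by
  rw [Submodule.eq_bot_iff]
  intro f hf
  have hc : (normConst : ℂ) ≠ 0 := by exact_mod_cast normConst_pos.ne'
  have hk : ∀ k, ∫ x in cell, conj (expMode k x) * f x = 0 := fun k => by
    have h1 := (Submodule.mem_orthogonal _ _).1 hf _ (Submodule.subset_span ⟨k, rfl⟩)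
    rw [inner_smul_left, inner_eigenvector] at h1
    simpa [hc] using h1
  have := ae_eq_zero_of_orthogonal (Lp.stronglyMeasurable f).measurable (Lp.memLp f) hk
  exact (Lp.eq_zero_iff_ae_eq_zero).2 this

/-- The Fourier basis `(2π)^{-3/2} exp (i k·x)` of `H`. -/
def basis : HilbertBasis (Fin 3 → ℤ) ℂ H :=
  HilbertBasis.mkOfOrthogonalEqBot orthonormal_eigenvector span_eigenvector_orthogonal

theorem basis_apply (k : Fin 3 → ℤ) : basis k = (normConst : ℂ) • eigenvector k := by
  rw [basis, HilbertBasis.coe_mkOfOrthogonalEqBot]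

theorem coeFn_basis (k : Fin 3 → ℤ) :
    basis k =ᵐ[volume.restrict cell] fun x => normConst * expMode k x := by
  rw [basis_apply]
  filter_upwards [Lp.coeFn_smul (normConst : ℂ) (eigenvector k), coeFn_eigenvector k] with x h1 h2
  rw [h1, Pi.smul_apply, h2, smul_eq_mul]

theorem inner_basis (k : Fin 3 → ℤ) (f : H) :
    inner ℂ (basis k) f = normConst * ∫ x in cell, conj (expMode k x) * f x := by
  rw [basis_apply, inner_smul_left, inner_eigenvector, Complex.conj_ofReal]

/-! ### Multiplication operators on `L²(Ω)` -/

theorem isCompact_closedCube : IsCompact {x : E3 | ∀ i, x i ∈ Icc (-Real.pi) Real.pi} := by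
  have h : {x : E3 | ∀ i, x i ∈ Icc (-Real.pi) Real.pi}
      = (EuclideanSpace.equiv (Fin 3) ℝ).toHomeomorph ⁻¹'
        (univ.pi fun _ => Icc (-Real.pi) Real.pi) := by
    ext x
    simp only [mem_ofPred_eq, mem_preimage, mem_univ_pi]
    rfl
  rw [h, Homeomorph.isCompact_preimage]
  exact isCompact_univ_pi fun _ => isCompact_Icc

theorem cell_subset_closedCube : cell ⊆ {x : E3 | ∀ i, x i ∈ Icc (-Real.pi) Real.pi} :=
  fun _ hx i => Ioo_subset_Icc_self (hx i)

theorem exists_bound_cell (f : C(E3, ℂ)) : ∃ c : ℝ, 0 ≤ c ∧ ∀ x ∈ cell, ‖f x‖ ≤ c := by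
  obtain ⟨c, hc⟩ := isCompact_closedCube.exists_bound_of_continuousOn f.continuous.continuousOn
  exact ⟨max c 0, le_max_right _ _,
    fun x hx => (hc x (cell_subset_closedCube hx)).trans (le_max_left _ _)⟩

theorem memLp_mul (f : C(E3, ℂ)) (g : H) :
    MemLp (fun x => f x * g x) 2 (volume.restrict cell) := by
  obtain ⟨c, -, hc⟩ := exists_bound_cell f
  refine (Lp.memLp g).of_le_mul (c := c)
    (f.continuous.aestronglyMeasurable.mul (Lp.aestronglyMeasurable g)) ?_
  filter_upwards [ae_restrict_mem measurableSet_cell] with x hx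
  rw [norm_mul]
  exact mul_le_mul_of_nonneg_right (hc x hx) (norm_nonneg _)

/-- Multiplication by a continuous function as a linear map of `H`. -/
def mulLin (f : C(E3, ℂ)) : H →ₗ[ℂ] H where
  toFun g := (memLp_mul f g).toLp
  map_add' g h := by
    rw [← MemLp.toLp_add]
    refine MemLp.toLp_congr _ _ ?_
    filter_upwards [Lp.coeFn_add g h] with x hx
    rw [hx, Pi.add_apply, Pi.add_apply, mul_add]
  map_smul' c g := by
    rw [RingHom.id_apply, ← MemLp.toLp_const_smul]
    refine MemLp.toLp_congr _ _ ?_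
    filter_upwards [Lp.coeFn_smul c g] with x hx
    rw [hx, Pi.smul_apply, Pi.smul_apply, smul_eq_mul, smul_eq_mul, mul_left_comm]

theorem coeFn_mulLin (f : C(E3, ℂ)) (g : H) :
    mulLin f g =ᵐ[volume.restrict cell] fun x => f x * g x :=
  (memLp_mul f g).coeFn_toLp

theorem norm_mulLin_le {f : C(E3, ℂ)} {c : ℝ} (hc : ∀ x ∈ cell, ‖f x‖ ≤ c) (g : H) :
    ‖mulLin f g‖ ≤ c * ‖g‖ := by
  refine Lp.norm_le_mul_norm_of_ae_le_mul ?_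
  filter_upwards [coeFn_mulLin f g, ae_restrict_mem measurableSet_cell] with x h1 hx
  rw [h1, norm_mul]
  exact mul_le_mul_of_nonneg_right (hc x hx) (norm_nonneg _)

/-- Multiplication by a continuous function as a bounded operator on `H`. -/
def mulOp (f : C(E3, ℂ)) : H →L[ℂ] H :=
  (mulLin f).mkContinuous (exists_bound_cell f).choose
    (norm_mulLin_le (exists_bound_cell f).choose_spec.2)

theorem coeFn_mulOp (f : C(E3, ℂ)) (g : H) :
    mulOp f g =ᵐ[volume.restrict cell] fun x => f x * g x :=
  coeFn_mulLin f g

theorem norm_mulOp_le {f : C(E3, ℂ)} {c : ℝ} (h0 : 0 ≤ c) (hc : ∀ x ∈ cell, ‖f x‖ ≤ c) :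
    ‖mulOp f‖ ≤ c :=
  ContinuousLinearMap.opNorm_le_bound _ h0 (norm_mulLin_le hc)

theorem mulOp_sub (f g : C(E3, ℂ)) : mulOp (f - g) = mulOp f - mulOp g := by
  ext1 u
  refine Lp.ext ?_
  filter_upwards [coeFn_mulOp (f - g) u, coeFn_mulOp f u, coeFn_mulOp g u,
    Lp.coeFn_sub (mulOp f u) (mulOp g u)] with x h1 h2 h3 h4
  rw [sub_apply, h4, Pi.sub_apply, h1, h2, h3, ContinuousMap.sub_apply, sub_mul]

/-- If `f` is jointly continuous, then multiplication by `f t` depends continuously on `t` in the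
operator norm, since `f t` does so uniformly on the cell. -/
theorem continuous_mulOp {F : ℝ → C(E3, ℂ)} (hF : Continuous F) :
    Continuous fun t => mulOp (F t) := by
  rw [Metric.continuous_iff']
  intro t ε hε
  have h1 := (ContinuousMap.tendsto_iff_forall_isCompact_tendstoUniformlyOn.1 (hF.tendsto t))
    _ isCompact_closedCube
  filter_upwards [Metric.tendstoUniformlyOn_iff.1 h1 (ε / 2) (half_pos hε)] with s hs
  rw [dist_eq_norm, ← mulOp_sub]
  refine (norm_mulOp_le (half_pos hε).le fun x hx => ?_).trans_lt (half_lt_self hε)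
  have := hs x (cell_subset_closedCube hx)
  rw [dist_comm, dist_eq_norm] at this
  exact this.le

/-- Complex conjugation on `H`. -/
def conjOp : H →L[ℝ] H :=
  (Complex.conjCLE : ℂ →L[ℝ] ℂ).compLpL 2 (volume.restrict cell)

theorem coeFn_conjOp (g : H) : conjOp g =ᵐ[volume.restrict cell] fun x => conj (g x) := by
  exact ContinuousLinearMap.coeFn_compLpL (Complex.conjCLE : ℂ →L[ℝ] ℂ) g

theorem norm_conjOp_apply (g : H) : ‖conjOp g‖ = ‖g‖ := by
  rw [Lp.norm_def, Lp.norm_def]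
  refine congrArg ENNReal.toReal (eLpNorm_congr_norm_ae ?_)
  filter_upwards [coeFn_conjOp g] with x hx
  rw [hx, RCLike.norm_conj]

theorem norm_conjOp_le : ‖conjOp‖ ≤ 1 :=
  ContinuousLinearMap.opNorm_le_bound conjOp zero_le_one fun g => by
    rw [norm_conjOp_apply, one_mul]

theorem conjOp_smul (c : ℂ) (g : H) : conjOp (c • g) = conj c • conjOp g := by
  refine Lp.ext ?_
  filter_upwards [coeFn_conjOp (c • g), coeFn_conjOp g, Lp.coeFn_smul c g,
    Lp.coeFn_smul (conj c) (conjOp g)] with x h1 h2 h3 h4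
  rw [h1, h3, h4, Pi.smul_apply, Pi.smul_apply, h2, smul_eq_mul, smul_eq_mul, map_mul]

/-! ### Spectral projectors and spatial averaging -/

theorem basis_mem_HN {N : ℕ} {k : Fin 3 → ℤ} (hk : eigenvalue k ≤ N) : basis k ∈ HN N := by
  rw [basis_apply]
  exact Submodule.smul_mem _ _ (Submodule.subset_span ⟨k, hk, rfl⟩)

theorem eigenvector_eq_smul_basis (k : Fin 3 → ℤ) :
    eigenvector k = ((normConst⁻¹ : ℝ) : ℂ) • basis k := by
  rw [basis_apply, smul_smul, ← Complex.ofReal_mul, inv_mul_cancel₀ normConst_pos.ne',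
    Complex.ofReal_one, one_smul]

theorem basis_mem_HN_orthogonal {N : ℕ} {k : Fin 3 → ℤ} (hk : ¬ eigenvalue k ≤ N) :
    basis k ∈ (HN N)ᗮ := by
  rw [HN, Submodule.mem_orthogonal]
  intro u hu
  induction hu using Submodule.span_induction with
  | mem u hu =>
    obtain ⟨l, hl, rfl⟩ := hu
    have hlk : l ≠ k := fun h => hk (h ▸ hl)
    rw [eigenvector_eq_smul_basis, inner_smul_left, basis.orthonormal.2 hlk, mul_zero]
  | zero => simp
  | add u v _ _ hu hv => rw [inner_add_left, hu, hv, add_zero]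
  | smul c u _ hu => rw [inner_smul_left, hu, mul_zero]

theorem inner_basis_P (N : ℕ) (k : Fin 3 → ℤ) (f : H) :
    inner ℂ (basis k) (P N f) = if eigenvalue k ≤ N then inner ℂ (basis k) f else 0 := by
  rw [P, ← Submodule.inner_starProjection_left_eq_right]
  split_ifs with h
  · rw [Submodule.starProjection_eq_self_iff.2 (basis_mem_HN h)]
  · rw [(Submodule.starProjection_apply_eq_zero_iff _).2 (basis_mem_HN_orthogonal h), inner_zero_left]

theorem ext_inner_basis {f g : H} (h : ∀ k, inner ℂ (basis k) f = inner ℂ (basis k) g) : f = g := by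
  apply basis.repr.injective
  ext k
  rw [HilbertBasis.repr_apply_apply, HilbertBasis.repr_apply_apply, h]

/-- The window of modes with `|λ - N| ≤ κ`. -/
def window (κ N : ℕ) : Set (Fin 3 → ℤ) := {k | |eigenvalue k - N| ≤ κ}

instance (κ N : ℕ) : DecidablePred (· ∈ window κ N) := fun _ => inferInstanceAs (Decidable ((_ : ℤ) ≤ _))

theorem finite_window (κ N : ℕ) : (window κ N).Finite :=
  (finite_modes (N + κ)).subset fun k hk => by
    have := (abs_le.1 (show |eigenvalue k - N| ≤ κ from hk)).2
    simp only [mem_ofPred_eq]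
    push_cast
    linarith

/-- The projector onto the modes of the window. -/
def winProj (κ N : ℕ) : H →L[ℂ] H := P (N + κ) - P (N - κ - 1)

theorem inner_basis_winProj {κ N : ℕ} (hN : κ < N) (k : Fin 3 → ℤ) (f : H) :
    inner ℂ (basis k) (winProj κ N f) = if k ∈ window κ N then inner ℂ (basis k) f else 0 := by
  rw [winProj, sub_apply, inner_sub_right, inner_basis_P, inner_basis_P]
  have h1 : k ∈ window κ N ↔ eigenvalue k ≤ (N + κ : ℕ) ∧ ¬ eigenvalue k ≤ (N - κ - 1 : ℕ) := by
    simp only [window, mem_ofPred_eq, abs_le]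
    omega
  have h2 : eigenvalue k ≤ (N - κ - 1 : ℕ) → eigenvalue k ≤ (N + κ : ℕ) := fun h => by omega
  by_cases ha : eigenvalue k ≤ (N - κ - 1 : ℕ)
  · rw [if_pos (h2 ha), if_pos ha, if_neg (by simp [h1, ha]), sub_self]
  · simp [h1, ha]

theorem norm_P_le (N : ℕ) : ‖P N‖ ≤ 1 := Submodule.starProjection_norm_le _

theorem norm_winProj_le (κ N : ℕ) : ‖winProj κ N‖ ≤ 2 :=
  (norm_sub_le _ _).trans (by linarith [norm_P_le (N + κ), norm_P_le (N - κ - 1)])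

theorem expMode_add (k l : Fin 3 → ℤ) (x : E3) : expMode (k + l) x = expMode k x * expMode l x := by
  rw [expMode, expMode, expMode, ← Complex.exp_add, ← mul_add, ← Complex.ofReal_add,
    ← Finset.sum_add_distrib]
  simp [add_mul]

theorem conj_expMode (k : Fin 3 → ℤ) (x : E3) : conj (expMode k x) = expMode (-k) x := by
  rw [expMode, expMode, ← Complex.exp_conj, map_mul, Complex.conj_I, Complex.conj_ofReal]
  simp

/-- The trigonometric polynomial with coefficients `c`. -/
def trigPoly (c : (Fin 3 → ℤ) →₀ ℂ) : C(E3, ℂ) where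
  toFun x := c.sum fun k z => z * expMode k x
  continuous_toFun := continuous_finsetSum _ fun k _ =>
    continuous_const.mul (continuous_expMode k)

theorem inner_basis_mulOp_trigPoly (c : (Fin 3 → ℤ) →₀ ℂ) (k : Fin 3 → ℤ) (g : H) :
    inner ℂ (basis k) (mulOp (trigPoly c) g) = c.sum fun m z => z * inner ℂ (basis (k - m)) g := by
  have hint : ∀ l : Fin 3 → ℤ, Integrable (fun x => conj (expMode l x) * g x)
      (volume.restrict cell) := fun l => by
    have h1 := (memLp_expMode (-l)).integrable_mul (Lp.memLp g)
    refine h1.congr (ae_of_all _ fun x => ?_)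
    simp [conj_expMode]
  have h1 : ∫ x in cell, conj (expMode k x) * mulOp (trigPoly c) g x
      = ∫ x in cell, ∑ m ∈ c.support, c m * (conj (expMode (k - m) x) * g x) := by
    refine integral_congr_ae ?_
    filter_upwards [coeFn_mulOp (trigPoly c) g] with x hx
    rw [hx]
    simp only [trigPoly, ContinuousMap.coe_mk, Finsupp.sum, Finset.sum_mul, Finset.mul_sum]
    refine Finset.sum_congr rfl fun m _ => ?_
    rw [conj_expMode, conj_expMode, neg_sub, sub_eq_add_neg, expMode_add]
    ring
  rw [inner_basis, h1, integral_finsetSum _ fun m _ => (hint _).const_mul _, Finsupp.sum,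
    Finset.mul_sum]
  refine Finset.sum_congr rfl fun m _ => ?_
  rw [integral_const_mul, inner_basis]
  ring

/-- A trigonometric polynomial whose frequencies `m` satisfy `0 < |m|² ≤ R` does not couple modes
of a separated window. -/
theorem winProj_mulOp_trigPoly {κ R N : ℕ} (hN : κ < N) (hsep : Separated κ R N)
    {c : (Fin 3 → ℤ) →₀ ℂ} (hc : ∀ m ∈ c.support, m ≠ 0 ∧ eigenvalue m ≤ R) (f : H) :
    winProj κ N (mulOp (trigPoly c) (winProj κ N f)) = 0 := by
  refine ext_inner_basis fun k => ?_
  rw [inner_basis_winProj hN, inner_zero_right]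
  split_ifs with hk
  · rw [inner_basis_mulOp_trigPoly]
    refine Finset.sum_eq_zero fun m hm => ?_
    simp only []
    rw [inner_basis_winProj hN, if_neg, mul_zero]
    intro hkm
    have h1 := hsep k (k - m) (fun h => (hc m hm).1 (by simpa using sub_eq_self.1 h.symm)) hk hkm
    rw [sub_sub_cancel] at h1
    exact absurd (hc m hm).2 (not_le.2 h1)
  · rfl

theorem integral_cell_expMode (k : Fin 3 → ℤ) :
    ∫ x in cell, expMode k x = if k = 0 then ((2 * Real.pi : ℝ) : ℂ) ^ 3 else 0 := by
  have := orthonormal_integral 0 k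
  simpa [expMode, eq_comm] using this

theorem mean_trigPoly (c : (Fin 3 → ℤ) →₀ ℂ) : mean (trigPoly c) = c 0 := by
  have h1 : ∫ x in cell, trigPoly c x = c 0 * ((2 * Real.pi : ℝ) : ℂ) ^ 3 := by
    simp only [trigPoly, ContinuousMap.coe_mk, Finsupp.sum]
    rw [integral_finsetSum _ fun m _ => ((memLp_expMode m).integrable (by norm_num)).const_mul _]
    simp only [integral_const_mul, integral_cell_expMode, mul_ite, mul_zero]
    rw [Finset.sum_ite_eq' ]
    split_ifs with h
    · rfl
    · rw [Finsupp.notMem_support_iff.1 h, zero_mul]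
  rw [mean, h1]
  have : (Real.pi : ℂ) ≠ 0 := by exact_mod_cast Real.pi_ne_zero
  push_cast
  field_simp

theorem volume_real_cell : volume.real cell = (2 * Real.pi) ^ 3 := by
  have h := integral_cell_expMode 0
  have h1 : ∀ x, expMode 0 x = 1 := fun x => by simp [expMode]
  simp only [h1, if_true] at h
  rw [setIntegral_const, Complex.real_smul, mul_one] at h
  exact_mod_cast h

theorem norm_mean_sub_le {f g : E3 → ℂ} (hf : Continuous f) (hg : Continuous g) {ε : ℝ}
    (h : ∀ x ∈ cell, ‖f x - g x‖ ≤ ε) : ‖mean f - mean g‖ ≤ ε := by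
  have hint : ∀ f : E3 → ℂ, Continuous f → IntegrableOn f cell := fun f hf =>
    (hf.continuousOn.integrableOn_compact isCompact_closedCube).mono_set cell_subset_closedCube
  have hπ := Real.pi_pos
  rw [mean, mean, ← mul_sub, ← integral_sub (hint f hf) (hint g hg), norm_mul]
  have h1 := norm_setIntegral_le_of_norm_le_const volume_cell_lt_top h
  rw [volume_real_cell] at h1
  have h2 : ‖(1 / (2 * (Real.pi : ℂ)) ^ 3)‖ = 1 / (2 * Real.pi) ^ 3 := by
    simp [abs_of_pos hπ]
  rw [h2]
  calc _ ≤ 1 / (2 * Real.pi) ^ 3 * (ε * (2 * Real.pi) ^ 3) := by gcongr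
    _ = ε := by field_simp

/-- Trigonometric approximation, uniform over a class of equicontinuous functions. The range of
frequencies depends only on the bound `K` and on the accuracy, by compactness of the class. -/
theorem exists_trigPoly_uniform (K : ℝ≥0) {ε : ℝ} (hε : 0 < ε) :
    ∃ R : ℕ, ∀ f : E3 → ℂ, LipschitzWith K f → IsPeriodic f → (∀ x, ‖f x‖ ≤ K) → mean f = 0 →
      ∃ c : (Fin 3 → ℤ) →₀ ℂ, (∀ m ∈ c.support, m ≠ 0 ∧ eigenvalue m ≤ R) ∧
        ∀ x ∈ cell, ‖f x - trigPoly c x‖ ≤ ε := by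
  classical
  set Q : Set E3 := {x | ∀ i, x i ∈ Icc (-Real.pi) Real.pi} with hQ
  have : CompactSpace Q := isCompact_iff_compactSpace.1 isCompact_closedCube
  set A : Set (BoundedContinuousFunction Q ℂ) := {g | ∃ f : E3 → ℂ, LipschitzWith K f ∧
    IsPeriodic f ∧ (∀ x, ‖f x‖ ≤ K) ∧ ∀ x : Q, g x = f x} with hA
  have hcomp : IsCompact (closure A) := by
    refine BoundedContinuousFunction.arzela_ascoli (Metric.closedBall 0 K)
      (isCompact_closedBall 0 (K : ℝ)) A ?_ ?_
    · rintro g x ⟨f, -, -, hf, hgf⟩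
      rw [mem_closedBall_zero_iff, hgf]
      exact hf x
    · refine (LipschitzWith.uniformEquicontinuous _ K ?_).equicontinuous
      rintro ⟨g, f, hf, -, -, hgf⟩ x y
      have := hf x y
      simpa [hgf, Subtype.edist_eq] using this
  obtain ⟨t, htA, htf, ht⟩ := (totallyBounded_iff_subset.1
    (hcomp.totallyBounded.subset subset_closure)) _ (Metric.dist_mem_uniformity
      (show (0 : ℝ) < ε / 4 by positivity))
  have hq : ∀ g : A, ∃ c : (Fin 3 → ℤ) →₀ ℂ, ∀ x : Q, ‖g.1 x - trigPoly c x‖ ≤ ε / 4 := by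
    rintro ⟨g, f, hf, hp, -, hgf⟩
    obtain ⟨c, hc⟩ := exists_trigPoly_near hf.continuous hp (show 0 < ε / 4 by positivity)
    exact ⟨c, fun x => by rw [hgf]; exact (hc x).le⟩
  choose c hc using hq
  obtain ⟨R, hR⟩ : ∃ R : ℕ, ∀ (g : A), g.1 ∈ t → ∀ m ∈ (c g).support, eigenvalue m ≤ R := by
    have hfin : (⋃ g ∈ {g : A | g.1 ∈ t}, (((c g).support : Finset _) : Set (Fin 3 → ℤ))).Finite :=
      (Set.Finite.preimage Subtype.val_injective.injOn htf).biUnion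
        fun g _ => Finset.finite_toSet _
    obtain ⟨R, hR⟩ := (hfin.image eigenvalue).bddAbove
    refine ⟨R.toNat, fun g hg m hm => (hR ⟨m, ?_, rfl⟩).trans (Int.self_le_toNat R)⟩
    exact mem_biUnion (show g ∈ {g : A | g.1 ∈ t} from hg) hm
  refine ⟨R, fun f hf hp hb hm => ?_⟩
  set fQ : BoundedContinuousFunction Q ℂ :=
    BoundedContinuousFunction.mkOfCompact ⟨fun x => f x, hf.continuous.comp continuous_subtype_val⟩
  have hfA : fQ ∈ A := ⟨f, hf, hp, hb, fun x => rfl⟩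
  obtain ⟨g, hgt, hg⟩ := mem_iUnion₂.1 (ht hfA)
  set cg := c ⟨g, htA hgt⟩
  have h1 : ∀ x ∈ cell, ‖f x - trigPoly cg x‖ ≤ ε / 2 := by
    intro x hx
    have hx' : x ∈ Q := cell_subset_closedCube hx
    have h2 := hc ⟨g, htA hgt⟩ ⟨x, hx'⟩
    have h3 : dist (fQ ⟨x, hx'⟩) (g ⟨x, hx'⟩) < ε / 4 :=
      (BoundedContinuousFunction.dist_coe_le_dist _).trans_lt hg
    rw [dist_eq_norm] at h3
    calc ‖f x - trigPoly cg x‖ = ‖(f x - g ⟨x, hx'⟩) + (g ⟨x, hx'⟩ - trigPoly cg x)‖ := by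
          congr 1; ring
      _ ≤ ε / 4 + ε / 4 := (norm_add_le _ _).trans (add_le_add h3.le h2)
      _ = ε / 2 := by ring
  have h0 : ‖cg 0‖ ≤ ε / 2 := by
    have := norm_mean_sub_le hf.continuous (trigPoly cg).continuous h1
    rwa [hm, mean_trigPoly, zero_sub, norm_neg] at this
  refine ⟨cg.erase 0, fun m hm' => ?_, fun x hx => ?_⟩
  · rw [Finsupp.support_erase, Finset.mem_erase] at hm'
    exact ⟨hm'.1, hR _ hgt m hm'.2⟩
  · have h2 : trigPoly cg x = cg 0 + trigPoly (cg.erase 0) x := by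
      have h3 := Finsupp.add_sum_erase' cg 0 (fun k z => z * expMode k x) (by simp)
      have h4 : expMode 0 x = 1 := by simp [expMode]
      rw [h4, mul_one] at h3
      exact h3.symm
    calc ‖f x - trigPoly (cg.erase 0) x‖ = ‖(f x - trigPoly cg x) + cg 0‖ := by
          rw [h2]; congr 1; ring
      _ ≤ ε / 2 + ε / 2 := (norm_add_le _ _).trans (add_le_add (h1 x hx) h0)
      _ = ε := by ring

/-- Spatial averaging: between modes of a separated window, multiplication by a function of zero
mean is small. -/
theorem spatial_averaging (K : ℝ≥0) {ε : ℝ} (hε : 0 < ε) :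
    ∃ R : ℕ, ∀ κ N : ℕ, κ < N → Separated κ R N → ∀ f : C(E3, ℂ), LipschitzWith K f →
      IsPeriodic f → (∀ x, ‖f x‖ ≤ K) → mean f = 0 → ∀ g : H,
        ‖winProj κ N (mulOp f (winProj κ N g))‖ ≤ ε * ‖g‖ := by
  obtain ⟨R, hR⟩ := exists_trigPoly_uniform K (show 0 < ε / 4 by positivity)
  refine ⟨R, fun κ N hN hsep f hf hp hb hm g => ?_⟩
  obtain ⟨c, hc, hfc⟩ := hR f hf hp hb hm
  have h1 : mulOp f = mulOp (f - trigPoly c) + mulOp (trigPoly c) := by rw [mulOp_sub]; simp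
  rw [h1, add_apply, map_add, winProj_mulOp_trigPoly hN hsep hc, add_zero]
  have h2 : ‖mulOp (f - trigPoly c)‖ ≤ ε / 4 := norm_mulOp_le (by positivity) hfc
  have h3 := norm_winProj_le κ N
  calc _ ≤ ‖winProj κ N‖ * (‖mulOp (f - trigPoly c)‖ * (‖winProj κ N‖ * ‖g‖)) := by
        refine (ContinuousLinearMap.le_opNorm _ _).trans ?_
        gcongr
        refine (ContinuousLinearMap.le_opNorm _ _).trans ?_
        gcongr
        exact ContinuousLinearMap.le_opNorm _ _
    _ ≤ 2 * (ε / 4 * (2 * ‖g‖)) := by gcongr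
    _ = ε * ‖g‖ := by ring

/-! ### The weighted spaces on the half-line -/

section Weight

variable {E : Type*} [NormedAddCommGroup E]

theorem measurable_weight_density (θ : ℝ) :
    Measurable fun t : ℝ => ENNReal.ofReal (Real.exp (2 * θ * t)) := by fun_prop

theorem ae_weight_iff {θ : ℝ} {p : ℝ → Prop} :
    (∀ᵐ t ∂(weight θ), p t) ↔ ∀ᵐ t ∂(volume.restrict (Iic (0 : ℝ))), p t := by
  rw [weight, ae_withDensity_iff (measurable_weight_density θ)]
  simp [Real.exp_pos]

theorem aestronglyMeasurable_weight_iff {θ : ℝ} {f : ℝ → E} :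
    AEStronglyMeasurable f (weight θ) ↔ AEStronglyMeasurable f (volume.restrict (Iic (0 : ℝ))) := by
  constructor
  · rintro ⟨g, hg, hfg⟩
    exact ⟨g, hg, ae_weight_iff.1 hfg⟩
  · rintro ⟨g, hg, hfg⟩
    exact ⟨g, hg, ae_weight_iff.2 hfg⟩

theorem lintegral_weight (θ : ℝ) {g : ℝ → ℝ≥0∞} (hg : AEMeasurable g (volume.restrict (Iic 0))) :
    ∫⁻ t, g t ∂(weight θ) = ∫⁻ t in Iic 0, ENNReal.ofReal (Real.exp (2 * θ * t)) * g t := by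
  rw [weight, lintegral_withDensity_eq_lintegral_mul₀ (measurable_weight_density θ).aemeasurable hg]
  rfl

theorem eLpNorm_two_sq {α : Type*} [MeasurableSpace α] (μ : Measure α) (f : α → E) :
    eLpNorm f 2 μ ^ 2 = ∫⁻ a, ‖f a‖ₑ ^ 2 ∂μ := by
  have := eLpNorm_nnreal_pow_eq_lintegral (f := f) (μ := μ) (p := 2) two_ne_zero
  simpa using this

theorem coeFn_toLp_weight {θ : ℝ} {f : ℝ → E} (hf : MemLp f 2 (weight θ)) :
    ∀ᵐ t ∂(volume.restrict (Iic (0 : ℝ))), hf.toLp f t = f t :=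
  ae_weight_iff.1 hf.coeFn_toLp

variable [NormedSpace ℂ E]

theorem integral_weight (θ : ℝ) (g : ℝ → E) :
    ∫ t, g t ∂(weight θ) = ∫ t in Iic 0, (Real.exp (2 * θ * t) : ℂ) • g t := by
  rw [weight, integral_withDensity_eq_integral_toReal_smul (measurable_weight_density θ)
    (ae_of_all _ fun _ => ENNReal.ofReal_lt_top)]
  refine integral_congr_ae (ae_of_all _ fun t => ?_)
  simp only [ENNReal.toReal_ofReal (Real.exp_pos _).le]
  rw [RCLike.real_smul_eq_coe_smul (K := ℂ)]
  rfl

theorem weight_enorm_sq (θ t : ℝ) (z : E) :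
    ENNReal.ofReal (Real.exp (2 * θ * t)) * ‖z‖ₑ ^ 2 = ‖(Real.exp (θ * t) : ℂ) • z‖ₑ ^ 2 := by
  have h : ‖(Real.exp (θ * t) : ℂ)‖ₑ = ENNReal.ofReal (Real.exp (θ * t)) := by
    rw [← ofReal_norm, Complex.norm_real, Real.norm_of_nonneg (Real.exp_pos _).le]
  rw [enorm_smul, mul_pow, h, ← ENNReal.ofReal_pow (Real.exp_pos _).le, ← Real.exp_nat_mul]
  congr 3
  push_cast
  ring_nf

theorem eLpNorm_weight {θ : ℝ} {f : ℝ → E}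
    (hf : AEStronglyMeasurable f (volume.restrict (Iic (0 : ℝ)))) :
    eLpNorm f 2 (weight θ)
      = eLpNorm (fun t => (Real.exp (θ * t) : ℂ) • f t) 2 (volume.restrict (Iic 0)) := by
  refine (ENNReal.pow_right_strictMono two_ne_zero).injective ?_
  show eLpNorm f 2 (weight θ) ^ 2 = _ ^ 2
  rw [eLpNorm_two_sq, eLpNorm_two_sq, lintegral_weight θ (hf.enorm.pow_const 2)]
  simp_rw [weight_enorm_sq]

theorem memLp_weight_iff {θ : ℝ} {f : ℝ → E} :
    MemLp f 2 (weight θ) ↔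
      MemLp (fun t => (Real.exp (θ * t) : ℂ) • f t) 2 (volume.restrict (Iic 0)) := by
  have hm : AEStronglyMeasurable f (volume.restrict (Iic (0 : ℝ))) ↔
      AEStronglyMeasurable (fun t => (Real.exp (θ * t) : ℂ) • f t) (volume.restrict (Iic 0)) := by
    constructor
    · intro h
      exact (by fun_prop : Continuous fun t : ℝ =>
        (Real.exp (θ * t) : ℂ)).aestronglyMeasurable.smul h
    · intro h
      have := (by fun_prop : Continuous fun t : ℝ =>
        (Real.exp (-(θ * t)) : ℂ)).aestronglyMeasurable.smul h
      refine this.congr (ae_of_all _ fun t => ?_)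
      simp only [Pi.smul_apply', smul_smul]
      rw [← Complex.ofReal_mul, ← Real.exp_add]
      simp
  constructor
  · intro h
    have h1 := aestronglyMeasurable_weight_iff.1 h.1
    exact ⟨hm.1 h1, by rw [← eLpNorm_weight h1]; exact h.2⟩
  · intro h
    have h1 := hm.2 h.1
    exact ⟨aestronglyMeasurable_weight_iff.2 h1, by rw [eLpNorm_weight h1]; exact h.2⟩

theorem integrableOn_Icc_of_memLp {θ : ℝ} {f : ℝ → E} (hf : MemLp f 2 (weight θ)) (a : ℝ) :
    IntegrableOn f (Icc a 0) := by
  have h1 := memLp_weight_iff.1 hf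
  have h2 : IntegrableOn (fun t => (Real.exp (θ * t) : ℂ) • f t) (Icc a 0) := by
    have h3 := h1.mono_measure (Measure.restrict_mono_set volume
      (Icc_subset_Iic_self : Icc a 0 ⊆ Iic 0))
    exact h3.integrable (by norm_num)
  have h3 := IntegrableOn.continuousOn_smul (f := fun t : ℝ => (Real.exp (-(θ * t)) : ℂ)) h2
    (by fun_prop : Continuous fun t : ℝ => (Real.exp (-(θ * t)) : ℂ)).continuousOn isCompact_Icc
  refine h3.congr_fun (fun t _ => ?_) measurableSet_Icc
  simp only [smul_smul]
  rw [← Complex.ofReal_mul, ← Real.exp_add]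
  simp

/-- On the half-line of negative times, `e^{-νt}` is square integrable against the weight when
`Re ν < θ`. -/
theorem memLp_exp {θ : ℝ} {ν : ℂ} (hν : ν.re < θ) :
    MemLp (fun t : ℝ => Complex.exp (-ν * t)) 2 (weight θ) := by
  have hc : Continuous fun t : ℝ => Complex.exp (-ν * t) := by fun_prop
  rw [memLp_weight_iff, memLp_two_iff_integrable_sq_norm
    (by fun_prop : Continuous fun t : ℝ =>
      (Real.exp (θ * t) : ℂ) • Complex.exp (-ν * t)).aestronglyMeasurable]
  have h1 : ∀ t : ℝ, ‖(Real.exp (θ * t) : ℂ) • Complex.exp (-ν * t)‖ ^ 2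
      = Real.exp (2 * (θ - ν.re) * t) := fun t => by
    rw [norm_smul, Complex.norm_real, Real.norm_of_nonneg (Real.exp_pos _).le, Complex.norm_exp,
      ← Real.exp_add, ← Real.exp_nat_mul]
    congr 1
    simp
    ring
  simp_rw [h1]
  exact integrableOn_exp_mul_Iic (by linarith) 0

/-- The exponential `e^{-νt}` as an element of the weighted space. -/
def expLp {θ : ℝ} {ν : ℂ} (hν : ν.re < θ) : Lp ℂ 2 (weight θ) := (memLp_exp hν).toLp

theorem norm_expLp_sq {θ : ℝ} {ν : ℂ} (hν : ν.re < θ) :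
    ‖expLp hν‖ ^ 2 = 1 / (2 * (θ - ν.re)) := by
  have h0 : ‖expLp hν‖ ^ 2 = (∫ t, ‖expLp hν t‖ ^ 2 ∂(weight θ)) := by
    rw [← real_inner_self_eq_norm_sq, L2.inner_def]
    refine integral_congr_ae (ae_of_all _ fun t => ?_)
    simp only [real_inner_self_eq_norm_sq]
  rw [h0, integral_congr_ae ((memLp_exp hν).coeFn_toLp.mono fun t ht => by
    show ‖expLp hν t‖ ^ 2 = ‖Complex.exp (-ν * t)‖ ^ 2
    rw [expLp, ht]), weight, integral_withDensity_eq_integral_toReal_smul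
    (measurable_weight_density θ) (ae_of_all _ fun _ => ENNReal.ofReal_lt_top)]
  have h1 : ∀ t : ℝ, (ENNReal.ofReal (Real.exp (2 * θ * t))).toReal • ‖Complex.exp (-ν * t)‖ ^ 2
      = Real.exp (2 * (θ - ν.re) * t) := fun t => by
    rw [ENNReal.toReal_ofReal (Real.exp_pos _).le, Complex.norm_exp, smul_eq_mul,
      ← Real.exp_nat_mul, ← Real.exp_add]
    congr 1
    simp
    ring
  simp_rw [h1]
  rw [integral_exp_mul_Iic (by linarith) 0]
  simp

theorem inner_weight {θ : ℝ} (f g : Lp ℂ 2 (weight θ)) :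
    inner ℂ f g = ∫ t in Iic 0, (Real.exp (2 * θ * t) : ℂ) * (conj (f t) * g t) := by
  rw [L2.inner_def, integral_weight]
  refine integral_congr_ae (ae_of_all _ fun t => ?_)
  simp [RCLike.inner_apply, mul_comm]

/-- On the half-line of negative times, `e^{-νt}` is not square integrable against the weight when
`Re ν ≥ θ`. -/
theorem eq_zero_of_memLp_exp {θ : ℝ} {ν : ℂ} (hν : θ ≤ ν.re) {C : ℂ}
    (h : MemLp (fun t : ℝ => Complex.exp (-ν * t) * C) 2 (weight θ)) : C = 0 := by
  by_contra hC
  have h1 := (memLp_weight_iff.1 h).2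
  have h2 : (∫⁻ t in Iic (0 : ℝ), ENNReal.ofReal (‖C‖ ^ 2)) < ∞ := by
    have h3 := ENNReal.pow_lt_top (n := 2) h1
    rw [eLpNorm_two_sq] at h3
    refine lt_of_le_of_lt (setLIntegral_mono' measurableSet_Iic fun t ht => ?_) h3
    have h4 : ‖C‖ ≤ ‖(Real.exp (θ * t) : ℂ) • (Complex.exp (-ν * t) * C)‖ := by
      rw [norm_smul, norm_mul, Complex.norm_real, Real.norm_of_nonneg (Real.exp_pos _).le,
        Complex.norm_exp, ← mul_assoc, ← Real.exp_add]
      refine le_mul_of_one_le_left (norm_nonneg _) (Real.one_le_exp ?_)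
      simp only [Complex.mul_re, Complex.neg_re, Complex.ofReal_re, Complex.neg_im,
        Complex.ofReal_im, mul_zero, sub_zero]
      have : t ≤ 0 := ht
      nlinarith
    rw [← ofReal_norm, ← ENNReal.ofReal_pow (norm_nonneg _)]
    exact ENNReal.ofReal_le_ofReal (pow_le_pow_left₀ (norm_nonneg _) h4 2)
  have h5 : ENNReal.ofReal (‖C‖ ^ 2) ≠ 0 := by
    simp [hC]
  rw [setLIntegral_const, Real.volume_Iic, ENNReal.mul_top h5] at h2
  exact lt_irrefl _ h2

end Weight

/-! ### Integration by parts and a lemma of du Bois-Reymond -/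

/-- Continuously differentiable test functions on `(-∞, 0)`, with their derivative. -/
structure IsC1Test (χ χ' : ℝ → ℂ) : Prop where
  hasDerivAt : ∀ t, HasDerivAt χ (χ' t) t
  continuous_deriv : Continuous χ'
  support : ∃ a r : ℝ, r < 0 ∧ ∀ t, t ∉ Icc a r → χ t = 0

namespace IsC1Test

variable {χ χ' : ℝ → ℂ}

theorem exists_support (h : IsC1Test χ χ') :
    ∃ a < (0 : ℝ), ∀ t, t ∉ Ioo a 0 → χ t = 0 ∧ χ' t = 0 := by
  obtain ⟨a, r, hr, hs⟩ := h.support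
  refine ⟨min a 0 - 1, by linarith [min_le_right a 0], fun t ht => ?_⟩
  have h1 : t ∈ (Icc a r)ᶜ := fun h2 => ht
    ⟨by linarith [min_le_left a 0, h2.1], lt_of_le_of_lt h2.2 hr⟩
  refine ⟨hs t h1, ?_⟩
  have h2 : χ =ᶠ[nhds t] fun _ => 0 := by
    filter_upwards [isClosed_Icc.isOpen_compl.mem_nhds h1] with s hs'
    exact hs s hs'
  exact (h.hasDerivAt t).unique ((hasDerivAt_const t (0 : ℂ)).congr_of_eventuallyEq h2)

theorem continuous (h : IsC1Test χ χ') : Continuous χ :=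
  continuous_iff_continuousAt.2 fun t => (h.hasDerivAt t).continuousAt

theorem exp_mul (h : IsC1Test χ χ') (μ : ℂ) :
    IsC1Test (fun t => Complex.exp (μ * t) * χ t)
      (fun t => Complex.exp (μ * t) * (χ' t + μ * χ t)) where
  hasDerivAt t := by
    have h1 : HasDerivAt (fun t : ℝ => Complex.exp (μ * t)) (Complex.exp (μ * t) * μ) t := by
      have := ((hasDerivAt_id (t : ℂ)).const_mul μ).cexp.comp_ofReal
      simpa using this
    refine (h1.mul (h.hasDerivAt t)).congr_deriv ?_
    ring
  continuous_deriv := by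
    have := h.continuous
    have := h.continuous_deriv
    fun_prop
  support := by
    obtain ⟨a, r, hr, hs⟩ := h.support
    exact ⟨a, r, hr, fun t ht => by rw [hs t ht, mul_zero]⟩

end IsC1Test

theorem setIntegral_Iio_eq_Ioc {E : Type*} [NormedAddCommGroup E] [NormedSpace ℝ E]
    {G : ℝ → E} {a : ℝ} (hG : ∀ t, t ∉ Ioo a 0 → G t = 0) :
    ∫ t in Iio 0, G t = ∫ t in Ioc a 0, G t := by
  rw [setIntegral_eq_integral_of_forall_compl_eq_zero (s := Iio 0)
      fun t ht => hG t fun h => ht h.2,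
    setIntegral_eq_integral_of_forall_compl_eq_zero (s := Ioc a 0)
      fun t ht => hG t fun h => ht ⟨h.1, h.2.le⟩]

/-- Integration by parts against a primitive of an integrable function. -/
theorem integral_primitive_mul_deriv {F χ χ' : ℝ → ℂ} {a b : ℝ}
    (hF : IntegrableOn F (Ioc a b)) (hχ : ∀ t, HasDerivAt χ (χ' t) t) (hχ' : Continuous χ')
    (hb : χ b = 0) :
    ∫ t in Ioc a b, (∫ s in Ioc a t, F s) * χ' t = -∫ s in Ioc a b, F s * χ s := by
  have hint : Integrable (fun p : ℝ × ℝ => {q : ℝ × ℝ | q.2 ≤ q.1}.indicator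
      (fun q => χ' q.1 * F q.2) p) ((volume.restrict (Ioc a b)).prod (volume.restrict (Ioc a b))) := by
    refine Integrable.indicator ?_ (measurableSet_le measurable_snd measurable_fst)
    exact Integrable.mul_prod (hχ'.integrableOn_Ioc) hF
  have h1 : ∀ t ∈ Ioc a b, (∫ s in Ioc a t, F s) * χ' t
      = ∫ s in Ioc a b, {q : ℝ × ℝ | q.2 ≤ q.1}.indicator (fun q => χ' q.1 * F q.2) (t, s) := by
    intro t ht
    have h2 : ∀ s, {q : ℝ × ℝ | q.2 ≤ q.1}.indicator (fun q => χ' q.1 * F q.2) (t, s)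
        = (Iic t).indicator (fun s => χ' t * F s) s := fun s => by
      by_cases hs : s ≤ t <;> simp [indicator, hs]
    simp_rw [h2]
    rw [setIntegral_indicator measurableSet_Iic, Ioc_inter_Iic, min_eq_right ht.2,
      integral_const_mul, mul_comm]
  have h3 : ∀ s ∈ Ioc a b, ∫ t in Ioc a b,
      {q : ℝ × ℝ | q.2 ≤ q.1}.indicator (fun q => χ' q.1 * F q.2) (t, s) = -(F s * χ s) := by
    intro s hs
    have h2 : ∀ t, {q : ℝ × ℝ | q.2 ≤ q.1}.indicator (fun q => χ' q.1 * F q.2) (t, s)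
        = (Ici s).indicator (fun t => χ' t * F s) t := fun t => by
      by_cases hs : s ≤ t <;> simp [indicator, hs]
    simp_rw [h2]
    rw [setIntegral_indicator measurableSet_Ici, integral_mul_const]
    have h4 : Ioc a b ∩ Ici s = Icc s b := by
      ext t
      simp only [mem_inter_iff, mem_Ioc, mem_Ici, mem_Icc]
      exact ⟨fun h => ⟨h.2, h.1.2⟩, fun h => ⟨⟨hs.1.trans_le h.1, h.2⟩, h.1⟩⟩
    rw [h4, integral_Icc_eq_integral_Ioc, ← intervalIntegral.integral_of_le hs.2,
      intervalIntegral.integral_eq_sub_of_hasDerivAt (fun t _ => hχ t)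
        (hχ'.intervalIntegrable _ _), hb]
    ring
  rw [setIntegral_congr_fun measurableSet_Ioc h1, integral_integral_swap hint,
    setIntegral_congr_fun measurableSet_Ioc h3, integral_neg]

/-- Smooth complex-valued test functions on `(-∞, 0)`. -/
structure IsSmoothTest (χ : ℝ → ℂ) : Prop where
  contDiff : ContDiff ℝ ((⊤ : ℕ∞) : WithTop ℕ∞) χ
  support : ∃ a r : ℝ, r < 0 ∧ ∀ t, t ∉ Icc a r → χ t = 0

theorem IsSmoothTest.isC1Test {χ : ℝ → ℂ} (h : IsSmoothTest χ) : IsC1Test χ (deriv χ) where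
  hasDerivAt t := (h.contDiff.differentiable (by simp) t).hasDerivAt
  continuous_deriv := h.contDiff.continuous_deriv (by simp)
  support := h.support

theorem IsSmoothTest.exp_mul {χ : ℝ → ℂ} (h : IsSmoothTest χ) (μ : ℂ) :
    IsSmoothTest fun t => Complex.exp (μ * t) * χ t where
  contDiff := by
    have := h.contDiff
    have h1 : ContDiff ℝ ((⊤ : ℕ∞) : WithTop ℕ∞) fun t : ℝ => (t : ℂ) := Complex.ofRealCLM.contDiff
    exact ((contDiff_const.mul h1).cexp).mul this
  support := by
    obtain ⟨a, r, hr, hs⟩ := h.support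
    exact ⟨a, r, hr, fun t ht => by rw [hs t ht, mul_zero]⟩

/-- Du Bois-Reymond: a function on `(-∞, 0)` with zero distributional derivative is constant. -/
theorem exists_ae_eq_const {ζ : ℝ → ℂ} (hζ : ∀ a, IntegrableOn ζ (Icc a 0))
    (h : ∀ χ, IsSmoothTest χ → ∫ t in Iio 0, ζ t * deriv χ t = 0) :
    ∃ C, ∀ᵐ t ∂(volume.restrict (Iio (0 : ℝ))), ζ t = C := by
  set β : ContDiffBump (-2 : ℝ) := ⟨1 / 2, 1, by norm_num, by norm_num⟩ with hβ
  set η₀ : ℝ → ℝ := β.normed volume with hη₀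
  have hη₀s : ∀ t, t ∉ Icc (-3 : ℝ) (-1) → η₀ t = 0 := fun t ht => by
    by_contra h0
    have h1 : t ∈ Function.support η₀ := h0
    rw [hη₀, β.support_normed_eq, Real.ball_eq_Ioo] at h1
    exact ht ⟨by linarith [h1.1], by linarith [h1.2]⟩
  have hη₀c : ContDiff ℝ ((⊤ : ℕ∞) : WithTop ℕ∞) η₀ := β.contDiff_normed
  have hη₀1 : ∫ t, η₀ t = 1 := β.integral_normed
  have hζint : ∀ (η : ℝ → ℝ) (a : ℝ), Continuous η → (∀ t, t ∉ Ioo a 0 → η t = 0) →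
      IntegrableOn (fun t => ζ t * (η t : ℂ)) (Iio 0) := by
    intro η a hη hs
    have h1 : IntegrableOn (fun t => ζ t * (η t : ℂ)) (Icc a 0) :=
      (hζ a).mul_continuousOn (Complex.continuous_ofReal.comp hη).continuousOn isCompact_Icc
    refine (integrableOn_iff_integrable_of_support_subset (s := Icc a 0) ?_).1 h1 |>.integrableOn
    intro t ht
    by_contra h2
    exact ht (by simp [hs t fun h3 => h2 ⟨h3.1.le, h3.2.le⟩])
  refine ⟨∫ t in Iio 0, ζ t * (η₀ t : ℂ), ?_⟩
  set C := ∫ t in Iio 0, ζ t * (η₀ t : ℂ) with hC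
  have hloc : LocallyIntegrableOn (fun t => ζ t - C) (Iio 0) := by
    intro t ht
    refine ⟨Icc (t - 1) 0, mem_nhdsWithin_of_mem_nhds (Icc_mem_nhds (by linarith) ht), ?_⟩
    exact (hζ _).sub (by simp)
  have key := isOpen_Iio.ae_eq_zero_of_integral_contDiff_smul_eq_zero hloc (fun η hη hηc hηs => ?_)
  · rw [ae_restrict_iff' measurableSet_Iio]
    filter_upwards [key] with t ht h0
    exact sub_eq_zero.1 (ht h0)
  · -- the test function whose derivative is `η - (∫ η) η₀`
    obtain ⟨a, r, hr, har⟩ : ∃ a r : ℝ, r < 0 ∧ ∀ t, t ∉ Icc a r → η t = 0 := by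
      rcases (tsupport η).eq_empty_or_nonempty with he | hne
      · refine ⟨-1, -1, by norm_num, fun t _ => ?_⟩
        exact image_eq_zero_of_notMem_tsupport (by rw [he]; exact notMem_empty t)
      · have hcomp : IsCompact (tsupport η) := hηc
        refine ⟨sInf (tsupport η), sSup (tsupport η), hηs (hcomp.sSup_mem hne), fun t ht => ?_⟩
        refine image_eq_zero_of_notMem_tsupport fun h1 => ht ⟨?_, ?_⟩
        · exact csInf_le hcomp.bddBelow h1
        · exact le_csSup hcomp.bddAbove h1
    set I := ∫ t, η t with hI
    set a' := min a (-3) - 1 with ha'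
    set r' := max r (-1) with hr'
    have hr'0 : r' < 0 := max_lt hr (by norm_num)
    set ρ : ℝ → ℝ := fun t => η t - I * η₀ t with hρ
    have hρs : ∀ t, t ∉ Icc (a' + 1) r' → ρ t = 0 := fun t ht => by
      simp only [hρ]
      rw [har t ?_, hη₀s t ?_, mul_zero, sub_zero]
      · exact fun h1 => ht ⟨by linarith [min_le_right a (-3), h1.1], h1.2.trans (le_max_right _ _)⟩
      · exact fun h1 => ht ⟨by linarith [min_le_left a (-3), h1.1], h1.2.trans (le_max_left _ _)⟩
    have hρc : ContDiff ℝ ((⊤ : ℕ∞) : WithTop ℕ∞) ρ := hη.sub (contDiff_const.mul hη₀c)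
    have hηint : Integrable η := hη.continuous.integrable_of_hasCompactSupport hηc
    have hη₀int : Integrable η₀ := β.integrable_normed
    have hρ0 : ∫ t, ρ t = 0 := by
      simp only [hρ]
      rw [integral_sub hηint (hη₀int.const_mul I), integral_const_mul, hη₀1, mul_one, sub_self]
    set Φ : ℝ → ℝ := fun t => ∫ s in a'..t, ρ s with hΦ
    have hΦd : ∀ t, HasDerivAt Φ (ρ t) t := fun t =>
      intervalIntegral.integral_hasDerivAt_right (hρc.continuous.intervalIntegrable _ _)
        hρc.continuous.aestronglyMeasurable.stronglyMeasurableAtFilter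
        hρc.continuous.continuousAt
    have hΦc : ContDiff ℝ ((⊤ : ℕ∞) : WithTop ℕ∞) Φ := by
      rw [contDiff_infty_iff_deriv]
      refine ⟨fun t => (hΦd t).differentiableAt, ?_⟩
      rwa [show deriv Φ = ρ from funext fun t => (hΦd t).deriv]
    have hΦs : ∀ t, t ∉ Icc a' r' → Φ t = 0 := by
      intro t ht
      rcases lt_or_ge t a' with h1 | h1
      · refine intervalIntegral.integral_zero_ae (ae_of_all _ fun s hs => hρs s fun h2 => ?_)
        rw [uIoc_of_ge h1.le] at hs
        linarith [h2.1, hs.2]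
      · have h2 : r' < t := not_le.1 fun h3 => ht ⟨h1, h3⟩
        simp only [hΦ]
        rw [intervalIntegral.integral_of_le h1, ← hρ0]
        refine setIntegral_eq_integral_of_forall_compl_eq_zero fun s hs => hρs s fun h3 => hs ?_
        exact ⟨by linarith [h3.1], by linarith [h3.2]⟩
    have htest : IsSmoothTest fun t => (Φ t : ℂ) :=
      ⟨Complex.ofRealCLM.contDiff.comp hΦc, a', r', hr'0, fun t ht => by rw [hΦs t ht]; simp⟩
    have h1 := h _ htest
    have h2 : ∀ t, deriv (fun t => (Φ t : ℂ)) t = (η t : ℂ) - I * (η₀ t : ℂ) := fun t => by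
      rw [(hΦd t).ofReal_comp.deriv]
      simp [hρ]
    have hη_supp : ∀ t, t ∉ Ioo (a - 1) 0 → η t = 0 := fun t ht => har t fun h3 =>
      ht ⟨by linarith [h3.1], by linarith [h3.2]⟩
    have hη₀_supp : ∀ t, t ∉ Ioo (-4 : ℝ) 0 → η₀ t = 0 := fun t ht => hη₀s t fun h3 =>
      ht ⟨by linarith [h3.1], by linarith [h3.2]⟩
    have h3 : ∫ t in Iio 0, ζ t * deriv (fun t => (Φ t : ℂ)) t
        = (∫ t in Iio 0, ζ t * (η t : ℂ)) - I * C := by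
      rw [hC, ← integral_const_mul, ← integral_sub (hζint η _ hη.continuous hη_supp)
        ((hζint η₀ _ hη₀c.continuous hη₀_supp).const_mul _)]
      refine integral_congr_ae (ae_of_all _ fun t => ?_)
      simp only [h2]
      ring
    have h4 : ∫ t in Iio 0, (η t : ℂ) = I := by
      rw [setIntegral_eq_integral_of_forall_compl_eq_zero fun t ht => by
        rw [hη_supp t fun h3 => ht h3.2]; simp, integral_complex_ofReal]
    have h5 : ∫ t, η t • (ζ t - C) = ∫ t in Iio 0, η t • (ζ t - C) :=
      (setIntegral_eq_integral_of_forall_compl_eq_zero fun t ht => by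
        rw [hη_supp t fun h3 => ht h3.2]; simp).symm
    have h6 : ∫ t in Iio 0, η t • (ζ t - C)
        = (∫ t in Iio 0, ζ t * (η t : ℂ)) - (∫ t in Iio 0, (η t : ℂ)) * C := by
      have h7 : IntegrableOn (fun t => (η t : ℂ) * C) (Iio 0) :=
        ((hηint.ofReal (𝕜 := ℂ)).mul_const C).integrableOn
      rw [← integral_mul_const, ← integral_sub (hζint η _ hη.continuous hη_supp) h7]
      refine integral_congr_ae (ae_of_all _ fun t => ?_)
      simp only [Complex.real_smul]
      ring
    rw [h5, h6, h4, ← h3, h1]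

/-! ### The scalar equation `y' + μ y = f` on the half-line -/

/-- The symmetric Schur test. -/
theorem lintegral_schur {α : Type*} [MeasurableSpace α] {ν : Measure α} [SFinite ν]
    {k : α → α → ℝ≥0∞} (hk : Measurable (Function.uncurry k)) {c : ℝ≥0∞}
    (h1 : ∀ t, ∫⁻ s, k t s ∂ν ≤ c) (h2 : ∀ s, ∫⁻ t, k t s ∂ν ≤ c)
    {G : α → ℝ≥0∞} (hG : AEMeasurable G ν) :
    ∫⁻ t, (∫⁻ s, k t s * G s ∂ν) ^ 2 ∂ν ≤ c ^ 2 * ∫⁻ s, G s ^ 2 ∂ν := by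
  have hks : ∀ t, Measurable (k t) := fun t => hk.comp measurable_prodMk_left
  have hcs : ∀ t, (∫⁻ s, k t s * G s ∂ν) ^ 2 ≤ c * ∫⁻ s, k t s * G s ^ 2 ∂ν := by
    intro t
    have h3 := ENNReal.lintegral_mul_le_Lp_mul_Lq ν Real.HolderConjugate.two_two
      ((hks t).pow_const (1 / 2 : ℝ)).aemeasurable
      (((hks t).pow_const (1 / 2 : ℝ)).aemeasurable.mul hG)
    have h4 : ∀ z : ℝ≥0∞, z ^ (1 / 2 : ℝ) * z ^ (1 / 2 : ℝ) = z := fun z => by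
      rw [← ENNReal.rpow_add_of_nonneg _ _ (by norm_num) (by norm_num)]
      norm_num
    have h5 : ∀ z : ℝ≥0∞, (z ^ (1 / 2 : ℝ)) ^ 2 = z := fun z => by rw [sq, h4]
    simp only [Pi.mul_apply, ENNReal.rpow_two, mul_pow, h5, ← mul_assoc, h4] at h3
    calc (∫⁻ s, k t s * G s ∂ν) ^ 2
        ≤ ((∫⁻ s, k t s ∂ν) ^ (1 / 2 : ℝ) * (∫⁻ s, k t s * G s ^ 2 ∂ν) ^ (1 / 2 : ℝ)) ^ 2 := by
          gcongr
      _ = (∫⁻ s, k t s ∂ν) * ∫⁻ s, k t s * G s ^ 2 ∂ν := by rw [mul_pow, h5, h5]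
      _ ≤ c * ∫⁻ s, k t s * G s ^ 2 ∂ν := by gcongr; exact h1 t
  have hG2 : AEMeasurable (Function.uncurry fun t s => k t s * G s ^ 2) (ν.prod ν) :=
    hk.aemeasurable.mul ((hG.pow_const 2).comp_quasiMeasurePreserving
      Measure.quasiMeasurePreserving_snd)
  calc ∫⁻ t, (∫⁻ s, k t s * G s ∂ν) ^ 2 ∂ν
      ≤ ∫⁻ t, c * ∫⁻ s, k t s * G s ^ 2 ∂ν ∂ν := lintegral_mono hcs
    _ = c * ∫⁻ t, ∫⁻ s, k t s * G s ^ 2 ∂ν ∂ν := lintegral_const_mul'' _ hG2.lintegral_prod_right'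
    _ = c * ∫⁻ s, ∫⁻ t, k t s * G s ^ 2 ∂ν ∂ν := by rw [lintegral_lintegral_swap hG2]
    _ ≤ c * ∫⁻ s, c * G s ^ 2 ∂ν := by
      gcongr with s
      rw [lintegral_mul_const (f := fun t => k t s) _ (hk.comp measurable_prodMk_right)]
      gcongr
      exact h2 s
    _ = c ^ 2 * ∫⁻ s, G s ^ 2 ∂ν := by
      rw [lintegral_const_mul'' _ (hG.pow_const 2), ← mul_assoc, sq]

theorem lintegral_exp_neg_abs {d : ℝ} (hd : 0 < d) (t : ℝ) :
    ∫⁻ s, ENNReal.ofReal (Real.exp (-d * |t - s|)) ≤ ENNReal.ofReal (2 / d) := by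
  rw [lintegral_sub_left_eq_self (fun x => ENNReal.ofReal (Real.exp (-d * |x|))) t]
  have h2 : ∫ x : ℝ, Real.exp (-d * |x|) = 2 / d := by
    rw [integral_comp_abs (f := fun x => Real.exp (-d * x)), integral_exp_mul_Ioi (by linarith) 0]
    simp
    ring
  have h3 : Integrable fun x : ℝ => Real.exp (-d * |x|) := by
    by_contra h
    rw [integral_undef h] at h2
    have : 0 < 2 / d := by positivity
    linarith
  rw [← ofReal_integral_eq_lintegral_ofReal h3 (ae_of_all _ fun _ => (Real.exp_pos _).le), h2]

/-- The function `e^{μs} f(s)`, cut off at positive times. -/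
def twist (μ : ℂ) (f : ℝ → ℂ) : ℝ → ℂ := (Iic 0).indicator fun s => Complex.exp (μ * s) * f s

/-- The solution of `y' + μ y = f` on `(-∞, 0]` with `y(0) = C`. -/
def odeSol (μ : ℂ) (f : ℝ → ℂ) (C : ℂ) (t : ℝ) : ℂ :=
  Complex.exp (-μ * t) * (C + ∫ s in (0 : ℝ)..t, twist μ f s)

/-- The final value of the solution of `y' + μ y = f` that is selected by the weight `e^{θt}`: zero
if `Re μ < θ`, when all solutions belong to the weighted space, and if `Re μ > θ` (a stable mode) the
value of the only solution that does. -/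
def finalValue (θ : ℝ) (μ : ℂ) (f : ℝ → ℂ) : ℂ :=
  if μ.re < θ then 0 else ∫ s in Iic (0 : ℝ), Complex.exp (μ * s) * f s

section Scalar

variable {θ : ℝ} {μ : ℂ} {f g : ℝ → ℂ}

theorem integrableOn_exp_mul_Icc (hf : MemLp f 2 (weight θ)) (a : ℝ) :
    IntegrableOn (fun s : ℝ => Complex.exp (μ * s) * f s) (Icc a 0) :=
  (integrableOn_Icc_of_memLp hf a).continuousOn_mul
    (by fun_prop : Continuous fun s : ℝ => Complex.exp (μ * s)).continuousOn isCompact_Icc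

theorem intervalIntegrable_twist (hf : MemLp f 2 (weight θ)) (a b : ℝ) :
    IntervalIntegrable (twist μ f) volume a b := by
  rw [intervalIntegrable_iff, twist, integrableOn_indicator_iff measurableSet_Iic]
  refine (integrableOn_exp_mul_Icc hf (min a b)).mono_set fun s hs => ⟨?_, hs.1⟩
  exact hs.2.1.le

theorem continuous_odeSol (hf : MemLp f 2 (weight θ)) (C : ℂ) : Continuous (odeSol μ f C) := by
  have h := intervalIntegral.continuous_primitive (intervalIntegrable_twist (μ := μ) hf) 0
  unfold odeSol
  fun_prop

theorem odeSol_zero (C : ℂ) : odeSol μ f C 0 = C := by simp [odeSol]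

theorem odeSol_add_const (C D : ℂ) (t : ℝ) :
    odeSol μ f (C + D) t = odeSol μ f C t + Complex.exp (-μ * t) * D := by
  simp only [odeSol]
  ring

theorem twist_congr (h : ∀ᵐ t ∂(volume.restrict (Iic (0 : ℝ))), f t = g t) :
    twist μ f =ᵐ[volume] twist μ g := by
  rw [ae_restrict_iff' measurableSet_Iic] at h
  filter_upwards [h] with t ht
  by_cases h0 : t ∈ Iic (0 : ℝ)
  · simp [twist, h0, ht h0]
  · simp [twist, h0]

theorem odeSol_congr (h : ∀ᵐ t ∂(volume.restrict (Iic (0 : ℝ))), f t = g t) (C : ℂ) :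
    odeSol μ f C = odeSol μ g C := by
  ext t
  simp only [odeSol]
  congr 2
  exact intervalIntegral.integral_congr_ae ((twist_congr h).mono fun s hs _ => hs)

theorem finalValue_congr (h : ∀ᵐ t ∂(volume.restrict (Iic (0 : ℝ))), f t = g t) :
    finalValue θ μ f = finalValue θ μ g := by
  simp only [finalValue]
  congr 1
  exact integral_congr_ae (h.mono fun s hs => by simp only [hs])

theorem twist_add : twist μ (fun t => f t + g t) = fun t => twist μ f t + twist μ g t := by
  ext t
  simp only [twist, indicator]
  split_ifs <;> ring

theorem twist_smul (c : ℂ) : twist μ (fun t => c * f t) = fun t => c * twist μ f t := by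
  ext t
  simp only [twist, indicator]
  split_ifs <;> ring

theorem odeSol_add (hf : MemLp f 2 (weight θ)) (hg : MemLp g 2 (weight θ)) (C D : ℂ) (t : ℝ) :
    odeSol μ (fun t => f t + g t) (C + D) t = odeSol μ f C t + odeSol μ g D t := by
  simp only [odeSol, twist_add]
  rw [intervalIntegral.integral_add (intervalIntegrable_twist hf _ _)
    (intervalIntegrable_twist hg _ _)]
  ring

theorem odeSol_smul (c C : ℂ) (t : ℝ) :
    odeSol μ (fun t => c * f t) (c * C) t = c * odeSol μ f C t := by
  simp only [odeSol, twist_smul, intervalIntegral.integral_const_mul]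
  ring

theorem integrableOn_exp_mul_Iic_of_memLp (hμ : θ < μ.re) (hf : MemLp f 2 (weight θ)) :
    IntegrableOn (fun s : ℝ => Complex.exp (μ * s) * f s) (Iic 0) := by
  have h1 := memLp_weight_iff.1 hf
  have h2 := memLp_weight_iff.1 (memLp_exp (θ := θ) (ν := 2 * θ - μ) (by simp; linarith))
  refine (h1.integrable_mul h2).congr (ae_of_all _ fun s => ?_)
  simp only [Pi.mul_apply, smul_eq_mul]
  have : Complex.exp (μ * s)
      = (Real.exp (θ * s) : ℂ) * (Real.exp (θ * s) : ℂ) * Complex.exp (-(2 * θ - μ) * s) := by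
    push_cast
    rw [← Complex.exp_add, ← Complex.exp_add]
    congr 1
    ring
  rw [this]
  ring

theorem finalValue_add (hμ : μ.re ≠ θ) (hf : MemLp f 2 (weight θ)) (hg : MemLp g 2 (weight θ)) :
    finalValue θ μ (fun t => f t + g t) = finalValue θ μ f + finalValue θ μ g := by
  simp only [finalValue]
  split_ifs with h
  · simp
  · have h' : θ < μ.re := lt_of_le_of_ne (not_lt.1 h) hμ.symm
    rw [← integral_add (integrableOn_exp_mul_Iic_of_memLp h' hf)
      (integrableOn_exp_mul_Iic_of_memLp h' hg)]
    simp only [mul_add]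

theorem finalValue_smul (c : ℂ) : finalValue θ μ (fun t => c * f t) = c * finalValue θ μ f := by
  simp only [finalValue]
  split_ifs with h
  · simp
  · rw [← integral_const_mul]
    congr 1
    ext s
    ring

/-- The final value of a stable mode is controlled by the weighted norm of the forcing. -/
theorem norm_finalValue_le (f : Lp ℂ 2 (weight θ)) (hμ : 1 / 2 ≤ |μ.re - θ|) :
    ‖finalValue θ μ f‖ ≤ ‖f‖ := by
  simp only [finalValue]
  split_ifs with h
  · simp
  · rw [abs_of_nonneg (by linarith)] at hμ
    have hν : (2 * θ - conj μ : ℂ).re < θ := by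
      simp
      linarith
    have h1 : ∫ s in Iic (0 : ℝ), Complex.exp (μ * s) * f s = inner ℂ (expLp hν) f := by
      rw [inner_weight]
      refine integral_congr_ae ?_
      filter_upwards [coeFn_toLp_weight (memLp_exp hν)] with s hs
      rw [expLp, hs, ← mul_assoc, ← Complex.exp_conj]
      congr 1
      push_cast
      rw [← Complex.exp_add]
      congr 1
      have h2 : conj (2 : ℂ) = 2 := map_ofNat _ 2
      simp [h2]
      ring
    rw [h1]
    have h2 : ‖expLp hν‖ ≤ 1 := by
      have h3 := norm_expLp_sq hν
      have h4 : 1 / (2 * (θ - (2 * θ - conj μ : ℂ).re)) ≤ 1 := by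
        rw [div_le_one (by linarith)]
        simp
        linarith
      rw [← h3] at h4
      nlinarith [norm_nonneg (expLp hν)]
    calc _ ≤ ‖expLp hν‖ * ‖f‖ := norm_inner_le_norm _ _
      _ ≤ 1 * ‖f‖ := by gcongr
      _ = ‖f‖ := one_mul _

/-- The selected solution is an integral of the forcing against an exponentially decaying
kernel. -/
theorem enorm_odeSol_finalValue_le (hμ : μ.re ≠ θ) (hf : MemLp f 2 (weight θ)) {t : ℝ}
    (ht : t ≤ 0) :
    ‖(Real.exp (θ * t) : ℂ) • odeSol μ f (finalValue θ μ f) t‖ₑ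
      ≤ ∫⁻ s in Iic (0 : ℝ), ENNReal.ofReal (Real.exp (-|μ.re - θ| * |t - s|))
          * ‖(Real.exp (θ * s) : ℂ) • f s‖ₑ := by
  -- the set of times `s` that influence the solution at time `t`
  have key : ∀ A : Set ℝ, MeasurableSet A → A ⊆ Iic 0 →
      (∀ s ∈ A, -(μ.re - θ) * (t - s) = -|μ.re - θ| * |t - s|) → ∀ σ : ℂ, ‖σ‖ₑ = 1 →
      finalValue θ μ f + ∫ s in (0 : ℝ)..t, twist μ f s
        = σ * ∫ s in A, Complex.exp (μ * s) * f s →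
      ‖(Real.exp (θ * t) : ℂ) • odeSol μ f (finalValue θ μ f) t‖ₑ
      ≤ ∫⁻ s in Iic (0 : ℝ), ENNReal.ofReal (Real.exp (-|μ.re - θ| * |t - s|))
          * ‖(Real.exp (θ * s) : ℂ) • f s‖ₑ := by
    intro A hA hA0 hAs σ hσ hprim
    have h1 : (Real.exp (θ * t) : ℂ) • odeSol μ f (finalValue θ μ f) t
        = σ * ∫ s in A, (Real.exp (θ * t) : ℂ) * Complex.exp (-μ * t)
            * (Complex.exp (μ * s) * f s) := by
      rw [odeSol, hprim, integral_const_mul, smul_eq_mul]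
      ring
    rw [h1, enorm_mul, hσ, one_mul]
    refine (enorm_integral_le_lintegral_enorm _).trans ?_
    refine le_trans (setLIntegral_mono' hA fun s hs => ?_)
      (lintegral_mono_set hA0)
    rw [smul_eq_mul, ← mul_assoc, enorm_mul, enorm_mul (_ : ℂ) (f s), ← mul_assoc]
    gcongr
    rw [← ofReal_norm, ← ofReal_norm, ← ENNReal.ofReal_mul (Real.exp_pos _).le]
    refine ENNReal.ofReal_le_ofReal (le_of_eq ?_)
    rw [norm_mul, norm_mul, Complex.norm_real, Complex.norm_real, Complex.norm_exp,
      Complex.norm_exp, Real.norm_of_nonneg (Real.exp_pos _).le,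
      Real.norm_of_nonneg (Real.exp_pos _).le, ← Real.exp_add, ← Real.exp_add, ← Real.exp_add,
      ← hAs s hs]
    congr 1
    simp
    ring
  have htw : ∫ s in (0 : ℝ)..t, twist μ f s
      = -∫ s in Ioc t 0, Complex.exp (μ * s) * f s := by
    rw [intervalIntegral.integral_of_ge ht]
    congr 1
    exact setIntegral_congr_fun measurableSet_Ioc fun s hs => indicator_of_mem (show s ∈ Iic 0 from hs.2) _
  rcases lt_or_gt_of_ne hμ with h | h
  · refine key (Ioc t 0) measurableSet_Ioc Ioc_subset_Iic_self (fun s hs => ?_) (-1) (by simp) ?_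
    · rw [abs_of_neg (by linarith), abs_of_neg (by linarith [hs.1])]
      ring
    · rw [finalValue, if_pos h, htw]
      ring
  · refine key (Iic t) measurableSet_Iic (Iic_subset_Iic.2 ht) (fun s hs => ?_) 1 (by simp) ?_
    · have : s ≤ t := hs
      rw [abs_of_pos (by linarith), abs_of_nonneg (by linarith)]
    · rw [finalValue, if_neg (by linarith), htw]
      have h2 := integrableOn_exp_mul_Iic_of_memLp h hf
      rw [← Iic_union_Ioc_eq_Iic ht, setIntegral_union (Iic_disjoint_Ioc le_rfl) measurableSet_Ioc
        (h2.mono_set (Iic_subset_Iic.2 ht)) (h2.mono_set Ioc_subset_Iic_self)]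
      ring

theorem eLpNorm_odeSol_finalValue_le (hμ : μ.re ≠ θ) (hf : MemLp f 2 (weight θ)) :
    eLpNorm (odeSol μ f (finalValue θ μ f)) 2 (weight θ)
      ≤ ENNReal.ofReal (2 / |μ.re - θ|) * eLpNorm f 2 (weight θ) := by
  have hd : 0 < |μ.re - θ| := abs_pos.2 (sub_ne_zero.2 hμ)
  have hfm := aestronglyMeasurable_weight_iff.1 hf.1
  rw [eLpNorm_weight (continuous_odeSol hf _).aestronglyMeasurable, eLpNorm_weight hfm]
  refine (ENNReal.pow_right_strictMono two_ne_zero).le_iff_le.1 ?_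
  show _ ^ 2 ≤ _ ^ 2
  rw [mul_pow, eLpNorm_two_sq, eLpNorm_two_sq]
  have hk : Measurable (Function.uncurry fun t s : ℝ =>
      ENNReal.ofReal (Real.exp (-|μ.re - θ| * |t - s|))) := by
    unfold Function.uncurry
    fun_prop
  have hG := (memLp_weight_iff.1 hf).1.enorm
  refine le_trans (setLIntegral_mono' measurableSet_Iic fun t ht => ?_)
    (lintegral_schur hk (c := ENNReal.ofReal (2 / |μ.re - θ|)) (fun t => ?_) (fun s => ?_) hG)
  · gcongr
    exact enorm_odeSol_finalValue_le hμ hf ht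
  · exact (setLIntegral_le_lintegral _ _).trans (lintegral_exp_neg_abs hd t)
  · refine (setLIntegral_le_lintegral _ _).trans ?_
    simp_rw [abs_sub_comm _ s]
    exact lintegral_exp_neg_abs hd s

theorem memLp_odeSol_finalValue (hμ : μ.re ≠ θ) (hf : MemLp f 2 (weight θ)) :
    MemLp (odeSol μ f (finalValue θ μ f)) 2 (weight θ) :=
  ⟨(continuous_odeSol hf _).aestronglyMeasurable,
    (eLpNorm_odeSol_finalValue_le hμ hf).trans_lt (ENNReal.mul_lt_top ENNReal.ofReal_lt_top hf.2)⟩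

/-- The solution operator of `y' + μ y = f` in the weighted space, as a linear map. -/
def solLin (hμ : μ.re ≠ θ) : Lp ℂ 2 (weight θ) →ₗ[ℂ] Lp ℂ 2 (weight θ) where
  toFun f := (memLp_odeSol_finalValue hμ (Lp.memLp f)).toLp
  map_add' f g := by
    rw [← MemLp.toLp_add]
    refine MemLp.toLp_congr _ _ (ae_of_all _ fun t => ?_)
    have h := ae_weight_iff.1 (Lp.coeFn_add f g)
    rw [odeSol_congr h, finalValue_congr h]
    simp only [Pi.add_apply]
    rw [show (⇑f + ⇑g : ℝ → ℂ) = fun t => f t + g t from rfl,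
      finalValue_add hμ (Lp.memLp f) (Lp.memLp g), odeSol_add (Lp.memLp f) (Lp.memLp g)]
  map_smul' c f := by
    rw [RingHom.id_apply, ← MemLp.toLp_const_smul]
    refine MemLp.toLp_congr _ _ (ae_of_all _ fun t => ?_)
    have h := ae_weight_iff.1 (Lp.coeFn_smul c f)
    rw [odeSol_congr h, finalValue_congr h]
    rw [show (c • ⇑f : ℝ → ℂ) = fun t => c * f t from rfl, finalValue_smul, odeSol_smul]
    rfl

/-- The solution operator of `y' + μ y = f` in the weighted space. For `Re μ > θ` it integrates
from `-∞`, for `Re μ < θ` it integrates backward from the final value `0`. The junk value at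
`Re μ = θ` is `0`. -/
def solOp (θ : ℝ) (μ : ℂ) : Lp ℂ 2 (weight θ) →L[ℂ] Lp ℂ 2 (weight θ) :=
  if hμ : μ.re ≠ θ then (solLin hμ).mkContinuous (2 / |μ.re - θ|) fun f => by
    have h := eLpNorm_odeSol_finalValue_le hμ (Lp.memLp f)
    have h2 : ‖solLin hμ f‖ = (eLpNorm (odeSol μ f (finalValue θ μ f)) 2 (weight θ)).toReal :=
      Lp.norm_toLp _ (memLp_odeSol_finalValue hμ (Lp.memLp f))
    rw [h2, Lp.norm_def]
    have h3 := ENNReal.toReal_mono (ENNReal.mul_ne_top ENNReal.ofReal_ne_top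
      (Lp.eLpNorm_ne_top f)) h
    rwa [ENNReal.toReal_mul, ENNReal.toReal_ofReal (by positivity)] at h3
  else 0

theorem norm_solOp_le (θ : ℝ) (μ : ℂ) : ‖solOp θ μ‖ ≤ 2 / |μ.re - θ| := by
  unfold solOp
  split_ifs
  · exact LinearMap.mkContinuous_norm_le _ (by positivity) _
  · rw [norm_zero]
    positivity

theorem coeFn_solOp (hμ : μ.re ≠ θ) (f : Lp ℂ 2 (weight θ)) :
    ∀ᵐ t ∂(volume.restrict (Iic (0 : ℝ))), solOp θ μ f t = odeSol μ f (finalValue θ μ f) t := by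
  have h : solOp θ μ f = (memLp_odeSol_finalValue hμ (Lp.memLp f)).toLp := by
    rw [solOp, dif_pos hμ]
    rfl
  rw [h]
  exact coeFn_toLp_weight _

/-- The weak form of `y' + μ y = f`. -/
theorem integral_odeSol_mul_test (hf : MemLp f 2 (weight θ)) (C : ℂ) {ψ ψ' : ℝ → ℂ}
    (hψ : IsC1Test ψ ψ') :
    ∫ t in Iio 0, odeSol μ f C t * (-ψ' t + μ * ψ t) = ∫ t in Iio 0, f t * ψ t := by
  have hχ := hψ.exp_mul (-μ)
  obtain ⟨a, ha, hs⟩ := hψ.exists_support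
  set χ : ℝ → ℂ := fun t => Complex.exp (-μ * t) * ψ t with hχdef
  set χ' : ℝ → ℂ := fun t => Complex.exp (-μ * t) * (ψ' t + -μ * ψ t) with hχ'def
  have hF : IntegrableOn (twist μ f) (Ioc a 0) :=
    (intervalIntegrable_iff_integrableOn_Ioc_of_le ha.le).1 (intervalIntegrable_twist hf a 0)
  rw [setIntegral_Iio_eq_Ioc (a := a) fun t ht => by rw [(hs t ht).1, (hs t ht).2]; simp,
    setIntegral_Iio_eq_Ioc (a := a) fun t ht => by rw [(hs t ht).1, mul_zero]]
  have h0 : χ 0 = 0 := by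
    simp only [hχdef]
    rw [(hs 0 (by simp)).1, mul_zero]
  have hχa : χ a = 0 := by
    simp only [hχdef]
    rw [(hs a (by simp)).1, mul_zero]
  have h1 : ∀ t ∈ Ioc a 0, odeSol μ f C t * (-ψ' t + μ * ψ t)
      = -((C + ∫ s in (0 : ℝ)..a, twist μ f s) * χ' t) - (∫ s in Ioc a t, twist μ f s) * χ' t := by
    intro t ht
    rw [← intervalIntegral.integral_of_le ht.1.le, odeSol,
      ← intervalIntegral.integral_add_adjacent_intervals (intervalIntegrable_twist hf 0 a)
        (intervalIntegrable_twist hf a t)]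
    simp only [hχ'def]
    ring
  have hχ'int : IntegrableOn χ' (Ioc a 0) := hχ.continuous_deriv.integrableOn_Ioc
  have h2 : ∫ t in Ioc a 0, χ' t = 0 := by
    rw [← intervalIntegral.integral_of_le ha.le,
      intervalIntegral.integral_eq_sub_of_hasDerivAt (fun t _ => hχ.hasDerivAt t)
        (hχ.continuous_deriv.intervalIntegrable _ _)]
    show χ 0 - χ a = 0
    rw [h0, hχa, sub_zero]
  have h3 : IntegrableOn (fun t => (∫ s in Ioc a t, twist μ f s) * χ' t) (Ioc a 0) := by
    have h4 : Continuous fun t => (∫ s in a..t, twist μ f s) * χ' t :=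
      (intervalIntegral.continuous_primitive (intervalIntegrable_twist hf) a).mul
        hχ.continuous_deriv
    refine (h4.integrableOn_Ioc (a := a) (b := 0)).congr_fun (fun t ht => ?_) measurableSet_Ioc
    simp only
    rw [intervalIntegral.integral_of_le ht.1.le]
  have h5 : IntegrableOn (fun t => -((C + ∫ s in (0 : ℝ)..a, twist μ f s) * χ' t)) (Ioc a 0) :=
    (hχ'int.const_mul _).neg
  rw [setIntegral_congr_fun measurableSet_Ioc h1, integral_sub h5 h3,
    integral_neg, integral_const_mul, h2, mul_zero, neg_zero, zero_sub,
    integral_primitive_mul_deriv hF hχ.hasDerivAt hχ.continuous_deriv h0, neg_neg]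
  refine setIntegral_congr_fun measurableSet_Ioc fun t ht => ?_
  simp only [hχdef, twist]
  rw [indicator_of_mem (show t ∈ Iic (0 : ℝ) from ht.2)]
  have : Complex.exp (μ * t) * Complex.exp (-μ * t) = 1 := by
    rw [← Complex.exp_add]
    simp
  linear_combination f t * ψ t * this

theorem integrableOn_mul_of_support {y ψ : ℝ → ℂ} (hy : ∀ a, IntegrableOn y (Icc a 0))
    (hψ : Continuous ψ) {a : ℝ} (hs : ∀ t, t ∉ Ioo a 0 → ψ t = 0) :
    IntegrableOn (fun t => y t * ψ t) (Iio 0) := by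
  have h1 : IntegrableOn (fun t => y t * ψ t) (Icc a 0) :=
    (hy a).mul_continuousOn hψ.continuousOn isCompact_Icc
  refine (integrableOn_iff_integrable_of_support_subset (s := Icc a 0) ?_).1 h1 |>.integrableOn
  intro t ht
  by_contra h2
  exact ht (by simp [hs t fun h3 => h2 ⟨h3.1.le, h3.2.le⟩])

/-- Every weak solution of `y' + μ y = f` is one of the functions `odeSol μ f C`. -/
theorem exists_eq_odeSol_of_weak {y : ℝ → ℂ} (hy : MemLp y 2 (weight θ))
    (hf : MemLp f 2 (weight θ))
    (h : ∀ ψ, IsSmoothTest ψ →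
      ∫ t in Iio 0, y t * (-deriv ψ t + μ * ψ t) = ∫ t in Iio 0, f t * ψ t) :
    ∃ C, ∀ᵐ t ∂(volume.restrict (Iic (0 : ℝ))), y t = odeSol μ f C t := by
  have hc := continuous_odeSol (μ := μ) hf 0
  have hyi := integrableOn_Icc_of_memLp hy
  have hexp : Continuous fun t : ℝ => Complex.exp (μ * t) := by fun_prop
  obtain ⟨C, hC⟩ := exists_ae_eq_const
    (ζ := fun t => Complex.exp (μ * t) * (y t - odeSol μ f 0 t)) (fun a =>
      ((hyi a).sub hc.integrableOn_Icc).continuousOn_mul hexp.continuousOn isCompact_Icc)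
    (fun χ hχ => by
      have h1 := h _ (hχ.exp_mul μ)
      have h2 := hχ.isC1Test.exp_mul μ
      rw [← integral_odeSol_mul_test hf 0 h2] at h1
      obtain ⟨a, ha, hs⟩ := h2.exists_support
      have hd : ∀ t, deriv (fun t : ℝ => Complex.exp (μ * t) * χ t) t
          = Complex.exp (μ * t) * (deriv χ t + μ * χ t) := fun t => (h2.hasDerivAt t).deriv
      have hG : Continuous fun t : ℝ => -(Complex.exp (μ * t) * (deriv χ t + μ * χ t))
          + μ * (Complex.exp (μ * t) * χ t) :=
        h2.continuous_deriv.neg.add (continuous_const.mul h2.continuous)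
      have hG0 : ∀ t, t ∉ Ioo a 0 → -(Complex.exp (μ * t) * (deriv χ t + μ * χ t))
          + μ * (Complex.exp (μ * t) * χ t) = 0 := fun t ht => by
        rw [(hs t ht).1, (hs t ht).2]
        simp
      simp only [hd] at h1
      rw [← sub_eq_zero, ← integral_sub (integrableOn_mul_of_support hyi hG hG0)
        (integrableOn_mul_of_support (fun a => hc.integrableOn_Icc) hG hG0)] at h1
      rw [← neg_eq_zero, ← integral_neg]
      refine Eq.trans (integral_congr_ae (ae_of_all _ fun t => ?_)) h1
      simp only
      ring)
  refine ⟨C, ?_⟩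
  rw [← restrict_Iio_eq_restrict_Iic]
  filter_upwards [hC] with t ht
  have h1 : Complex.exp (-μ * t) * Complex.exp (μ * t) = 1 := by
    rw [← Complex.exp_add]
    simp
  rw [← zero_add C, odeSol_add_const, ← ht]
  linear_combination -(y t - odeSol μ f 0 t) * h1

/-- A stable solution in the weighted space is the one given by the solution operator. -/
theorem eq_finalValue_of_memLp (hμ : θ < μ.re) (hf : MemLp f 2 (weight θ)) {C : ℂ}
    (hC : MemLp (odeSol μ f C) 2 (weight θ)) : C = finalValue θ μ f := by
  have h1 := hC.sub (memLp_odeSol_finalValue hμ.ne' hf)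
  have h2 : MemLp (fun t : ℝ => Complex.exp (-μ * t) * (C - finalValue θ μ f)) 2 (weight θ) := by
    refine (memLp_congr_ae (ae_of_all _ fun t => ?_)).1 h1
    rw [Pi.sub_apply, odeSol, odeSol]
    ring
  exact sub_eq_zero.1 (eq_zero_of_memLp_exp hμ.le h2)

/-- A classical solution of `y' + μ y = f` is given by the formula. -/
theorem eq_odeSol_of_hasDerivAt {y : ℝ → ℂ} (hy : ContinuousOn y (Iic 0))
    (hf : MemLp f 2 (weight θ)) (h : ∀ t < 0, HasDerivAt y (f t - μ * y t) t) {t : ℝ}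
    (ht : t ≤ 0) : y t = odeSol μ f (y 0) t := by
  have hexp : Continuous fun t : ℝ => Complex.exp (μ * t) := by fun_prop
  have h1 := intervalIntegral.integral_eq_sub_of_hasDerivAt_of_le ht
    (f := fun t : ℝ => Complex.exp (μ * t) * y t) (f' := twist μ f)
    (hexp.continuousOn.mul (hy.mono Icc_subset_Iic_self)) (fun s hs => ?_)
    (intervalIntegrable_twist hf _ _)
  · rw [odeSol, intervalIntegral.integral_symm, h1]
    have h1 : Complex.exp (-μ * t) * Complex.exp (μ * t) = 1 := by
      rw [← Complex.exp_add]
      simp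
    simp only [Complex.ofReal_zero, mul_zero, Complex.exp_zero, one_mul]
    linear_combination -y t * h1
  · have h2 : HasDerivAt (fun t : ℝ => Complex.exp (μ * t)) (Complex.exp (μ * s) * μ) s := by
      have := ((hasDerivAt_id (s : ℂ)).const_mul μ).cexp.comp_ofReal
      simpa using this
    refine (h2.mul (h s hs.2)).congr_deriv ?_
    rw [twist, indicator_of_mem (show s ∈ Iic (0 : ℝ) from hs.2.le)]
    ring

theorem hasDerivAt_odeSol (hf : MemLp f 2 (weight θ)) (hc : Continuous f) (C : ℂ) {t : ℝ}
    (ht : t < 0) : HasDerivAt (odeSol μ f C) (f t - μ * odeSol μ f C t) t := by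
  have h2 : HasDerivAt (fun t : ℝ => Complex.exp (-μ * t)) (Complex.exp (-μ * t) * -μ) t := by
    have := ((hasDerivAt_id (t : ℂ)).const_mul (-μ)).cexp.comp_ofReal
    simpa using this
  have hcont : Continuous fun s : ℝ => Complex.exp (μ * s) * f s := by fun_prop
  have heq : twist μ f =ᶠ[nhds t] fun s : ℝ => Complex.exp (μ * s) * f s := by
    filter_upwards [Iio_mem_nhds ht] with s hs
    exact indicator_of_mem (Iio_subset_Iic_self hs) _
  have h3 : HasDerivAt (fun t => ∫ s in (0 : ℝ)..t, twist μ f s) (Complex.exp (μ * t) * f t) t := by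
    refine intervalIntegral.integral_hasDerivAt_of_tendsto_ae_right
      (intervalIntegrable_twist hf _ _) ?_ ?_
    · have : StronglyMeasurable (twist μ f) :=
        hcont.stronglyMeasurable.indicator measurableSet_Iic
      exact this.stronglyMeasurableAtFilter
    · exact ((hcont.tendsto t).congr' heq.symm).mono_left inf_le_left
  refine (h2.mul (h3.const_add C)).congr_deriv ?_
  have h1 : Complex.exp (-μ * t) * Complex.exp (μ * t) = 1 := by
    rw [← Complex.exp_add]
    simp
  rw [odeSol]
  linear_combination f t * h1

end Scalar

/-! ### Fourier modes of the weighted space -/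

section Modes

variable {θ : ℝ}

/-- The `k`-th Fourier coefficient of an element of the weighted space, a function of time. -/
def coef (k : Fin 3 → ℤ) : WeightedL2 θ →L[ℂ] Lp ℂ 2 (weight θ) :=
  (innerSL ℂ (basis k)).compLpL 2 (weight θ)

theorem coeFn_coef (k : Fin 3 → ℤ) (v : WeightedL2 θ) :
    ∀ᵐ t ∂(volume.restrict (Iic (0 : ℝ))), coef k v t = inner ℂ (basis k) (v t) :=
  ae_weight_iff.1 (ContinuousLinearMap.coeFn_compLpL (innerSL ℂ (basis k)) v)

theorem norm_toSpanSingleton_basis (k : Fin 3 → ℤ) (z : ℂ) : ‖z • basis k‖ = ‖z‖ := by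
  rw [norm_smul, basis.orthonormal.1 k, mul_one]

/-- The function `f(t) (2π)^{-3/2} exp (i k·x)` as an element of the weighted space. -/
def embed (k : Fin 3 → ℤ) : Lp ℂ 2 (weight θ) →ₗᵢ[ℂ] WeightedL2 θ where
  toLinearMap := ((ContinuousLinearMap.toSpanSingleton ℂ (basis k)).compLpL 2 (weight θ)).toLinearMap
  norm_map' f := by
    rw [Lp.norm_def, Lp.norm_def]
    refine congrArg ENNReal.toReal (eLpNorm_congr_norm_ae ?_)
    filter_upwards [ContinuousLinearMap.coeFn_compLpL
      (ContinuousLinearMap.toSpanSingleton ℂ (basis k)) f] with t ht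
    refine (congrArg norm ht).trans ?_
    rw [ContinuousLinearMap.toSpanSingleton_apply, norm_toSpanSingleton_basis]

theorem coeFn_embed (k : Fin 3 → ℤ) (f : Lp ℂ 2 (weight θ)) :
    ∀ᵐ t ∂(weight θ), embed k f t = f t • basis k := by
  filter_upwards [ContinuousLinearMap.coeFn_compLpL
      (ContinuousLinearMap.toSpanSingleton ℂ (basis k)) f] with t ht
  exact ht

theorem coef_embed (k l : Fin 3 → ℤ) (f : Lp ℂ 2 (weight θ)) :
    coef k (embed l f) = if k = l then f else 0 := by
  refine Lp.ext ?_
  filter_upwards [ae_weight_iff.2 (coeFn_coef k (embed l f)), coeFn_embed l f,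
    Lp.coeFn_zero ℂ 2 (weight θ)] with t h1 h2 h3
  rw [h1, h2, inner_smul_right, orthonormal_iff_ite.1 basis.orthonormal]
  split_ifs
  · rw [mul_one]
  · rw [mul_zero, h3]
    rfl

theorem inner_embed (k : Fin 3 → ℤ) (f : Lp ℂ 2 (weight θ)) (v : WeightedL2 θ) :
    inner ℂ (embed k f) v = inner ℂ f (coef k v) := by
  rw [L2.inner_def, L2.inner_def]
  refine integral_congr_ae ?_
  filter_upwards [ae_weight_iff.2 (coeFn_coef k v), coeFn_embed k f] with t h1 h2
  rw [h1, h2, inner_smul_left, RCLike.inner_apply, mul_comm]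

theorem weightedL2_ext {v w : WeightedL2 θ} (h : ∀ k, coef k v = coef k w) : v = w := by
  refine Lp.ext ?_
  have h1 : ∀ᵐ t ∂(weight θ), ∀ k, inner ℂ (basis k) (v t) = inner ℂ (basis k) (w t) := by
    rw [ae_all_iff]
    intro k
    filter_upwards [ae_weight_iff.2 (coeFn_coef k v), ae_weight_iff.2 (coeFn_coef k w)]
      with t h1 h2
    rw [← h1, ← h2, h k]
  filter_upwards [h1] with t ht
  exact ext_inner_basis ht

theorem isHilbertSum_embed :
    IsHilbertSum ℂ (fun _ : Fin 3 → ℤ => Lp ℂ 2 (weight θ)) (fun k => embed (θ := θ) k) := by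
  refine IsHilbertSum.mk ?_ ?_
  · intro k l hkl f g
    rw [inner_embed, coef_embed, if_neg hkl, inner_zero_right]
  · rw [top_le_iff, Submodule.topologicalClosure_eq_top_iff, Submodule.eq_bot_iff]
    intro v hv
    refine weightedL2_ext fun k => ?_
    rw [map_zero, ← inner_self_eq_zero (𝕜 := ℂ), ← inner_embed]
    refine (Submodule.mem_orthogonal _ _).1 hv _ ?_
    exact Submodule.mem_iSup_of_mem k ⟨_, rfl⟩

/-- The weighted space as the Hilbert sum of its Fourier modes. -/
def modes : WeightedL2 θ ≃ₗᵢ[ℂ] lp (fun _ : Fin 3 → ℤ => Lp ℂ 2 (weight θ)) 2 :=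
  isHilbertSum_embed.linearIsometryEquiv

theorem coef_modes_symm (k : Fin 3 → ℤ) (w : lp (fun _ : Fin 3 → ℤ => Lp ℂ 2 (weight θ)) 2) :
    coef k (modes.symm w) = w k := by
  have h1 := (isHilbertSum_embed.hasSum_linearIsometryEquiv_symm w).mapL (coef k)
  have h2 : ∀ l, coef k (embed l (w l)) = if l = k then w k else 0 := fun l => by
    rw [coef_embed]
    by_cases h : k = l
    · subst h; simp
    · rw [if_neg h, if_neg (Ne.symm h)]
  simp only [h2] at h1
  exact h1.unique (hasSum_ite_eq k (w k))

theorem modes_apply (v : WeightedL2 θ) (k : Fin 3 → ℤ) : modes v k = coef k v := by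
  rw [← coef_modes_symm k (modes v), LinearIsometryEquiv.symm_apply_apply]

theorem hasSum_inner_coef (v w : WeightedL2 θ) :
    HasSum (fun k => inner ℂ (coef k v) (coef k w)) (inner ℂ v w) := by
  have h := lp.hasSum_inner (𝕜 := ℂ) (modes v) (modes w)
  simp only [modes_apply] at h
  rwa [LinearIsometryEquiv.inner_map_map] at h

theorem hasSum_norm_coef_sq (v : WeightedL2 θ) : HasSum (fun k => ‖coef k v‖ ^ 2) (‖v‖ ^ 2) := by
  have h := lp.hasSum_norm (p := 2) (by norm_num) (modes v)
  simp only [modes_apply, LinearIsometryEquiv.norm_map] at h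
  simpa using h

theorem exists_coef_eq {u : (Fin 3 → ℤ) → Lp ℂ 2 (weight θ)} (hu : Summable fun k => ‖u k‖ ^ 2) :
    ∃ v : WeightedL2 θ, ∀ k, coef k v = u k := by
  have hmem : Memℓp u 2 := by
    rw [memℓp_gen_iff (by norm_num)]
    simpa using hu
  exact ⟨modes.symm ⟨u, hmem⟩, fun k => coef_modes_symm k _⟩

theorem norm_le_of_coef {v w : WeightedL2 θ} {c : ℝ} (hc : 0 ≤ c)
    (h : ∀ k, ‖coef k v‖ ≤ c * ‖coef k w‖) : ‖v‖ ≤ c * ‖w‖ := by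
  have h1 : ‖v‖ ^ 2 ≤ (c * ‖w‖) ^ 2 := by
    rw [mul_pow]
    refine hasSum_le (fun k => ?_) (hasSum_norm_coef_sq v) ((hasSum_norm_coef_sq w).mul_left _)
    rw [← mul_pow]
    exact pow_le_pow_left₀ (norm_nonneg _) (h k) 2
  exact le_of_sq_le_sq h1 (by positivity)

theorem exists_diagonal {T : (Fin 3 → ℤ) → Lp ℂ 2 (weight θ) →L[ℂ] Lp ℂ 2 (weight θ)} {c : ℝ}
    (hT : ∀ k, ‖T k‖ ≤ c) (v : WeightedL2 θ) : ∃ w : WeightedL2 θ, ∀ k, coef k w = T k (coef k v) := by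
  have hc : 0 ≤ c := (norm_nonneg _).trans (hT 0)
  refine exists_coef_eq (((hasSum_norm_coef_sq v).summable.mul_left (c ^ 2)).of_nonneg_of_le
    (fun k => by positivity) fun k => ?_)
  rw [← mul_pow]
  exact pow_le_pow_left₀ (norm_nonneg _) ((T k).le_of_opNorm_le (hT k) _) 2

/-- The operator that acts on the `k`-th Fourier mode by `T k`, for a bounded family `T`. -/
def diagonal (T : (Fin 3 → ℤ) → Lp ℂ 2 (weight θ) →L[ℂ] Lp ℂ 2 (weight θ)) {c : ℝ}
    (hT : ∀ k, ‖T k‖ ≤ c) : WeightedL2 θ →L[ℂ] WeightedL2 θ :=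
  LinearMap.mkContinuous
    { toFun := fun v => (exists_diagonal hT v).choose
      map_add' := fun v w => weightedL2_ext fun k => by
        rw [map_add, (exists_diagonal hT (v + w)).choose_spec, (exists_diagonal hT v).choose_spec,
          (exists_diagonal hT w).choose_spec, map_add, map_add]
      map_smul' := fun z v => weightedL2_ext fun k => by
        rw [RingHom.id_apply, map_smul, (exists_diagonal hT (z • v)).choose_spec,
          (exists_diagonal hT v).choose_spec, map_smul, map_smul] } c fun v =>
    norm_le_of_coef ((norm_nonneg _).trans (hT 0)) fun k => by
      rw [LinearMap.coe_mk, AddHom.coe_mk, (exists_diagonal hT v).choose_spec]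
      exact (T k).le_of_opNorm_le (hT k) _

theorem coef_diagonal {T : (Fin 3 → ℤ) → Lp ℂ 2 (weight θ) →L[ℂ] Lp ℂ 2 (weight θ)} {c : ℝ}
    (hT : ∀ k, ‖T k‖ ≤ c) (k : Fin 3 → ℤ) (v : WeightedL2 θ) :
    coef k (diagonal T hT v) = T k (coef k v) :=
  (exists_diagonal hT v).choose_spec k

end Modes

/-! ### Pointwise operators -/

section Pointwise

variable {θ : ℝ} {O : ℝ → H →L[ℝ] H} {c : ℝ}

theorem memLp_pointwise (hO : Continuous O) (hc : ∀ t, ‖O t‖ ≤ c) (v : WeightedL2 θ) :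
    MemLp (fun t => O t (v t)) 2 (weight θ) := by
  refine (Lp.memLp v).of_le_mul (c := c) ?_ (ae_of_all _ fun t => (O t).le_of_opNorm_le (hc t) _)
  have h : Continuous fun p : ℝ × H => O p.1 p.2 := (hO.comp continuous_fst).clm_apply continuous_snd
  exact h.comp_aestronglyMeasurable
    (continuous_id.aestronglyMeasurable.prodMk (Lp.aestronglyMeasurable v))

/-- The operator `v ↦ (t ↦ O t (v t))` for a bounded continuous family `O`. -/
def pointwise (hO : Continuous O) (hc : ∀ t, ‖O t‖ ≤ c) : WeightedL2 θ →L[ℝ] WeightedL2 θ :=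
  LinearMap.mkContinuous
    { toFun := fun v => (memLp_pointwise hO hc v).toLp
      map_add' := fun v w => by
        rw [← MemLp.toLp_add]
        refine MemLp.toLp_congr _ _ ?_
        filter_upwards [Lp.coeFn_add v w] with t ht
        rw [ht, Pi.add_apply, Pi.add_apply, map_add]
      map_smul' := fun z v => by
        rw [RingHom.id_apply, ← MemLp.toLp_const_smul]
        refine MemLp.toLp_congr _ _ ?_
        filter_upwards [Lp.coeFn_smul z v] with t ht
        rw [ht, Pi.smul_apply, Pi.smul_apply, map_smul] } c fun v => by
    refine Lp.norm_le_mul_norm_of_ae_le_mul ?_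
    filter_upwards [(memLp_pointwise hO hc v).coeFn_toLp] with t ht
    rw [LinearMap.coe_mk, AddHom.coe_mk, ht]
    exact (O t).le_of_opNorm_le (hc t) _

theorem coeFn_pointwise (hO : Continuous O) (hc : ∀ t, ‖O t‖ ≤ c) (v : WeightedL2 θ) :
    ∀ᵐ t ∂(weight θ), pointwise hO hc v t = O t (v t) :=
  (memLp_pointwise hO hc v).coeFn_toLp

theorem norm_pointwise_le (hO : Continuous O) (hc : ∀ t, ‖O t‖ ≤ c) :
    ‖pointwise (θ := θ) hO hc‖ ≤ c :=
  LinearMap.mkContinuous_norm_le _ ((norm_nonneg _).trans (hc 0)) _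

end Pointwise

/-! ### The unperturbed problem -/

/-- The coefficient `(1 + iω)|k|²` of the `k`-th mode. -/
def rate (ω : ℝ) (k : Fin 3 → ℤ) : ℂ := (1 + Complex.I * ω) * eigenvalue k

theorem rate_re (ω : ℝ) (k : Fin 3 → ℤ) : (rate ω k).re = eigenvalue k := by
  simp [rate]

theorem half_le_abs_rate (ω : ℝ) (N : ℕ) (k : Fin 3 → ℤ) :
    1 / 2 ≤ |(rate ω k).re - ((N : ℝ) + 1 / 2)| := by
  rw [rate_re]
  rcases le_or_gt (eigenvalue k) N with h | h
  · have : (eigenvalue k : ℝ) ≤ N := by exact_mod_cast h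
    rw [abs_of_nonpos (by linarith)]
    linarith
  · have : (N : ℝ) + 1 ≤ eigenvalue k := by exact_mod_cast h
    rw [abs_of_nonneg (by linarith)]
    linarith

theorem rate_re_ne (ω : ℝ) (N : ℕ) (k : Fin 3 → ℤ) : (rate ω k).re ≠ (N : ℝ) + 1 / 2 := fun h => by
  have := half_le_abs_rate ω N k
  rw [h, sub_self, abs_zero] at this
  norm_num at this

theorem rate_re_lt_iff (ω : ℝ) (N : ℕ) (k : Fin 3 → ℤ) :
    (rate ω k).re < (N : ℝ) + 1 / 2 ↔ eigenvalue k ≤ N := by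
  rw [rate_re]
  constructor
  · intro h
    by_contra h'
    have : (N : ℝ) + 1 ≤ eigenvalue k := by exact_mod_cast not_le.1 h'
    linarith
  · intro h
    have : (eigenvalue k : ℝ) ≤ N := by exact_mod_cast h
    linarith

theorem norm_solOp_rate_le (ω : ℝ) (N : ℕ) (k : Fin 3 → ℤ) :
    ‖solOp ((N : ℝ) + 1 / 2) (rate ω k)‖ ≤ 4 := by
  refine (norm_solOp_le _ _).trans ?_
  have h := half_le_abs_rate ω N k
  rw [div_le_iff₀ (by linarith)]
  linarith

/-- The solution operator of the unperturbed problem `∂ₜv - (1 + iω)Δv = h`, `P_N v(0) = 0`. -/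
def solve (ω : ℝ) (N : ℕ) :
    WeightedL2 ((N : ℝ) + 1 / 2) →L[ℂ] WeightedL2 ((N : ℝ) + 1 / 2) :=
  diagonal (fun k => solOp ((N : ℝ) + 1 / 2) (rate ω k)) (norm_solOp_rate_le ω N)

theorem coef_solve (ω : ℝ) (N : ℕ) (k : Fin 3 → ℤ) (v : WeightedL2 ((N : ℝ) + 1 / 2)) :
    coef k (solve ω N v) = solOp ((N : ℝ) + 1 / 2) (rate ω k) (coef k v) :=
  coef_diagonal _ _ _

theorem norm_solve_apply_le (ω : ℝ) (N : ℕ) (v : WeightedL2 ((N : ℝ) + 1 / 2)) :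
    ‖solve ω N v‖ ≤ 4 * ‖v‖ :=
  norm_le_of_coef (by norm_num) fun k => by
    rw [coef_solve]
    exact (solOp _ _).le_of_opNorm_le (norm_solOp_rate_le ω N k) _

theorem exists_free (ω : ℝ) (N : ℕ) (u : H) : ∃ v : WeightedL2 ((N : ℝ) + 1 / 2),
    (∀ k, coef k v = if h : (rate ω k).re < (N : ℝ) + 1 / 2 then
      (inner ℂ (basis k) u : ℂ) • expLp h else 0) ∧ ‖v‖ ≤ ‖u‖ := by
  have hle : ∀ k, ‖(if h : (rate ω k).re < (N : ℝ) + 1 / 2 then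
      (inner ℂ (basis k) u : ℂ) • expLp h else 0)‖ ^ 2 ≤ ‖(inner ℂ (basis k) u : ℂ)‖ ^ 2 := by
    intro k
    split_ifs with h
    · rw [norm_smul, mul_pow, norm_expLp_sq]
      refine mul_le_of_le_one_right (by positivity) ?_
      have h1 := half_le_abs_rate ω N k
      rw [abs_of_neg (by linarith)] at h1
      rw [div_le_one (by linarith)]
      linarith
    · rw [norm_zero, sq, mul_zero]
      positivity
  have hs : HasSum (fun k => ‖(inner ℂ (basis k) u : ℂ)‖ ^ 2) (‖u‖ ^ 2) := by
    have h := lp.hasSum_norm (p := 2) (by norm_num) (basis.repr u)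
    simp only [HilbertBasis.repr_apply_apply, LinearIsometryEquiv.norm_map] at h
    simpa using h
  obtain ⟨v, hv⟩ := exists_coef_eq (hs.summable.of_nonneg_of_le (fun k => by positivity) hle)
  refine ⟨v, hv, ?_⟩
  refine le_of_sq_le_sq (hasSum_le (fun k => ?_) (hasSum_norm_coef_sq v) hs) (norm_nonneg _)
  rw [hv]
  exact hle k

/-- The solution of the homogeneous problem `∂ₜv - (1 + iω)Δv = 0`, `P_N v(0) = P_N u`, without
components outside `H_N`. -/
def free (ω : ℝ) (N : ℕ) (u : H) : WeightedL2 ((N : ℝ) + 1 / 2) := (exists_free ω N u).choose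

theorem coef_free (ω : ℝ) (N : ℕ) (u : H) (k : Fin 3 → ℤ) :
    coef k (free ω N u) = if h : (rate ω k).re < (N : ℝ) + 1 / 2 then
      (inner ℂ (basis k) u : ℂ) • expLp h else 0 :=
  (exists_free ω N u).choose_spec.1 k

theorem norm_free_le (ω : ℝ) (N : ℕ) (u : H) : ‖free ω N u‖ ≤ ‖u‖ :=
  (exists_free ω N u).choose_spec.2

/-! ### Calculus of periodic functions -/

/-- The `i`-th unit vector of `ℝ³`. -/
abbrev dir (i : Fin 3) : E3 := EuclideanSpace.single i 1

theorem preimage_toLp_cell :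
    (fun y : Fin 3 → ℝ => (WithLp.toLp 2 y : E3)) ⁻¹' cell
      = univ.pi fun _ => Ioo (-Real.pi) Real.pi := by
  ext y
  simp [cell]

theorem setIntegral_cell_eq_Icc (f : E3 → ℂ) :
    ∫ x in cell, f x
      = ∫ y in Icc (fun _ : Fin 3 => -Real.pi) (fun _ => Real.pi), f (WithLp.toLp 2 y) := by
  have h1 := (PiLp.volume_preserving_toLp (Fin 3)).setIntegral_preimage_emb
    (MeasurableEquiv.toLp 2 (Fin 3 → ℝ)).measurableEmbedding f cell
  rw [← h1, preimage_toLp_cell]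
  exact setIntegral_congr_set Measure.univ_pi_Ioo_ae_eq_Icc

theorem integrableOn_cell {g : E3 → ℂ} (hg : Continuous g) : IntegrableOn g cell :=
  (hg.continuousOn.integrableOn_compact isCompact_closedCube).mono_set cell_subset_closedCube

theorem IsPeriodic.fderiv_apply {f : E3 → ℂ} (hf : IsPeriodic f) (e : E3) :
    IsPeriodic fun x => fderiv ℝ f x e := by
  intro x i
  have h : (fun y => f (y + EuclideanSpace.single i (2 * Real.pi))) = f := funext fun y => hf y i
  have h2 := fderiv_comp_add_right (𝕜 := ℝ) (f := f) (x := x) (EuclideanSpace.single i (2 * Real.pi))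
  rw [h] at h2
  simp only [h2]

theorem isPeriodic_expMode (k : Fin 3 → ℤ) : IsPeriodic (expMode k) := by
  intro x i
  have h : ((∑ j, (k j : ℝ) * (x + EuclideanSpace.single i (2 * Real.pi)) j : ℝ) : ℂ)
      = ((∑ j, (k j : ℝ) * x j : ℝ) : ℂ) + k i * (2 * Real.pi) := by
    simp [mul_add, Finset.sum_add_distrib]
  rw [expMode, h, mul_add, Complex.exp_add, expMode]
  rw [show Complex.I * (k i * (2 * (Real.pi : ℂ))) = k i * (2 * Real.pi * Complex.I) by ring,
    Complex.exp_int_mul_two_pi_mul_I, mul_one]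

theorem contDiff_expMode (k : Fin 3 → ℤ) {n : WithTop ℕ∞} : ContDiff ℝ n (expMode k) := by
  unfold expMode
  have hs : ContDiff ℝ n fun x : E3 => ∑ i, (k i : ℝ) * x i :=
    ContDiff.sum fun i _ => contDiff_const.mul
      (EuclideanSpace.proj i : E3 →L[ℝ] ℝ).contDiff
  have h : ContDiff ℝ n fun x : E3 => ((∑ i, (k i : ℝ) * x i : ℝ) : ℂ) :=
    Complex.ofRealCLM.contDiff.comp hs
  exact (contDiff_const.mul h).cexp

theorem fderiv_expMode (k : Fin 3 → ℤ) (x : E3) (i : Fin 3) :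
    fderiv ℝ (expMode k) x (dir i) = Complex.I * k i * expMode k x := by
  have hlin : HasDerivAt (fun s : ℝ => Complex.I * ((∑ j, (k j : ℝ) * (x + s • dir i) j : ℝ) : ℂ))
      (Complex.I * k i) 0 := by
    have h1 : ∀ s : ℝ, (∑ j, (k j : ℝ) * (x + s • dir i) j : ℝ) = (∑ j, (k j : ℝ) * x j) + s * k i := by
      intro s
      simp [mul_add, Finset.sum_add_distrib, mul_comm]
    simp_rw [h1]
    have h2 : HasDerivAt (fun s : ℝ => (∑ j, (k j : ℝ) * x j) + s * k i) (1 * k i) 0 :=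
      ((hasDerivAt_id (0 : ℝ)).mul_const _).const_add _
    have h3 := h2.ofReal_comp.const_mul Complex.I
    simpa using h3
  have h3 := hlin.cexp
  have h4 : HasFDerivAt (expMode k) (fderiv ℝ (expMode k) x) (x + (0 : ℝ) • dir i) := by
    rw [zero_smul, add_zero]
    exact (((contDiff_expMode k (n := 1)).differentiable (by simp)) x).hasFDerivAt
  have h5 : HasDerivAt (fun s : ℝ => x + s • dir i) (dir i) 0 := by
    simpa using ((hasDerivAt_id (0 : ℝ)).smul_const (dir i)).const_add x
  have h6 := h4.comp_hasDerivAt (0 : ℝ) h5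
  rw [h6.unique h3]
  simp [expMode, mul_comm]

theorem laplacian_eq_sum_fderiv {f : E3 → ℂ} (hf : ContDiff ℝ 2 f) (x : E3) :
    Laplacian.laplacian f x
      = ∑ i, fderiv ℝ (fun y => fderiv ℝ f y (dir i)) x (dir i) := by
  rw [InnerProductSpace.laplacian_eq_iteratedFDeriv_orthonormalBasis f
    (EuclideanSpace.basisFun (Fin 3) ℝ)]
  refine Finset.sum_congr rfl fun i _ => ?_
  rw [iteratedFDeriv_two_apply, fderiv_clm_apply
    ((hf.fderiv_right (m := 1) (by norm_num)).differentiable (by simp) x)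
    (differentiableAt_const _)]
  simp

theorem laplacian_const_mul_expMode (c : ℂ) (k : Fin 3 → ℤ) (x : E3) :
    Laplacian.laplacian (fun x => c * expMode k x) x = -eigenvalue k * (c * expMode k x) := by
  have hd : ∀ (c : ℂ) (y : E3) (i : Fin 3), fderiv ℝ (fun x => c * expMode k x) y (dir i)
      = c * (Complex.I * k i) * expMode k y := fun c y i => by
    rw [fderiv_const_mul ((contDiff_expMode k (n := 1)).differentiable (by simp) y)]
    simp only [smul_apply, fderiv_expMode, smul_eq_mul]
    ring
  rw [laplacian_eq_sum_fderiv (contDiff_const.mul (contDiff_expMode k))]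
  simp only [hd, eigenvalue]
  push_cast
  rw [← Finset.sum_neg_distrib, Finset.sum_mul]
  refine Finset.sum_congr rfl fun i _ => ?_
  linear_combination c * k i ^ 2 * expMode k x * Complex.I_sq

/-- The divergence theorem on the torus. -/
theorem integral_divergence_eq_zero {W : Fin 3 → E3 → ℂ} (hW : ∀ i, ContDiff ℝ 1 (W i))
    (hp : ∀ i, IsPeriodic (W i)) : ∫ x in cell, ∑ i, fderiv ℝ (W i) x (dir i) = 0 := by
  set L : (Fin 3 → ℝ) →L[ℝ] E3 := (EuclideanSpace.equiv (Fin 3) ℝ).symm.toContinuousLinearMap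
  have hL : ∀ y, L y = WithLp.toLp 2 y := fun y => rfl
  have hLd : ∀ i, L (Pi.single i 1) = dir i := fun i => by
    ext j
    simp [hL]
  have hd : ∀ i y, HasFDerivAt (fun y => W i (L y)) ((fderiv ℝ (W i) (L y)).comp L) y := fun i y =>
    (((hW i).differentiable (by simp)) (L y)).hasFDerivAt.comp y L.hasFDerivAt
  have hle : (fun _ : Fin 3 => -Real.pi) ≤ fun _ => Real.pi := fun _ => by
    have := Real.pi_pos
    simp only
    linarith
  have hcont : Continuous fun y => ∑ i, ((fderiv ℝ (W i) (L y)).comp L) (Pi.single i 1) := by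
    refine continuous_finsetSum _ fun i _ => ?_
    simp only [ContinuousLinearMap.comp_apply]
    exact (((hW i).continuous_fderiv (by simp)).comp L.continuous).clm_apply continuous_const
  have h1 := integral_divergence_of_hasFDerivAt_off_countable' (fun _ : Fin 3 => -Real.pi)
    (fun _ => Real.pi) hle (fun i y => W i (L y)) (fun i y => (fderiv ℝ (W i) (L y)).comp L) ∅
    countable_empty (fun i => ((hW i).continuous.comp L.continuous).continuousOn)
    (fun y _ i => hd i y) (hcont.continuousOn.integrableOn_compact isCompact_Icc)
  rw [setIntegral_cell_eq_Icc]
  simp only [ContinuousLinearMap.comp_apply, hLd] at h1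
  refine h1.trans (Finset.sum_eq_zero fun i _ => ?_)
  rw [sub_eq_zero]
  congr 1
  ext y
  rw [← hp i (L (i.insertNth (-Real.pi) y)) i]
  congr 1
  ext j
  refine Fin.succAboveCases i ?_ (fun j => ?_) j
  · simp [hL]
    ring
  · simp [hL]

/-- Green's formula on the torus against an exponential. -/
theorem integral_laplacian_mul_expMode {f : E3 → ℂ} (hf : ContDiff ℝ 2 f) (hp : IsPeriodic f)
    (k : Fin 3 → ℤ) :
    ∫ x in cell, Laplacian.laplacian f x * expMode k x
      = -eigenvalue k * ∫ x in cell, f x * expMode k x := by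
  have hf1 : ∀ i, ContDiff ℝ 1 fun x => fderiv ℝ f x (dir i) := fun i =>
    (hf.fderiv_right (m := 1) (by norm_num)).clm_apply contDiff_const
  have he := contDiff_expMode k (n := 1)
  set W : Fin 3 → E3 → ℂ := fun i x =>
    fderiv ℝ f x (dir i) * expMode k x - f x * (Complex.I * k i * expMode k x) with hWdef
  have hW : ∀ i, ContDiff ℝ 1 (W i) := fun i =>
    ((hf1 i).mul he).sub ((hf.of_le (by norm_num)).mul (contDiff_const.mul he))
  have hWp : ∀ i, IsPeriodic (W i) := fun i x j => by
    have h1 := hp.fderiv_apply (dir i) x j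
    simp only [hWdef]
    rw [hp x j, isPeriodic_expMode k x j]
    simp only at h1
    rw [h1]
  have hdiv : ∀ x, ∑ i, fderiv ℝ (W i) x (dir i)
      = Laplacian.laplacian f x * expMode k x + eigenvalue k * (f x * expMode k x) := by
    intro x
    have hed := (he.differentiable (by simp)) x
    have hfd := (hf.differentiable (by simp)) x
    rw [laplacian_eq_sum_fderiv hf, Finset.sum_mul, eigenvalue]
    push_cast
    rw [Finset.sum_mul, ← Finset.sum_add_distrib]
    refine Finset.sum_congr rfl fun i _ => ?_
    have hf1d := ((hf1 i).differentiable (by simp)) x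
    simp only [hWdef]
    have hA : DifferentiableAt ℝ (fun x => fderiv ℝ f x (dir i) * expMode k x) x := hf1d.mul hed
    have hB : DifferentiableAt ℝ (fun x => f x * (Complex.I * k i * expMode k x)) x :=
      hfd.mul (hed.const_mul _)
    rw [fderiv_fun_sub hA hB, fderiv_fun_mul hf1d hed,
      fderiv_fun_mul hfd (hed.const_mul _), fderiv_const_mul hed]
    simp only [sub_apply, add_apply, smul_apply, fderiv_expMode, smul_eq_mul]
    linear_combination -f x * k i ^ 2 * expMode k x * Complex.I_sq
  have hlap : Continuous fun x => Laplacian.laplacian f x := by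
    simp_rw [laplacian_eq_sum_fderiv hf]
    exact continuous_finsetSum _ fun i _ =>
      ((hf1 i).continuous_fderiv (by simp)).clm_apply continuous_const
  have h0 := integral_divergence_eq_zero hW hWp
  simp_rw [hdiv] at h0
  have hI1 : IntegrableOn (fun x => Laplacian.laplacian f x * expMode k x) cell :=
    integrableOn_cell (hlap.mul he.continuous)
  have hI2 : IntegrableOn (fun x => (eigenvalue k : ℂ) * (f x * expMode k x)) cell :=
    (integrableOn_cell (hf.continuous.mul he.continuous)).const_mul _
  rw [integral_add hI1 hI2, integral_const_mul] at h0
  linear_combination h0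

/-! ### Integrals over the cell that depend on time -/

theorem restrict_cell_eq : (volume.restrict cell : Measure E3)
    = volume.restrict {x : E3 | ∀ i, x i ∈ Icc (-Real.pi) Real.pi} := by
  refine Measure.restrict_congr_set ?_
  have h := (PiLp.volume_preserving_ofLp (Fin 3)).quasiMeasurePreserving.preimage_ae_eq
    (Measure.univ_pi_Ioo_ae_eq_Icc (μ := fun _ : Fin 3 => (volume : Measure ℝ))
      (f := fun _ => -Real.pi) (g := fun _ => Real.pi))
  have h1 : (WithLp.ofLp : E3 → Fin 3 → ℝ) ⁻¹' (univ.pi fun _ => Ioo (-Real.pi) Real.pi)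
      = cell := by
    ext x
    simp [cell]
  have h2 : (WithLp.ofLp : E3 → Fin 3 → ℝ) ⁻¹' (Icc (fun _ => -Real.pi) fun _ => Real.pi)
      = {x : E3 | ∀ i, x i ∈ Icc (-Real.pi) Real.pi} := by
    ext x
    simp only [mem_preimage, mem_Icc, Pi.le_def, mem_ofPred_eq, forall_and]
  rwa [h1, h2] at h

theorem continuous_integral_cell {g : ℝ × E3 → ℂ} (hg : Continuous g) :
    Continuous fun t => ∫ x in cell, g (t, x) := by
  rw [restrict_cell_eq]
  exact continuous_parametric_integral_of_continuous (f := fun t x => g (t, x)) hg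
    isCompact_closedCube

/-- The time derivative of a `C¹` function of time and space. -/
def timeDeriv (g : ℝ × E3 → ℂ) (p : ℝ × E3) : ℂ := fderiv ℝ g p (1, 0)

theorem hasDerivAt_timeDeriv {g : ℝ × E3 → ℂ} (hg : ContDiff ℝ 1 g) (t : ℝ) (x : E3) :
    HasDerivAt (fun s => g (s, x)) (timeDeriv g (t, x)) t := by
  have h1 := ((hg.differentiable (by simp)) (t, x)).hasFDerivAt
  have h2 : HasDerivAt (fun s : ℝ => (s, x)) ((1 : ℝ), (0 : E3)) t :=
    (hasDerivAt_id t).prodMk (hasDerivAt_const t x)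
  exact h1.comp_hasDerivAt t h2

theorem continuous_timeDeriv {g : ℝ × E3 → ℂ} (hg : ContDiff ℝ 1 g) : Continuous (timeDeriv g) :=
  (hg.continuous_fderiv (by simp)).clm_apply continuous_const

theorem hasDerivAt_integral_cell {g : ℝ × E3 → ℂ} (hg : ContDiff ℝ 1 g) {e : E3 → ℂ}
    (he : Continuous e) (t : ℝ) :
    HasDerivAt (fun t => ∫ x in cell, g (t, x) * e x)
      (∫ x in cell, timeDeriv g (t, x) * e x) t := by
  have hc := continuous_timeDeriv hg
  have hcomp : IsCompact (Icc (t - 1) (t + 1) ×ˢ {x : E3 | ∀ i, x i ∈ Icc (-Real.pi) Real.pi}) :=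
    isCompact_Icc.prod isCompact_closedCube
  obtain ⟨M, hM⟩ := hcomp.exists_bound_of_continuousOn
    (f := fun p : ℝ × E3 => timeDeriv g p * e p.2) (by fun_prop)
  have hgt : ∀ s, Continuous fun x => g (s, x) * e x := fun s => by
    have := hg.continuous
    fun_prop
  refine (hasDerivAt_integral_of_dominated_loc_of_deriv_le (𝕜 := ℝ)
    (F := fun s x => g (s, x) * e x) (F' := fun s x => timeDeriv g (s, x) * e x)
    (bound := fun _ => M) (Icc_mem_nhds (show t - 1 < t by linarith) (show t < t + 1 by linarith))
    (Filter.Eventually.of_forall fun s => (hgt s).aestronglyMeasurable) (integrableOn_cell (hgt t))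
    (by fun_prop : Continuous fun x => timeDeriv g (t, x) * e x).aestronglyMeasurable ?_
    (integrable_const M) ?_).2
  · filter_upwards [ae_restrict_mem measurableSet_cell] with x hx s hs
    exact hM (s, x) ⟨hs, cell_subset_closedCube hx⟩
  · exact ae_of_all _ fun x s _ => (hasDerivAt_timeDeriv hg s x).mul_const _

/-! ### Pairing with continuous functions of time and space -/

theorem isFiniteMeasure_weight {θ : ℝ} (hθ : 0 < θ) : IsFiniteMeasure (weight θ) := by
  have h := (memLp_exp (θ := θ) (ν := 0) (by simpa using hθ))
  simp only [neg_zero, zero_mul, Complex.exp_zero] at h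
  rcases (memLp_const_iff (by norm_num) (by norm_num)).1 h with h1 | h1
  · exact absurd h1 one_ne_zero
  · exact ⟨h1⟩

/-- A continuous function on `ℝ × ℝ³` as a continuous family of continuous functions. -/
def slice (Φ : C(ℝ × E3, ℂ)) : C(ℝ, C(E3, ℂ)) := Φ.curry

theorem slice_apply (Φ : C(ℝ × E3, ℂ)) (t : ℝ) (x : E3) : slice Φ t x = Φ (t, x) := rfl

/-- The element `conj (Φ (t, ·))` of `H`. -/
def conjSlice (Φ : C(ℝ × E3, ℂ)) (t : ℝ) : H := conjOp (mulOp (slice Φ t) (eigenvector 0))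

theorem coeFn_conjSlice (Φ : C(ℝ × E3, ℂ)) (t : ℝ) :
    conjSlice Φ t =ᵐ[volume.restrict cell] fun x => conj (Φ (t, x)) := by
  filter_upwards [coeFn_conjOp (mulOp (slice Φ t) (eigenvector 0)),
    coeFn_mulOp (slice Φ t) (eigenvector 0), coeFn_eigenvector 0] with x h1 h2 h3
  rw [conjSlice, h1, h2, h3, slice_apply]
  simp [expMode]

theorem continuous_conjSlice (Φ : C(ℝ × E3, ℂ)) : Continuous (conjSlice Φ) :=
  conjOp.continuous.comp ((continuous_mulOp (slice Φ).continuous).clm_apply continuous_const)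

theorem integrable_mul_slice (Φ : C(ℝ × E3, ℂ)) (t : ℝ) (g : H) :
    Integrable (fun x => g x * Φ (t, x)) (volume.restrict cell) := by
  refine (L2.integrable_inner (𝕜 := ℂ) (conjSlice Φ t) g).congr ?_
  filter_upwards [coeFn_conjSlice Φ t] with x hx
  rw [hx, RCLike.inner_apply, Complex.conj_conj]

theorem inner_conjSlice (Φ : C(ℝ × E3, ℂ)) (t : ℝ) (g : H) :
    inner ℂ (conjSlice Φ t) g = ∫ x in cell, g x * Φ (t, x) := by
  rw [L2.inner_def]
  refine integral_congr_ae ?_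
  filter_upwards [coeFn_conjSlice Φ t] with x hx
  rw [hx, RCLike.inner_apply, Complex.conj_conj]

/-- The `k`-th Fourier coefficient of `Φ` that pairs with `coef k`; it belongs to the frequency
`-k`. -/
def hat (Φ : C(ℝ × E3, ℂ)) (k : Fin 3 → ℤ) (t : ℝ) : ℂ :=
  normConst * ∫ x in cell, Φ (t, x) * expMode k x

theorem inner_basis_conjSlice (Φ : C(ℝ × E3, ℂ)) (k : Fin 3 → ℤ) (t : ℝ) :
    inner ℂ (basis k) (conjSlice Φ t) = conj (hat Φ k t) := by
  rw [inner_basis, hat, map_mul, Complex.conj_ofReal, ← integral_conj]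
  congr 1
  refine integral_congr_ae ?_
  filter_upwards [coeFn_conjSlice Φ t] with x hx
  rw [hx, map_mul, mul_comm]

section Pairing

variable {θ : ℝ} {Φ : C(ℝ × E3, ℂ)} {a : ℝ}

theorem memLp_exp_smul_conjSlice (hθ : 0 < θ) (hs : ∀ t, t ∉ Ioo a 0 → ∀ x, Φ (t, x) = 0) :
    MemLp (fun t : ℝ => (Real.exp (-2 * θ * t) : ℂ) • conjSlice Φ t) 2 (weight θ) := by
  have := isFiniteMeasure_weight hθ
  have hc : Continuous fun t : ℝ => (Real.exp (-2 * θ * t) : ℂ) • conjSlice Φ t :=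
    (by fun_prop : Continuous fun t : ℝ => (Real.exp (-2 * θ * t) : ℂ)).smul
      (continuous_conjSlice Φ)
  obtain ⟨M, hM⟩ := (isCompact_Icc (a := a) (b := 0)).exists_bound_of_continuousOn hc.continuousOn
  refine MemLp.of_bound hc.aestronglyMeasurable (max M 0) (ae_of_all _ fun t => ?_)
  by_cases ht : t ∈ Ioo a 0
  · exact (hM t ⟨ht.1.le, ht.2.le⟩).trans (le_max_left _ _)
  · have h0 : conjSlice Φ t = 0 := by
      refine (Lp.eq_zero_iff_ae_eq_zero).2 ?_
      filter_upwards [coeFn_conjSlice Φ t] with x hx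
      rw [hx, hs t ht, map_zero, Pi.zero_apply]
    rw [h0, smul_zero, norm_zero]
    exact le_max_right _ _

theorem exp_mul_exp_neg (θ t : ℝ) (z : ℂ) :
    (Real.exp (2 * θ * t) : ℂ) * ((Real.exp (-2 * θ * t) : ℂ) * z) = z := by
  rw [← mul_assoc, ← Complex.ofReal_mul, ← Real.exp_add]
  ring_nf
  simp

theorem integrableOn_pairing (hθ : 0 < θ) (hs : ∀ t, t ∉ Ioo a 0 → ∀ x, Φ (t, x) = 0)
    (w : WeightedL2 θ) : IntegrableOn (fun t => ∫ x in cell, w t x * Φ (t, x)) (Iio 0) := by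
  have hm := memLp_exp_smul_conjSlice hθ hs
  have h1 := (integrable_withDensity_iff_integrable_smul' (measurable_weight_density θ)
    (ae_of_all _ fun _ => ENNReal.ofReal_lt_top)).1 (L2.integrable_inner (𝕜 := ℂ) hm.toLp w)
  refine IntegrableOn.mono_set (t := Iic 0) ?_ Iio_subset_Iic_self
  refine h1.congr ?_
  filter_upwards [coeFn_toLp_weight hm] with t ht
  rw [ht, inner_smul_left, Complex.conj_ofReal, inner_conjSlice,
    ENNReal.toReal_ofReal (Real.exp_pos _).le, Complex.real_smul, exp_mul_exp_neg]

/-- Parseval's identity for the pairing. -/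
theorem hasSum_pairing (hθ : 0 < θ) (hs : ∀ t, t ∉ Ioo a 0 → ∀ x, Φ (t, x) = 0)
    (w : WeightedL2 θ) : HasSum (fun k => ∫ t in Iio 0, coef k w t * hat Φ k t)
      (∫ t in Iio 0, ∫ x in cell, w t x * Φ (t, x)) := by
  have hm := memLp_exp_smul_conjSlice hθ hs
  have h1 := hasSum_inner_coef hm.toLp w
  have h2 : inner ℂ hm.toLp w = ∫ t in Iio 0, ∫ x in cell, w t x * Φ (t, x) := by
    rw [L2.inner_def, integral_weight, integral_Iic_eq_integral_Iio]
    refine integral_congr_ae ?_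
    filter_upwards [ae_restrict_of_ae_restrict_of_subset Iio_subset_Iic_self
      (coeFn_toLp_weight hm)] with t ht
    rw [ht, inner_smul_left, Complex.conj_ofReal, inner_conjSlice, smul_eq_mul, exp_mul_exp_neg]
  rw [h2] at h1
  convert h1 using 2 with k
  rw [inner_weight, integral_Iic_eq_integral_Iio]
  refine integral_congr_ae ?_
  filter_upwards [ae_restrict_of_ae_restrict_of_subset Iio_subset_Iic_self (coeFn_toLp_weight hm),
    ae_restrict_of_ae_restrict_of_subset Iio_subset_Iic_self (coeFn_coef k hm.toLp)] with t h3 h4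
  rw [h4, h3, inner_smul_right, inner_basis_conjSlice, map_mul, Complex.conj_ofReal,
    Complex.conj_conj, mul_assoc (Real.exp (-2 * θ * t) : ℂ), exp_mul_exp_neg, mul_comm]

end Pairing

/-! ### Test functions -/

section Test

variable {φ : ℝ → E3 → ℂ}

/-- The adjoint operator `-∂ₜφ - (1 + iω)Δφ`. -/
def adjointOp (ω : ℝ) (φ : ℝ → E3 → ℂ) (t : ℝ) (x : E3) : ℂ :=
  -deriv (fun s => φ s x) t - (1 + Complex.I * ω) * Laplacian.laplacian (φ t) x

theorem two_le_infty : (2 : WithTop ℕ∞) ≤ ((⊤ : ℕ∞) : WithTop ℕ∞) := by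
  exact WithTop.coe_le_coe.2 (le_top : (2 : ℕ∞) ≤ ⊤)

theorem IsTestFunction.contDiff_slice (hφ : IsTestFunction φ) (t : ℝ) :
    ContDiff ℝ ((⊤ : ℕ∞) : WithTop ℕ∞) (φ t) :=
  hφ.smooth.comp (contDiff_const.prodMk contDiff_id)

theorem IsTestFunction.deriv_eq (hφ : IsTestFunction φ) (t : ℝ) (x : E3) :
    deriv (fun s => φ s x) t = timeDeriv (fun p => φ p.1 p.2) (t, x) :=
  (hasDerivAt_timeDeriv (hφ.smooth.of_le (by exact_mod_cast le_top)) t x).deriv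

theorem fderiv_slice {g : ℝ × E3 → ℂ} {t : ℝ} {x : E3} (hg : DifferentiableAt ℝ g (t, x)) (e : E3) :
    fderiv ℝ (fun y => g (t, y)) x e = fderiv ℝ g (t, x) (0, e) := by
  have h1 : HasFDerivAt (fun y : E3 => (t, y)) (ContinuousLinearMap.inr ℝ ℝ E3) x :=
    hasFDerivAt_prodMk_right t x
  have h2 := (hg.hasFDerivAt.comp x h1).fderiv
  have h3 : (g ∘ fun y : E3 => (t, y)) = fun y => g (t, y) := rfl
  rw [← h3, h2]
  simp

theorem IsTestFunction.laplacian_eq (hφ : IsTestFunction φ) (t : ℝ) (x : E3) :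
    Laplacian.laplacian (φ t) x = ∑ i, fderiv ℝ (fun q : ℝ × E3 =>
      fderiv ℝ (fun p : ℝ × E3 => φ p.1 p.2) q (0, dir i)) (t, x) (0, dir i) := by
  rw [laplacian_eq_sum_fderiv ((hφ.contDiff_slice t).of_le two_le_infty)]
  refine Finset.sum_congr rfl fun i _ => ?_
  have hd := hφ.smooth.differentiable (by simp)
  have h1 : ∀ y, fderiv ℝ (φ t) y (dir i)
      = fderiv ℝ (fun p : ℝ × E3 => φ p.1 p.2) (t, y) (0, dir i) := fun y =>
    fderiv_slice (g := fun p : ℝ × E3 => φ p.1 p.2) (hd (t, y)) (dir i)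
  simp_rw [h1]
  have h2 : ContDiff ℝ 1 fun q : ℝ × E3 =>
      fderiv ℝ (fun p : ℝ × E3 => φ p.1 p.2) q (0, dir i) :=
    (hφ.smooth.fderiv_right (m := 1) two_le_infty).clm_apply contDiff_const
  exact fderiv_slice (h2.differentiable (by simp) (t, x)) (dir i)

theorem IsTestFunction.continuous_adjointOp (hφ : IsTestFunction φ) (ω : ℝ) :
    Continuous fun p : ℝ × E3 => adjointOp ω φ p.1 p.2 := by
  have h1 : Continuous fun p : ℝ × E3 => timeDeriv (fun p => φ p.1 p.2) p :=
    continuous_timeDeriv (hφ.smooth.of_le (by exact_mod_cast le_top))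
  have h2 : ∀ i : Fin 3, Continuous fun p : ℝ × E3 => fderiv ℝ (fun q : ℝ × E3 =>
      fderiv ℝ (fun p : ℝ × E3 => φ p.1 p.2) q (0, dir i)) p (0, dir i) := fun i => by
    have h2 : ContDiff ℝ 1 fun q : ℝ × E3 =>
        fderiv ℝ (fun p : ℝ × E3 => φ p.1 p.2) q (0, dir i) :=
      (hφ.smooth.fderiv_right (m := 1) two_le_infty).clm_apply contDiff_const
    exact (h2.continuous_fderiv (by simp)).clm_apply continuous_const
  simp only [adjointOp, hφ.deriv_eq, hφ.laplacian_eq, Prod.mk.eta]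
  exact h1.neg.sub (continuous_const.mul (continuous_finsetSum _ fun i _ => h2 i))

/-- A test function as a continuous function. -/
def IsTestFunction.toMap (hφ : IsTestFunction φ) : C(ℝ × E3, ℂ) :=
  ⟨fun p => φ p.1 p.2, hφ.smooth.continuous⟩

/-- The image of a test function under the adjoint operator as a continuous function. -/
def IsTestFunction.adjointMap (hφ : IsTestFunction φ) (ω : ℝ) : C(ℝ × E3, ℂ) :=
  ⟨fun p => adjointOp ω φ p.1 p.2, hφ.continuous_adjointOp ω⟩

theorem IsTestFunction.exists_support (hφ : IsTestFunction φ) (ω : ℝ) :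
    ∃ a, (∀ t, t ∉ Ioo a 0 → ∀ x, hφ.toMap (t, x) = 0) ∧
      ∀ t, t ∉ Ioo a 0 → ∀ x, hφ.adjointMap ω (t, x) = 0 := by
  obtain ⟨s, r, hr, hs⟩ := hφ.support
  have hz : ∀ t, t ∉ Icc s r → φ t = 0 := fun t ht => funext fun x => by
    by_contra h
    exact ht (hs t x h)
  have hsub : ∀ t, t ∉ Ioo (s - 1) 0 → t ∈ (Icc s r)ᶜ := fun t ht h =>
    ht ⟨by linarith [h.1], lt_of_le_of_lt h.2 hr⟩
  refine ⟨s - 1, fun t ht x => congrFun (hz t (hsub t ht)) x, fun t ht x => ?_⟩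
  show adjointOp ω φ t x = 0
  have h1 : (fun s => φ s x) =ᶠ[nhds t] fun _ => 0 := by
    filter_upwards [isClosed_Icc.isOpen_compl.mem_nhds (hsub t ht)] with τ hτ
    exact congrFun (hz τ hτ) x
  have h2 : Laplacian.laplacian (φ t) x = 0 := by
    rw [hz t (hsub t ht)]
    show Laplacian.laplacian (fun _ : E3 => (0 : ℂ)) x = 0
    rw [laplacian_eq_sum_fderiv contDiff_const]
    simp
  rw [adjointOp, h1.deriv_eq, h2]
  simp

theorem IsTestFunction.hasDerivAt_hat (hφ : IsTestFunction φ) (k : Fin 3 → ℤ) (t : ℝ) :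
    HasDerivAt (hat hφ.toMap k)
      (normConst * ∫ x in cell, timeDeriv (fun p => φ p.1 p.2) (t, x) * expMode k x) t :=
  (hasDerivAt_integral_cell (hφ.smooth.of_le (by exact_mod_cast le_top)) (continuous_expMode k)
    t).const_mul _

theorem IsTestFunction.isC1Test_hat (hφ : IsTestFunction φ) (k : Fin 3 → ℤ) :
    IsC1Test (hat hφ.toMap k)
      (fun t => normConst * ∫ x in cell, timeDeriv (fun p => φ p.1 p.2) (t, x) * expMode k x) where
  hasDerivAt := hφ.hasDerivAt_hat k
  continuous_deriv := by
    have h1 := continuous_timeDeriv (g := fun p : ℝ × E3 => φ p.1 p.2)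
      (hφ.smooth.of_le (by exact_mod_cast le_top))
    exact continuous_const.mul (continuous_integral_cell
      (g := fun p => timeDeriv (fun p => φ p.1 p.2) p * expMode k p.2)
      (h1.mul ((continuous_expMode k).comp continuous_snd)))
  support := by
    obtain ⟨s, r, hr, hs⟩ := hφ.support
    refine ⟨s, r, hr, fun t ht => ?_⟩
    have hz : ∀ x, hφ.toMap (t, x) = 0 := fun x => by
      by_contra h
      exact ht (hs t x h)
    simp [hat, hz]

theorem IsTestFunction.hat_adjointMap (hφ : IsTestFunction φ) (ω : ℝ) (k : Fin 3 → ℤ) (t : ℝ) :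
    hat (hφ.adjointMap ω) k t
      = -(normConst * ∫ x in cell, timeDeriv (fun p => φ p.1 p.2) (t, x) * expMode k x)
        + rate ω k * hat hφ.toMap k t := by
  have h1 := continuous_timeDeriv (g := fun p : ℝ × E3 => φ p.1 p.2)
    (hφ.smooth.of_le (by exact_mod_cast le_top))
  have hA : IntegrableOn (fun x => timeDeriv (fun p => φ p.1 p.2) (t, x) * expMode k x) cell :=
    integrableOn_cell ((h1.comp (Continuous.prodMk_right t)).mul (continuous_expMode k))
  have h2 := (hφ.contDiff_slice t).of_le two_le_infty
  have hlap : Continuous fun x => Laplacian.laplacian (φ t) x := by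
    simp_rw [laplacian_eq_sum_fderiv h2]
    exact continuous_finsetSum _ fun i _ =>
      (((h2.fderiv_right (m := 1) (by norm_num)).clm_apply contDiff_const).continuous_fderiv
        (by simp)).clm_apply continuous_const
  have hB : IntegrableOn (fun x => Laplacian.laplacian (φ t) x * expMode k x) cell :=
    integrableOn_cell (hlap.mul (continuous_expMode k))
  have h3 : ∀ x, hφ.adjointMap ω (t, x) * expMode k x
      = -(timeDeriv (fun p => φ p.1 p.2) (t, x) * expMode k x)
        - (1 + Complex.I * ω) * (Laplacian.laplacian (φ t) x * expMode k x) := fun x => by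
    show adjointOp ω φ t x * _ = _
    rw [adjointOp, hφ.deriv_eq]
    ring
  have hA' : IntegrableOn
      (fun x => -(timeDeriv (fun p => φ p.1 p.2) (t, x) * expMode k x)) cell := hA.neg
  rw [hat, integral_congr_ae (ae_of_all _ h3), integral_sub hA' (hB.const_mul _), integral_neg,
    integral_const_mul, integral_laplacian_mul_expMode h2 (hφ.periodic t), hat, rate]
  show _ = _ + _ * (_ * ∫ x in cell, φ t x * expMode k x)
  ring

end Test

/-! ### Distributional solutions and mild solutions -/

/-- `v` solves `∂ₜv - (1 + iω)Δv = F` on `(-∞, 0) × 𝕋³` in the sense of distributions. -/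
def WeakSol (ω : ℝ) {θ : ℝ} (F v : WeightedL2 θ) : Prop :=
  ∀ φ : ℝ → E3 → ℂ, IsTestFunction φ →
    ∫ t in Iio (0 : ℝ), ∫ x in cell, v t x * adjointOp ω φ t x
      = ∫ t in Iio (0 : ℝ), ∫ x in cell, F t x * φ t x

theorem eigenvalue_neg (k : Fin 3 → ℤ) : eigenvalue (-k) = eigenvalue k := by
  simp [eigenvalue]

theorem isTestFunction_mul_expMode {ψ : ℝ → ℂ} (hψ : IsSmoothTest ψ) (k : Fin 3 → ℤ) :
    IsTestFunction fun t x => ψ t * expMode k x where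
  smooth := (hψ.contDiff.comp contDiff_fst).mul ((contDiff_expMode k).comp contDiff_snd)
  periodic t x i := congrArg (ψ t * ·) (isPeriodic_expMode k x i)
  support := by
    obtain ⟨a, r, hr, h⟩ := hψ.support
    refine ⟨a, r, hr, fun t x hne => ?_⟩
    by_contra ht
    exact hne (by rw [h t ht, zero_mul])

theorem integral_cell_mul_expMode (g : H) (c : ℂ) (k : Fin 3 → ℤ) :
    ∫ x in cell, g x * (c * expMode (-k) x) = (normConst : ℂ)⁻¹ * (inner ℂ (basis k) g * c) := by
  have hn : (normConst : ℂ) ≠ 0 := by exact_mod_cast normConst_pos.ne'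
  have h : ∀ x, g x * (c * expMode (-k) x) = c * (conj (expMode k x) * g x) := fun x => by
    rw [conj_expMode]
    ring
  rw [integral_congr_ae (ae_of_all _ h), integral_const_mul, inner_basis]
  field_simp

theorem integral_mul_expMode {θ : ℝ} (w : WeightedL2 θ) (c : ℝ → ℂ) (k : Fin 3 → ℤ) :
    ∫ t in Iio (0 : ℝ), ∫ x in cell, w t x * (c t * expMode (-k) x)
      = (normConst : ℂ)⁻¹ * ∫ t in Iio (0 : ℝ), coef k w t * c t := by
  simp_rw [integral_cell_mul_expMode]
  rw [integral_const_mul]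
  congr 1
  refine integral_congr_ae ?_
  filter_upwards [ae_restrict_of_ae_restrict_of_subset Iio_subset_Iic_self (coeFn_coef k w)]
    with t ht
  rw [ht]

theorem adjointOp_mul_expMode (ω : ℝ) (ψ : ℝ → ℂ) (k : Fin 3 → ℤ) (t : ℝ) (x : E3) :
    adjointOp ω (fun t x => ψ t * expMode (-k) x) t x
      = (-deriv ψ t + rate ω k * ψ t) * expMode (-k) x := by
  rw [adjointOp, laplacian_const_mul_expMode, deriv_mul_const_field, eigenvalue_neg, rate]
  ring

/-- A function solves the heat equation in the sense of distributions if and only if its Fourier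
modes solve the corresponding ordinary differential equations. -/
theorem weakSol_iff {ω θ : ℝ} (hθ : 0 < θ) {F v : WeightedL2 θ} :
    WeakSol ω F v ↔ ∀ k, ∃ C, ∀ᵐ t ∂(volume.restrict (Iic (0 : ℝ))),
      coef k v t = odeSol (rate ω k) (coef k F) C t := by
  constructor
  · intro h k
    refine exists_eq_odeSol_of_weak (Lp.memLp _) (Lp.memLp _) fun ψ hψ => ?_
    have h1 := h _ (isTestFunction_mul_expMode hψ (-k))
    simp_rw [adjointOp_mul_expMode] at h1
    rw [integral_mul_expMode, integral_mul_expMode] at h1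
    have hn : (normConst : ℂ)⁻¹ ≠ 0 := inv_ne_zero (by exact_mod_cast normConst_pos.ne')
    exact mul_left_cancel₀ hn h1
  · intro h φ hφ
    obtain ⟨a, h0, h1⟩ := hφ.exists_support ω
    have hs1 := hasSum_pairing hθ h1 v
    have hs2 : HasSum _ (∫ t in Iio (0 : ℝ), ∫ x in cell, F t x * φ t x) := hasSum_pairing hθ h0 F
    refine hs1.unique ?_
    convert hs2 using 2 with k
    obtain ⟨C, hC⟩ := h k
    rw [← integral_odeSol_mul_test (Lp.memLp _) C (hφ.isC1Test_hat k)]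
    refine integral_congr_ae ?_
    filter_upwards [ae_restrict_of_ae_restrict_of_subset Iio_subset_Iic_self hC] with t ht
    rw [ht, hφ.hat_adjointMap]

theorem ae_coef_free (ω : ℝ) (N : ℕ) (u : H) (k : Fin 3 → ℤ) :
    ∀ᵐ t ∂(volume.restrict (Iic (0 : ℝ))), coef k (free ω N u) t
      = if eigenvalue k ≤ N then Complex.exp (-rate ω k * t) * inner ℂ (basis k) u else 0 := by
  rw [coef_free]
  by_cases h : (rate ω k).re < (N : ℝ) + 1 / 2
  · rw [dif_pos h]
    filter_upwards [ae_weight_iff.1 (Lp.coeFn_smul (inner ℂ (basis k) u : ℂ) (expLp h)),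
      coeFn_toLp_weight (memLp_exp h)] with t h1 h2
    rw [h1, Pi.smul_apply, expLp, h2, if_pos ((rate_re_lt_iff ω N k).1 h), smul_eq_mul, mul_comm]
  · rw [dif_neg h]
    filter_upwards [ae_weight_iff.1 (Lp.coeFn_zero ℂ 2 (weight ((N : ℝ) + 1 / 2)))] with t h1
    rw [h1, if_neg (mt (rate_re_lt_iff ω N k).2 h), Pi.zero_apply]

/-- The modes of the mild solution. -/
theorem ae_coef_free_add_solve (ω : ℝ) (N : ℕ) (u : H) (F : WeightedL2 ((N : ℝ) + 1 / 2))
    (k : Fin 3 → ℤ) : ∀ᵐ t ∂(volume.restrict (Iic (0 : ℝ))),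
      coef k (free ω N u + solve ω N F) t = odeSol (rate ω k) (coef k F)
        (if eigenvalue k ≤ N then inner ℂ (basis k) u
          else finalValue ((N : ℝ) + 1 / 2) (rate ω k) (coef k F)) t := by
  rw [map_add, coef_solve]
  filter_upwards [ae_coef_free ω N u k, coeFn_solOp (rate_re_ne ω N k) (coef k F),
    ae_weight_iff.1 (Lp.coeFn_add (coef k (free ω N u))
      (solOp ((N : ℝ) + 1 / 2) (rate ω k) (coef k F)))] with t h1 h2 h3
  rw [h3, Pi.add_apply, h1, h2]
  split_ifs with h
  · rw [finalValue, if_pos ((rate_re_lt_iff ω N k).2 h), add_comm, ← odeSol_add_const, zero_add]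
  · rw [zero_add]

theorem inner_basis_of_mem_HN {N : ℕ} {u : H} (hu : u ∈ HN N) {k : Fin 3 → ℤ}
    (hk : ¬ eigenvalue k ≤ N) : inner ℂ (basis k) u = (0 : ℂ) := by
  have h := inner_basis_P N k u
  rwa [if_neg hk, P, Submodule.starProjection_eq_self_iff.2 hu] at h

/-- Distributional solutions with prescribed final value are the mild solutions: the modes outside
`H_N` are determined by membership in the weighted space, the others by the final value. -/
theorem weakSol_and_hasFinalValue_iff {ω : ℝ} {N : ℕ} {F v : WeightedL2 ((N : ℝ) + 1 / 2)} {u : H}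
    (hu : u ∈ HN N) :
    WeakSol ω F v ∧ HasFinalValue N v u ↔ v = free ω N u + solve ω N F := by
  have hθ : 0 < (N : ℝ) + 1 / 2 := by positivity
  constructor
  · rintro ⟨h, p, hpc, hp0, hp⟩
    refine weightedL2_ext fun k => Lp.ext (ae_weight_iff.2 ?_)
    obtain ⟨C, hC⟩ := (weakSol_iff hθ).1 h k
    have hC' : C = if eigenvalue k ≤ N then inner ℂ (basis k) u
          else finalValue ((N : ℝ) + 1 / 2) (rate ω k) (coef k F) := by
      split_ifs with hk
      · have h1 : (fun t => (inner ℂ (basis k) (p t) : ℂ)) =ᵐ[volume.restrict (Iic 0)]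
            odeSol (rate ω k) (coef k F) C := by
          filter_upwards [hp, hC, coeFn_coef k v] with t h2 h3 h4
          rw [← h3, h4, ← h2, inner_basis_P, if_pos hk]
        have h2 : EqOn (fun t => (inner ℂ (basis k) (p t) : ℂ)) (odeSol (rate ω k) (coef k F) C)
            (Iic 0) := by
          refine Measure.eqOn_of_ae_eq h1 (continuousOn_const.inner hpc)
            (continuous_odeSol (Lp.memLp _) C).continuousOn ?_
          rw [interior_Iic, closure_Iio]
        have h3 := h2 (mem_Iic.2 le_rfl)
        simp only [hp0, odeSol_zero] at h3
        exact h3.symm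
      · refine eq_finalValue_of_memLp ?_ (Lp.memLp _)
          ((memLp_congr_ae (ae_weight_iff.2 hC)).1 (Lp.memLp (coef k v)))
        exact lt_of_le_of_ne (not_lt.1 (mt (rate_re_lt_iff ω N k).1 hk)) (rate_re_ne ω N k).symm
    filter_upwards [hC, ae_coef_free_add_solve ω N u F k] with t h1 h2
    rw [h1, h2, hC']
  · rintro rfl
    refine ⟨(weakSol_iff hθ).2 fun k => ⟨_, ae_coef_free_add_solve ω N u F k⟩, fun t =>
      ∑ k ∈ (finite_modes N).toFinset,
        odeSol (rate ω k) (coef k F) (inner ℂ (basis k) u) t • basis k, ?_, ?_, ?_⟩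
    · exact (continuous_finsetSum _ fun k _ =>
        (continuous_odeSol (Lp.memLp (coef k F)) _).smul continuous_const).continuousOn
    · refine ext_inner_basis fun k => ?_
      simp only [odeSol_zero, inner_sum, inner_smul_right, orthonormal_iff_ite.1 basis.orthonormal]
      rw [Finset.sum_eq_single k (fun l _ hl => by rw [if_neg (Ne.symm hl), mul_zero])]
      · rw [if_pos rfl, mul_one]
      · intro hk
        rw [if_pos rfl, mul_one]
        exact inner_basis_of_mem_HN hu (by simpa using hk)
    · have h1 := ae_all_iff.2 fun k => ae_coef_free_add_solve ω N u F k
      have h2 := ae_all_iff.2 fun k => coeFn_coef k (free ω N u + solve ω N F)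
      filter_upwards [h1, h2] with t h3 h4
      refine ext_inner_basis fun k => ?_
      rw [inner_basis_P, ← h4, h3]
      simp only [inner_sum, inner_smul_right, orthonormal_iff_ite.1 basis.orthonormal]
      split_ifs with hk
      · rw [Finset.sum_eq_single k (fun l _ hl => by rw [if_neg (Ne.symm hl), mul_zero])]
        · rw [if_pos rfl, mul_one]
        · intro hk'
          exact absurd (by simpa using hk) hk'
      · refine (Finset.sum_eq_zero fun l hl => ?_).symm
        rw [if_neg, mul_zero]
        rintro rfl
        exact hk (by simpa using hl)

/-! ### The perturbation -/

section Perturbation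

variable {a b : ℝ → E3 → ℂ} {K : ℝ≥0}

/-- A `C¹` coefficient as a continuous function. -/
def IsC1.toMap (ha : IsC1 a) : C(ℝ × E3, ℂ) := ⟨fun p => a p.1 p.2, ha.1.continuous⟩

theorem norm_le_of_c1Norm (h : c1Norm a ≤ K) (t : ℝ) (x : E3) : ‖a t x‖ ≤ K := by
  have h1 : ‖a t x‖ₑ ≤ K :=
    (le_iSup (fun p : ℝ × E3 => ‖a p.1 p.2‖ₑ) (t, x)).trans (le_self_add.trans h)
  rw [enorm_le_coe] at h1
  exact_mod_cast h1

theorem nnnorm_fderiv_le_of_c1Norm (h : c1Norm a ≤ K) (p : ℝ × E3) :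
    ‖fderiv ℝ (fun q : ℝ × E3 => a q.1 q.2) p‖₊ ≤ K := by
  have h1 : ‖fderiv ℝ (fun q : ℝ × E3 => a q.1 q.2) p‖ₑ ≤ K :=
    (le_iSup (fun p : ℝ × E3 => ‖fderiv ℝ (fun q : ℝ × E3 => a q.1 q.2) p‖ₑ) p).trans
      (le_add_self.trans h)
  rwa [enorm_le_coe] at h1

theorem IsC1.lipschitzWith (ha : IsC1 a) (h : c1Norm a ≤ K) (t : ℝ) : LipschitzWith K (a t) := by
  have h1 : LipschitzWith K fun q : ℝ × E3 => a q.1 q.2 :=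
    lipschitzWith_of_nnnorm_fderiv_le (𝕜 := ℝ) (ha.1.differentiable (by simp))
      (nnnorm_fderiv_le_of_c1Norm h)
  have h2 := h1.comp (LipschitzWith.prodMk_left t)
  rwa [mul_one] at h2

theorem norm_timeDeriv_le (h : c1Norm a ≤ K) (p : ℝ × E3) :
    ‖timeDeriv (fun q : ℝ × E3 => a q.1 q.2) p‖ ≤ K := by
  have h1 := nnnorm_fderiv_le_of_c1Norm h p
  refine ((fderiv ℝ (fun q : ℝ × E3 => a q.1 q.2) p).le_opNorm _).trans ?_
  have h2 : ‖((1 : ℝ), (0 : E3))‖ = 1 := by simp [Prod.norm_def]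
  rw [h2, mul_one]
  exact_mod_cast h1

/-- Multiplication by `Φ (t, ·)`. -/
def mulAt (Φ : C(ℝ × E3, ℂ)) (t : ℝ) : H →L[ℝ] H := (mulOp (slice Φ t)).restrictScalars ℝ

theorem continuous_mulAt (Φ : C(ℝ × E3, ℂ)) : Continuous (mulAt Φ) :=
  (ContinuousLinearMap.restrictScalarsL ℂ H H ℝ ℝ).continuous.comp
    (continuous_mulOp (slice Φ).continuous)

theorem norm_mulAt_le {Φ : C(ℝ × E3, ℂ)} {c : ℝ} (h : ∀ p, ‖Φ p‖ ≤ c) (t : ℝ) :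
    ‖mulAt Φ t‖ ≤ c := by
  rw [mulAt, ContinuousLinearMap.norm_restrictScalars]
  exact norm_mulOp_le ((norm_nonneg _).trans (h (0, 0))) fun x _ => h (t, x)

theorem norm_mulAt_conjOp_le {Φ : C(ℝ × E3, ℂ)} {c : ℝ} (h : ∀ p, ‖Φ p‖ ≤ c) (t : ℝ) :
    ‖(mulAt Φ t).comp conjOp‖ ≤ c := by
  have hc : 0 ≤ c := (norm_nonneg _).trans (h (0, 0))
  refine ((mulAt Φ t).opNorm_comp_le _).trans ?_
  calc _ ≤ c * 1 := mul_le_mul (norm_mulAt_le h t) norm_conjOp_le (norm_nonneg _) hc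
    _ = c := mul_one c

/-- The operator `v ↦ Φ v`. -/
def multiply {θ c : ℝ} {Φ : C(ℝ × E3, ℂ)} (h : ∀ p, ‖Φ p‖ ≤ c) : WeightedL2 θ →L[ℝ] WeightedL2 θ :=
  pointwise (continuous_mulAt Φ) (norm_mulAt_le h)

/-- The operator `v ↦ Φ v̄`. -/
def conjMultiply {θ c : ℝ} {Φ : C(ℝ × E3, ℂ)} (h : ∀ p, ‖Φ p‖ ≤ c) :
    WeightedL2 θ →L[ℝ] WeightedL2 θ :=
  pointwise (O := fun t => (mulAt Φ t).comp conjOp)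
    ((continuous_mulAt Φ).clm_comp continuous_const) (norm_mulAt_conjOp_le h)

theorem solvesEquation_iff {ω θ c : ℝ} (hθ : 0 < θ) (ha : IsC1 a) (hb : IsC1 b)
    (hac : ∀ p, ‖ha.toMap p‖ ≤ c) (hbc : ∀ p, ‖hb.toMap p‖ ≤ c) {h v : WeightedL2 θ} :
    SolvesEquation ω a b h v ↔ WeakSol ω (h - (multiply hac v + conjMultiply hbc v)) v := by
  refine forall₂_congr fun φ hφ => ?_
  obtain ⟨r, h0, h1⟩ := hφ.exists_support ω
  set B := multiply hac v + conjMultiply hbc v with hB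
  have hpt : ∀ᵐ t ∂(volume.restrict (Iio (0 : ℝ))), ∫ x in cell,
      (v t x * (-deriv (fun s => φ s x) t - (1 + Complex.I * ω) * Laplacian.laplacian (φ t) x)
          + (a t x * v t x + b t x * conj (v t x)) * φ t x)
      = (∫ x in cell, v t x * adjointOp ω φ t x) + ∫ x in cell, B t x * φ t x := by
    refine ae_restrict_of_ae_restrict_of_subset Iio_subset_Iic_self (ae_weight_iff (θ := θ).1 ?_)
    filter_upwards [coeFn_pointwise (continuous_mulAt ha.toMap) (norm_mulAt_le hac) v,
      coeFn_pointwise (O := fun t => (mulAt hb.toMap t).comp conjOp)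
        ((continuous_mulAt hb.toMap).clm_comp continuous_const) (norm_mulAt_conjOp_le hbc) v,
      Lp.coeFn_add (multiply hac v) (conjMultiply hbc v)] with t h2 h3 h4
    refine Eq.trans ?_ (integral_add (integrable_mul_slice (hφ.adjointMap ω) t (v t))
      (integrable_mul_slice hφ.toMap t (B t)))
    refine integral_congr_ae ?_
    have h5 : B t = mulOp (slice ha.toMap t) (v t) + mulOp (slice hb.toMap t) (conjOp (v t)) := by
      rw [hB, h4, Pi.add_apply]
      exact congrArg₂ _ h2 h3
    filter_upwards [coeFn_mulOp (slice ha.toMap t) (v t),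
      coeFn_mulOp (slice hb.toMap t) (conjOp (v t)), coeFn_conjOp (v t),
      Lp.coeFn_add (mulOp (slice ha.toMap t) (v t)) (mulOp (slice hb.toMap t) (conjOp (v t)))]
      with x h6 h7 h8 h9
    rw [h5, h9, Pi.add_apply, h6, h7, h8]
    rfl
  have hpt' : ∀ᵐ t ∂(volume.restrict (Iio (0 : ℝ))), ∫ x in cell, (h - B) t x * φ t x
      = (∫ x in cell, h t x * φ t x) - ∫ x in cell, B t x * φ t x := by
    refine ae_restrict_of_ae_restrict_of_subset Iio_subset_Iic_self (ae_weight_iff (θ := θ).1 ?_)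
    filter_upwards [Lp.coeFn_sub h B] with t h2
    refine Eq.trans ?_ (integral_sub (integrable_mul_slice hφ.toMap t (h t))
      (integrable_mul_slice hφ.toMap t (B t)))
    refine integral_congr_ae ?_
    rw [h2, Pi.sub_apply]
    filter_upwards [Lp.coeFn_sub (h t) (B t)] with x hx
    rw [hx, Pi.sub_apply, sub_mul]
  have hi1 : IntegrableOn (fun t => ∫ x in cell, v t x * adjointOp ω φ t x) (Iio 0) :=
    integrableOn_pairing hθ h1 v
  have hi2 : ∀ w : WeightedL2 θ, IntegrableOn (fun t => ∫ x in cell, w t x * φ t x) (Iio 0) :=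
    integrableOn_pairing hθ h0
  rw [integral_congr_ae hpt, integral_congr_ae hpt', integral_add hi1 (hi2 B),
    integral_sub (hi2 h) (hi2 B), eq_sub_iff_add_eq]

end Perturbation

/-! ### Fourier multipliers and the spectral window -/

section Multiplier

variable {θ : ℝ} {m : (Fin 3 → ℤ) → ℂ} {c : ℝ}

theorem norm_smul_id_le (hm : ∀ k, ‖m k‖ ≤ c) (k : Fin 3 → ℤ) :
    ‖m k • ContinuousLinearMap.id ℂ (Lp ℂ 2 (weight θ))‖ ≤ c := by
  refine (norm_smul_le (m k) (ContinuousLinearMap.id ℂ (Lp ℂ 2 (weight θ)))).trans ?_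
  calc _ ≤ ‖m k‖ * 1 := mul_le_mul_of_nonneg_left ContinuousLinearMap.norm_id_le (norm_nonneg _)
    _ ≤ c := by rw [mul_one]; exact hm k

/-- The Fourier multiplier with bounded symbol `m`. -/
def multiplier (hm : ∀ k, ‖m k‖ ≤ c) : WeightedL2 θ →L[ℂ] WeightedL2 θ :=
  diagonal (fun k => m k • ContinuousLinearMap.id ℂ (Lp ℂ 2 (weight θ))) (norm_smul_id_le hm)

theorem coef_multiplier (hm : ∀ k, ‖m k‖ ≤ c) (k : Fin 3 → ℤ) (v : WeightedL2 θ) :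
    coef k (multiplier hm v) = m k • coef k v :=
  coef_diagonal _ _ _

theorem norm_multiplier_le (hm : ∀ k, ‖m k‖ ≤ c) (v : WeightedL2 θ) :
    ‖multiplier hm v‖ ≤ c * ‖v‖ :=
  norm_le_of_coef ((norm_nonneg _).trans (hm 0)) fun k => by
    rw [coef_multiplier, norm_smul]
    exact mul_le_mul_of_nonneg_right (hm k) (norm_nonneg _)

end Multiplier

/-- The indicator function of the window. -/
def winSymbol (κ N : ℕ) (k : Fin 3 → ℤ) : ℂ := if k ∈ window κ N then 1 else 0

/-- The function `λ - N` on the window. -/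
def shiftSymbol (κ N : ℕ) (k : Fin 3 → ℤ) : ℂ :=
  if k ∈ window κ N then ((eigenvalue k - N : ℤ) : ℂ) else 0

theorem norm_winSymbol_le (κ N : ℕ) (k : Fin 3 → ℤ) : ‖winSymbol κ N k‖ ≤ 1 := by
  unfold winSymbol
  split_ifs <;> simp

theorem norm_shiftSymbol_le (κ N : ℕ) (k : Fin 3 → ℤ) : ‖shiftSymbol κ N k‖ ≤ κ := by
  unfold shiftSymbol
  split_ifs with h
  · rw [Complex.norm_intCast]
    exact_mod_cast (show |eigenvalue k - N| ≤ κ from h)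
  · simp

section Window

variable {θ : ℝ} {κ N : ℕ}

/-- The projector onto the modes of the window, acting on functions of time. -/
def win (κ N : ℕ) : WeightedL2 θ →L[ℂ] WeightedL2 θ := multiplier (norm_winSymbol_le κ N)

/-- The operator `-Δ - N` on the modes of the window. -/
def winShift (κ N : ℕ) : WeightedL2 θ →L[ℂ] WeightedL2 θ := multiplier (norm_shiftSymbol_le κ N)

theorem coef_win (k : Fin 3 → ℤ) (v : WeightedL2 θ) : coef k (win κ N v) = winSymbol κ N k • coef k v :=
  coef_multiplier _ _ _

theorem coef_winShift (k : Fin 3 → ℤ) (v : WeightedL2 θ) :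
    coef k (winShift κ N v) = shiftSymbol κ N k • coef k v :=
  coef_multiplier _ _ _

theorem norm_win_le (v : WeightedL2 θ) : ‖win κ N v‖ ≤ ‖v‖ :=
  (norm_multiplier_le (norm_winSymbol_le κ N) v).trans_eq (one_mul _)

theorem norm_winShift_le (v : WeightedL2 θ) : ‖winShift κ N v‖ ≤ κ * ‖v‖ :=
  norm_multiplier_le (norm_shiftSymbol_le κ N) v

theorem coeFn_win (hN : κ < N) (v : WeightedL2 θ) :
    ∀ᵐ t ∂(weight θ), win κ N v t = winProj κ N (v t) := by
  have h1 := ae_all_iff.2 fun k => ae_weight_iff (θ := θ).2 (coeFn_coef k v)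
  have h2 := ae_all_iff.2 fun k => ae_weight_iff (θ := θ).2 (coeFn_coef k (win κ N v))
  have h3 := ae_all_iff.2 fun k => Lp.coeFn_smul (winSymbol κ N k) (coef k v)
  filter_upwards [h1, h2, h3] with t h4 h5 h6
  refine ext_inner_basis fun k => ?_
  rw [inner_basis_winProj hN, ← h5, coef_win, h6, Pi.smul_apply, h4, winSymbol]
  split_ifs <;> simp

/-- Away from the window, the spectral gap makes the unperturbed solution operator small. -/
theorem norm_solve_sub_win_le (ω : ℝ) (v : WeightedL2 ((N : ℝ) + 1 / 2)) :
    ‖solve ω N (v - win κ N v)‖ ≤ 2 / (κ + 1 / 2) * ‖v‖ := by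
  refine norm_le_of_coef (by positivity) fun k => ?_
  rw [coef_solve, map_sub, coef_win, winSymbol]
  split_ifs with h
  · rw [one_smul, sub_self, map_zero, norm_zero]
    positivity
  · rw [zero_smul, sub_zero]
    refine (solOp _ _).le_of_opNorm_le ((norm_solOp_le _ _).trans ?_) _
    refine div_le_div_of_nonneg_left (by norm_num) (by positivity) ?_
    rw [rate_re]
    have h' : (κ : ℤ) + 1 ≤ |eigenvalue k - N| := by
      have : ¬ |eigenvalue k - N| ≤ κ := h
      omega
    have h'' : (κ : ℝ) + 1 ≤ |(eigenvalue k : ℝ) - N| := by exact_mod_cast h'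
    rcases le_abs.1 h'' with h3 | h3
    · rw [le_abs]
      left
      linarith
    · rw [le_abs]
      right
      linarith

/-- The element of `H` with given Fourier coefficients on the window. -/
def winSum (κ N : ℕ) (c : (Fin 3 → ℤ) → ℂ) : H := ∑ l ∈ (finite_window κ N).toFinset, c l • basis l

theorem inner_basis_winSum (c : (Fin 3 → ℤ) → ℂ) (k : Fin 3 → ℤ) :
    inner ℂ (basis k) (winSum κ N c) = if k ∈ window κ N then c k else 0 := by
  simp only [winSum, inner_sum, inner_smul_right, orthonormal_iff_ite.1 basis.orthonormal]
  split_ifs with hk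
  · rw [Finset.sum_eq_single k (fun l _ hl => by rw [if_neg (Ne.symm hl), mul_zero])]
    · rw [if_pos rfl, mul_one]
    · intro hk'
      exact absurd (by simpa using hk) hk'
  · refine Finset.sum_eq_zero fun l hl => ?_
    rw [if_neg, mul_zero]
    rintro rfl
    exact hk (by simpa using hl)

theorem norm_winSum_sq (c : (Fin 3 → ℤ) → ℂ) :
    ‖winSum κ N c‖ ^ 2 = ∑ l ∈ (finite_window κ N).toFinset, ‖c l‖ ^ 2 := by
  have h1 : (inner ℂ (winSum κ N c) (winSum κ N c) : ℂ)
      = ∑ l ∈ (finite_window κ N).toFinset, conj (c l) * c l := by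
    rw [winSum, basis.orthonormal.inner_sum]
  rw [inner_self_eq_norm_sq_to_K] at h1
  simp_rw [Complex.conj_mul'] at h1
  refine Complex.ofReal_injective ?_
  rw [Complex.ofReal_pow, Complex.ofReal_sum]
  simpa using h1

theorem ae_eq_winSum {w : WeightedL2 θ} {c : (Fin 3 → ℤ) → ℝ → ℂ}
    (h0 : ∀ k, k ∉ window κ N → coef k w = 0)
    (h : ∀ k ∈ window κ N, ∀ᵐ t ∂(volume.restrict (Iic (0 : ℝ))), coef k w t = c k t) :
    ∀ᵐ t ∂(volume.restrict (Iic (0 : ℝ))), w t = winSum κ N fun k => c k t := by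
  have h1 : ∀ k, ∀ᵐ t ∂(volume.restrict (Iic (0 : ℝ))),
      inner ℂ (basis k) (w t) = if k ∈ window κ N then c k t else 0 := fun k => by
    by_cases hk : k ∈ window κ N
    · filter_upwards [coeFn_coef k w, h k hk] with t h2 h3
      rw [← h2, h3, if_pos hk]
    · filter_upwards [coeFn_coef k w, ae_weight_iff.1 (Lp.coeFn_zero ℂ 2 (weight θ))] with t h2 h3
      rw [← h2, h0 k hk, h3, if_neg hk, Pi.zero_apply]
  filter_upwards [ae_all_iff.2 h1] with t h2
  refine ext_inner_basis fun k => ?_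
  rw [h2, inner_basis_winSum]

end Window

theorem mulAt_apply (Φ : C(ℝ × E3, ℂ)) (t : ℝ) (g : H) : mulAt Φ t g = mulOp (slice Φ t) g := rfl

/-! ### Matrix elements of multiplication and conjugation -/

/-- The matrix element `⟨e_k, Φ(t) ē_l⟩`. -/
def crossCoef (Φ : C(ℝ × E3, ℂ)) (k l : Fin 3 → ℤ) (t : ℝ) : ℂ :=
  inner ℂ (basis k) (mulAt Φ t (conjOp (basis l)))

theorem crossCoef_eq (Φ : C(ℝ × E3, ℂ)) (k l : Fin 3 → ℤ) (t : ℝ) :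
    crossCoef Φ k l t
      = (normConst : ℂ) ^ 2 * ∫ x in cell, Φ (t, x) * (expMode (-k) x * expMode (-l) x) := by
  have h : ∫ x in cell, conj (expMode k x) * mulAt Φ t (conjOp (basis l)) x
      = ∫ x in cell, normConst * (Φ (t, x) * (expMode (-k) x * expMode (-l) x)) := by
    refine integral_congr_ae ?_
    filter_upwards [coeFn_mulOp (slice Φ t) (conjOp (basis l)), coeFn_conjOp (basis l),
      coeFn_basis l] with x h1 h2 h3
    rw [mulAt_apply, h1, h2, h3, map_mul, Complex.conj_ofReal, conj_expMode, conj_expMode,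
      slice_apply]
    ring
  rw [crossCoef, inner_basis, h, integral_const_mul]
  ring

theorem hasDerivAt_crossCoef {Φ Φ' : C(ℝ × E3, ℂ)} (hΦ : ContDiff ℝ 1 Φ)
    (hΦ' : ∀ p, Φ' p = timeDeriv Φ p) (k l : Fin 3 → ℤ) (t : ℝ) :
    HasDerivAt (crossCoef Φ k l) (crossCoef Φ' k l t) t := by
  have h := (hasDerivAt_integral_cell hΦ (e := fun x => expMode (-k) x * expMode (-l) x)
    ((continuous_expMode _).mul (continuous_expMode _)) t).const_mul ((normConst : ℂ) ^ 2)
  rw [funext (crossCoef_eq Φ k l), crossCoef_eq]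
  simp_rw [hΦ']
  exact h

theorem inner_basis_mulAt_conjOp_winSum (Φ : C(ℝ × E3, ℂ)) {κ N : ℕ} (c : (Fin 3 → ℤ) → ℂ)
    (k : Fin 3 → ℤ) (t : ℝ) :
    inner ℂ (basis k) (mulAt Φ t (conjOp (winSum κ N c)))
      = ∑ l ∈ (finite_window κ N).toFinset, conj (c l) * crossCoef Φ k l t := by
  rw [winSum, map_sum, map_sum, inner_sum]
  refine Finset.sum_congr rfl fun l _ => ?_
  rw [conjOp_smul, mulAt_apply, map_smul, inner_smul_right]
  rfl

/-! ### Temporal averaging -/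

section Temporal

variable {ω : ℝ} {κ N : ℕ} {Φ Φ' : C(ℝ × E3, ℂ)} {c c' : ℝ}

/-- The terms of the equation for `I Φ Ȳ`, where `Y` solves the unperturbed equation with right-hand
side `I g` and `I` is the projector onto the window, that do not contain the large factor `2iωN`.
-/
def remainder (ω : ℝ) (κ : ℕ) (hc : ∀ p, ‖Φ p‖ ≤ c) (hc' : ∀ p, ‖Φ' p‖ ≤ c')
    (g : WeightedL2 ((N : ℝ) + 1 / 2)) : WeightedL2 ((N : ℝ) + 1 / 2) :=
  win κ N (conjMultiply hc' (solve ω N (win κ N g)) + conjMultiply hc (win κ N g)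
      - (1 - Complex.I * ω) • conjMultiply hc (winShift κ N (solve ω N (win κ N g))))
    + (1 + Complex.I * ω) • winShift κ N (conjMultiply hc (solve ω N (win κ N g)))

theorem coeFn_conjMultiply {θ : ℝ} (hc : ∀ p, ‖Φ p‖ ≤ c) (w : WeightedL2 θ) :
    ∀ᵐ t ∂(volume.restrict (Iic (0 : ℝ))), conjMultiply hc w t = mulAt Φ t (conjOp (w t)) :=
  ae_weight_iff.1 (coeFn_pointwise (O := fun t => (mulAt Φ t).comp conjOp)
        ((continuous_mulAt Φ).clm_comp continuous_const) (norm_mulAt_conjOp_le hc) w)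

theorem ae_coef_conjMultiply {θ : ℝ} (hc : ∀ p, ‖Φ p‖ ≤ c) {w : WeightedL2 θ}
    {y : (Fin 3 → ℤ) → ℝ → ℂ}
    (hw : ∀ᵐ t ∂(volume.restrict (Iic (0 : ℝ))), w t = winSum κ N fun k => y k t) (k : Fin 3 → ℤ) :
    ∀ᵐ t ∂(volume.restrict (Iic (0 : ℝ))), coef k (conjMultiply hc w) t
      = ∑ l ∈ (finite_window κ N).toFinset, conj (y l t) * crossCoef Φ k l t := by
  filter_upwards [hw, coeFn_conjMultiply hc w, coeFn_coef k (conjMultiply hc w)] with t h1 h2 h3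
  rw [h3, h2, h1, inner_basis_mulAt_conjOp_winSum]

/-- The time derivative of `⟨e_k, Φ Ȳ⟩` for modes `Y_l` that solve their differential equations. The
difference of the rates of a mode and of a conjugate mode is `2iωN` up to a bounded error. -/
theorem hasDerivAt_sum_crossCoef (hΦ : ContDiff ℝ 1 Φ) (hΦ' : ∀ p, Φ' p = timeDeriv Φ p)
    {γ Y : (Fin 3 → ℤ) → ℝ → ℂ} {t : ℝ}
    (hY : ∀ l, HasDerivAt (Y l) (γ l t - rate ω l * Y l t) t) (k : Fin 3 → ℤ) :
    HasDerivAt (fun t => ∑ l ∈ (finite_window κ N).toFinset, conj (Y l t) * crossCoef Φ k l t)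
      (((∑ l ∈ (finite_window κ N).toFinset, conj (Y l t) * crossCoef Φ' k l t)
        + (∑ l ∈ (finite_window κ N).toFinset, conj (γ l t) * crossCoef Φ k l t)
        - (1 - Complex.I * ω) * (∑ l ∈ (finite_window κ N).toFinset,
            conj ((eigenvalue l - N : ℤ) * Y l t) * crossCoef Φ k l t)
        + (1 + Complex.I * ω) * ((eigenvalue k - N : ℤ) *
            ∑ l ∈ (finite_window κ N).toFinset, conj (Y l t) * crossCoef Φ k l t)
        + 2 * Complex.I * ω * N *
            ∑ l ∈ (finite_window κ N).toFinset, conj (Y l t) * crossCoef Φ k l t)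
        - rate ω k * ∑ l ∈ (finite_window κ N).toFinset, conj (Y l t) * crossCoef Φ k l t) t := by
  have hconj : ∀ l, HasDerivAt (fun t => conj (Y l t)) (conj (γ l t - rate ω l * Y l t)) t :=
    fun l => (hY l).star
  have h := HasDerivAt.fun_sum (u := (finite_window κ N).toFinset) fun l _ =>
    (hconj l).mul (hasDerivAt_crossCoef hΦ hΦ' k l t)
  refine h.congr_deriv ?_
  simp only [Finset.mul_sum, ← Finset.sum_add_distrib, ← Finset.sum_sub_distrib]
  refine Finset.sum_congr rfl fun l _ => ?_
  simp only [rate, map_sub, map_mul, map_add, map_one, Complex.conj_I, Complex.conj_ofReal,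
    map_intCast]
  push_cast
  ring

/-- The oscillation identity: `I Φ Ȳ` solves an unperturbed equation with a right-hand side that
contains `2iωN I Φ Ȳ`, since the frequencies of the modes of the window and of their complex
conjugates differ by about `2ωN`. -/
theorem exists_win_conjMultiply_eq (hN : κ < N) (hΦ : ContDiff ℝ 1 Φ)
    (hΦ' : ∀ p, Φ' p = timeDeriv Φ p) (hc : ∀ p, ‖Φ p‖ ≤ c) (hc' : ∀ p, ‖Φ' p‖ ≤ c')
    {g : ℝ → H} (hg : Continuous g) (hgm : MemLp g 2 (weight ((N : ℝ) + 1 / 2))) :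
    ∃ u : H, ‖u‖ ≤ 2 * c * ‖hgm.toLp‖ ∧
      win κ N (conjMultiply hc (solve ω N (win κ N hgm.toLp)))
        = free ω N u + solve ω N (remainder ω κ hc hc' hgm.toLp
          + (2 * Complex.I * ω * N) • win κ N (conjMultiply hc (solve ω N (win κ N hgm.toLp)))) := by
  set θ : ℝ := (N : ℝ) + 1 / 2 with hθ
  set f : WeightedL2 θ := hgm.toLp with hf
  set W := (finite_window κ N).toFinset with hW
  set V := solve ω N (win κ N f) with hV
  set γ : (Fin 3 → ℤ) → ℝ → ℂ := fun l t => inner ℂ (basis l) (g t) with hγ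
  set Y : (Fin 3 → ℤ) → ℝ → ℂ := fun l =>
    odeSol (rate ω l) (γ l) (finalValue θ (rate ω l) (γ l)) with hYdef
  have hc0 : 0 ≤ c := (norm_nonneg _).trans (hc (0, 0))
  have hγc : ∀ l, Continuous (γ l) := fun l => continuous_const.inner hg
  have hγf : ∀ l, ∀ᵐ t ∂(volume.restrict (Iic (0 : ℝ))), coef l f t = γ l t := fun l => by
    filter_upwards [coeFn_coef l f, coeFn_toLp_weight hgm] with t h1 h2
    rw [h1, h2]
  have hγm : ∀ l, MemLp (γ l) 2 (weight θ) := fun l =>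
    (memLp_congr_ae (ae_weight_iff.2 (hγf l))).1 (Lp.memLp _)
  have hYc : ∀ l, Continuous (Y l) := fun l => continuous_odeSol (hγm l) _
  -- the functions `I g` and `Y` in terms of their modes
  have hIf0 : ∀ k, k ∉ window κ N → coef k (win κ N f) = 0 := fun k hk => by
    rw [coef_win, winSymbol, if_neg hk, zero_smul]
  have hIf1 : ∀ k ∈ window κ N, coef k (win κ N f) = coef k f := fun k hk => by
    rw [coef_win, winSymbol, if_pos hk, one_smul]
  have hVk : ∀ k ∈ window κ N, ∀ᵐ t ∂(volume.restrict (Iic (0 : ℝ))), coef k V t = Y k t :=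
    fun k hk => by
      rw [hV, coef_solve, hIf1 k hk]
      filter_upwards [coeFn_solOp (rate_re_ne ω N k) (coef k f)] with t h1
      rw [h1, odeSol_congr (hγf k), finalValue_congr (hγf k)]
  have hIf : ∀ᵐ t ∂(volume.restrict (Iic (0 : ℝ))), win κ N f t = winSum κ N fun k => γ k t :=
    ae_eq_winSum hIf0 fun k hk => by rw [hIf1 k hk]; exact hγf k
  have hVs : ∀ᵐ t ∂(volume.restrict (Iic (0 : ℝ))), V t = winSum κ N fun k => Y k t :=
    ae_eq_winSum (fun k hk => by rw [hV, coef_solve, hIf0 k hk, map_zero]) hVk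
  have hDV : ∀ᵐ t ∂(volume.restrict (Iic (0 : ℝ))),
      winShift κ N V t = winSum κ N fun k => (eigenvalue k - N : ℤ) * Y k t :=
    ae_eq_winSum (fun k hk => by rw [coef_winShift, shiftSymbol, if_neg hk, zero_smul])
      fun k hk => by
        rw [coef_winShift, shiftSymbol, if_pos hk]
        filter_upwards [hVk k hk, ae_weight_iff.1
          (Lp.coeFn_smul (((eigenvalue k - N : ℤ) : ℂ)) (coef k V))] with t h1 h2
        rw [h2, Pi.smul_apply, h1, smul_eq_mul]
  -- the modes of `Φ Ȳ`
  set G : (Fin 3 → ℤ) → ℝ → ℂ := fun k t => ∑ l ∈ W, conj (Y l t) * crossCoef Φ k l t with hG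
  have hcross : ∀ k l, Continuous (crossCoef Φ k l) := fun k l =>
    continuous_iff_continuousAt.2 fun t => (hasDerivAt_crossCoef hΦ hΦ' k l t).continuousAt
  have hGc : ∀ k, Continuous (G k) := fun k => continuous_finsetSum _ fun l _ =>
    (Complex.continuous_conj.comp (hYc l)).mul (hcross k l)
  set F := remainder ω κ hc hc' f + (2 * Complex.I * ω * N) • win κ N (conjMultiply hc V) with hF
  have hFk0 : ∀ k, k ∉ window κ N → coef k F = 0 := fun k hk => by
    rw [hF, remainder, map_add, map_add, map_smul, map_smul, coef_win, coef_win, coef_winShift,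
      winSymbol, shiftSymbol, if_neg hk, if_neg hk]
    simp
  have hGk : ∀ k ∈ window κ N, ∀ t ≤ 0, G k t = odeSol (rate ω k) (coef k F) (G k 0) t := by
    intro k hk t ht
    set E : ℝ → ℂ := fun t => (∑ l ∈ W, conj (Y l t) * crossCoef Φ' k l t)
        + (∑ l ∈ W, conj (γ l t) * crossCoef Φ k l t)
        - (1 - Complex.I * ω) * (∑ l ∈ W,
            conj ((eigenvalue l - N : ℤ) * Y l t) * crossCoef Φ k l t)
        + (1 + Complex.I * ω) * ((eigenvalue k - N : ℤ) * G k t)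
        + 2 * Complex.I * ω * N * G k t with hE
    have hEF : ∀ᵐ t ∂(volume.restrict (Iic (0 : ℝ))), coef k F t = E t := by
      have h0 : coef k F = (coef k (conjMultiply hc' V) + coef k (conjMultiply hc (win κ N f))
          - (1 - Complex.I * ω) • coef k (conjMultiply hc (winShift κ N V)))
          + (1 + Complex.I * ω) • ((eigenvalue k - N : ℤ) : ℂ) • coef k (conjMultiply hc V)
          + (2 * Complex.I * ω * N) • coef k (conjMultiply hc V) := by
        rw [hF, remainder, map_add, map_add, map_smul, map_smul, coef_win, coef_win, coef_winShift,
          winSymbol, shiftSymbol, if_pos hk, if_pos hk, one_smul, one_smul, map_sub, map_add,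
          map_smul]
      rw [h0]
      filter_upwards [ae_coef_conjMultiply hc' hVs k, ae_coef_conjMultiply hc hIf k,
        ae_coef_conjMultiply hc hDV k, ae_coef_conjMultiply hc hVs k,
        ae_weight_iff.1 (Lp.coeFn_add ((coef k (conjMultiply hc' V)
          + coef k (conjMultiply hc (win κ N f))
          - (1 - Complex.I * ω) • coef k (conjMultiply hc (winShift κ N V)))
          + (1 + Complex.I * ω) • ((eigenvalue k - N : ℤ) : ℂ) • coef k (conjMultiply hc V))
          ((2 * Complex.I * ω * N) • coef k (conjMultiply hc V))),
        ae_weight_iff.1 (Lp.coeFn_add (coef k (conjMultiply hc' V)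
          + coef k (conjMultiply hc (win κ N f))
          - (1 - Complex.I * ω) • coef k (conjMultiply hc (winShift κ N V)))
          ((1 + Complex.I * ω) • ((eigenvalue k - N : ℤ) : ℂ) • coef k (conjMultiply hc V))),
        ae_weight_iff.1 (Lp.coeFn_sub (coef k (conjMultiply hc' V)
          + coef k (conjMultiply hc (win κ N f)))
          ((1 - Complex.I * ω) • coef k (conjMultiply hc (winShift κ N V)))),
        ae_weight_iff.1 (Lp.coeFn_add (coef k (conjMultiply hc' V))
          (coef k (conjMultiply hc (win κ N f)))),
        ae_weight_iff.1 (Lp.coeFn_smul (1 - Complex.I * ω : ℂ)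
          (coef k (conjMultiply hc (winShift κ N V)))),
        ae_weight_iff.1 (Lp.coeFn_smul (1 + Complex.I * ω : ℂ)
          (((eigenvalue k - N : ℤ) : ℂ) • coef k (conjMultiply hc V))),
        ae_weight_iff.1 (Lp.coeFn_smul ((eigenvalue k - N : ℤ) : ℂ) (coef k (conjMultiply hc V))),
        ae_weight_iff.1 (Lp.coeFn_smul (2 * Complex.I * ω * N : ℂ) (coef k (conjMultiply hc V)))]
        with t a1 a2 a3 a4 a5 a6 a7 a8 a9 a10 a11 a12
      rw [a5, Pi.add_apply, a6, Pi.add_apply, a7, Pi.sub_apply, a8, Pi.add_apply, a9, a10, a12,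
        Pi.smul_apply, Pi.smul_apply, Pi.smul_apply, a11, Pi.smul_apply, a1, a2, a3, a4]
      simp only [smul_eq_mul, hE, hG]
      ring
    have hEm : MemLp E 2 (weight θ) := (memLp_congr_ae (ae_weight_iff.2 hEF)).1 (Lp.memLp _)
    rw [odeSol_congr hEF]
    refine eq_odeSol_of_hasDerivAt (hGc k).continuousOn hEm (fun s hs => ?_) ht
    exact hasDerivAt_sum_crossCoef hΦ hΦ' (fun l => hasDerivAt_odeSol (hγm l) (hγc l) _ hs) k
  -- the final value of `I Φ Ȳ`
  refine ⟨winProj κ N (mulAt Φ 0 (conjOp (winSum κ N fun k => Y k 0))), ?_, ?_⟩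
  · have h1 : ‖winSum κ N fun k => Y k 0‖ ≤ ‖f‖ := by
      refine le_of_sq_le_sq ?_ (norm_nonneg _)
      rw [norm_winSum_sq]
      refine (Finset.sum_le_sum fun l _ => ?_).trans
        (sum_le_hasSum W (fun l _ => by positivity) (hasSum_norm_coef_sq f))
      refine pow_le_pow_left₀ (norm_nonneg _) ?_ 2
      simp only [hYdef]
      rw [odeSol_zero, ← finalValue_congr (hγf l)]
      exact norm_finalValue_le _ (half_le_abs_rate ω N l)
    calc _ ≤ ‖winProj κ N‖ * (‖mulAt Φ 0‖ * ‖conjOp (winSum κ N fun k => Y k 0)‖) := by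
          refine (ContinuousLinearMap.le_opNorm _ _).trans ?_
          gcongr
          exact ContinuousLinearMap.le_opNorm _ _
      _ ≤ 2 * (c * ‖f‖) := by
          rw [norm_conjOp_apply]
          gcongr
          · exact norm_winProj_le κ N
          · exact norm_mulAt_le hc 0
      _ = 2 * c * ‖f‖ := by ring
  · refine weightedL2_ext fun k => ?_
    by_cases hk : k ∈ window κ N
    · refine Lp.ext (ae_weight_iff.2 ?_)
      rw [coef_win, winSymbol, if_pos hk, one_smul]
      have hFm := Lp.memLp (coef k F)
      have h1 : ∀ᵐ t ∂(volume.restrict (Iic (0 : ℝ))), coef k (conjMultiply hc V) t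
          = odeSol (rate ω k) (coef k F) (G k 0) t := by
        filter_upwards [ae_coef_conjMultiply hc hVs k, ae_restrict_mem measurableSet_Iic]
          with t h2 ht
        rw [h2, ← hGk k hk t ht]
      filter_upwards [h1, ae_coef_free_add_solve ω N
        (winProj κ N (mulAt Φ 0 (conjOp (winSum κ N fun k => Y k 0)))) F k] with t h2 h3
      rw [h2, h3]
      congr 1
      split_ifs with hkN
      · rw [inner_basis_winProj hN, if_pos hk, inner_basis_mulAt_conjOp_winSum]
      · refine eq_finalValue_of_memLp ?_ hFm
          ((memLp_congr_ae (ae_weight_iff.2 h1)).1 (Lp.memLp _))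
        exact lt_of_le_of_ne (not_lt.1 (mt (rate_re_lt_iff ω N k).1 hkN)) (rate_re_ne ω N k).symm
    · rw [map_add, coef_solve, hFk0 k hk, map_zero, coef_win, winSymbol, if_neg hk, zero_smul,
        coef_free, inner_basis_winProj hN, if_neg hk]
      simp

end Temporal

section Temporal

variable {ω : ℝ} {κ N : ℕ} {Φ Φ' : C(ℝ × E3, ℂ)} {c c' : ℝ}

theorem norm_multiply_le {θ : ℝ} (hc : ∀ p, ‖Φ p‖ ≤ c) (w : WeightedL2 θ) :
    ‖multiply hc w‖ ≤ c * ‖w‖ :=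
  (multiply hc).le_of_opNorm_le (norm_pointwise_le (continuous_mulAt Φ) (norm_mulAt_le hc)) w

theorem norm_conjMultiply_le {θ : ℝ} (hc : ∀ p, ‖Φ p‖ ≤ c) (w : WeightedL2 θ) :
    ‖conjMultiply hc w‖ ≤ c * ‖w‖ :=
  (conjMultiply hc).le_of_opNorm_le (norm_pointwise_le (O := fun t => (mulAt Φ t).comp conjOp)
    ((continuous_mulAt Φ).clm_comp continuous_const) (norm_mulAt_conjOp_le hc)) w

theorem norm_one_add_I_mul_le (ω : ℝ) : ‖1 + Complex.I * ω‖ ≤ 1 + |ω| :=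
  (norm_add_le _ _).trans (by simp)

theorem norm_one_sub_I_mul_le (ω : ℝ) : ‖1 - Complex.I * ω‖ ≤ 1 + |ω| :=
  (norm_sub_le _ _).trans (by simp)

theorem norm_remainder_le (hc : ∀ p, ‖Φ p‖ ≤ c) (hc' : ∀ p, ‖Φ' p‖ ≤ c)
    (g : WeightedL2 ((N : ℝ) + 1 / 2)) :
    ‖remainder ω κ hc hc' g‖ ≤ c * (5 + 8 * κ * (1 + |ω|)) * ‖g‖ := by
  have hc0 : 0 ≤ c := (norm_nonneg _).trans (hc (0, 0))
  set V := solve ω N (win κ N g) with hV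
  have hI := norm_win_le (κ := κ) (N := N) g
  have hVn : ‖V‖ ≤ 4 * ‖g‖ := (norm_solve_apply_le ω N _).trans (by linarith)
  have h1 : ‖conjMultiply hc' V‖ ≤ c * (4 * ‖g‖) := (norm_conjMultiply_le hc' V).trans (by gcongr)
  have h2 : ‖conjMultiply hc (win κ N g)‖ ≤ c * ‖g‖ :=
    (norm_conjMultiply_le hc _).trans (by gcongr)
  have h3 : ‖(1 - Complex.I * ω) • conjMultiply hc (winShift κ N V)‖
      ≤ (1 + |ω|) * (c * (κ * (4 * ‖g‖))) := by
    rw [norm_smul]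
    refine mul_le_mul (norm_one_sub_I_mul_le ω) ?_ (norm_nonneg _) (by positivity)
    refine (norm_conjMultiply_le hc _).trans ?_
    gcongr
    exact (norm_winShift_le V).trans (by gcongr)
  have h4 : ‖(1 + Complex.I * ω) • winShift κ N (conjMultiply hc V)‖
      ≤ (1 + |ω|) * (κ * (c * (4 * ‖g‖))) := by
    rw [norm_smul]
    refine mul_le_mul (norm_one_add_I_mul_le ω) ?_ (norm_nonneg _) (by positivity)
    refine (norm_winShift_le _).trans ?_
    gcongr
    exact (norm_conjMultiply_le hc V).trans (by gcongr)
  calc _ ≤ (‖conjMultiply hc' V‖ + ‖conjMultiply hc (win κ N g)‖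
          + ‖(1 - Complex.I * ω) • conjMultiply hc (winShift κ N V)‖)
          + ‖(1 + Complex.I * ω) • winShift κ N (conjMultiply hc V)‖ := by
        refine (norm_add_le _ _).trans (add_le_add ?_ le_rfl)
        refine (norm_win_le _).trans ((norm_sub_le _ _).trans (add_le_add ?_ le_rfl))
        exact norm_add_le _ _
    _ ≤ (c * (4 * ‖g‖) + c * ‖g‖ + (1 + |ω|) * (c * (κ * (4 * ‖g‖))))
          + (1 + |ω|) * (κ * (c * (4 * ‖g‖))) := by gcongr
    _ = _ := by ring

/-- Temporal averaging: on the window, the term with the complex conjugate is small of order `1/N`,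
because it is multiplied by a rapid oscillation. -/
theorem temporal_averaging (hN : κ < N) (hΦ : ContDiff ℝ 1 Φ) (hΦ' : ∀ p, Φ' p = timeDeriv Φ p)
    (hc : ∀ p, ‖Φ p‖ ≤ c) (hc' : ∀ p, ‖Φ' p‖ ≤ c) (g : WeightedL2 ((N : ℝ) + 1 / 2)) :
    2 * |ω| * N * ‖solve ω N (win κ N (conjMultiply hc (solve ω N (win κ N g))))‖
      ≤ c * (26 + 32 * κ * (1 + |ω|)) * ‖g‖ := by
  have := isFiniteMeasure_weight (θ := (N : ℝ) + 1 / 2) (by positivity)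
  have hc0 : 0 ≤ c := (norm_nonneg _).trans (hc (0, 0))
  -- both sides are continuous in `g`, and functions that are continuous in time are dense
  induction g using (BoundedContinuousFunction.toLp_denseRange (E := H)
    (weight ((N : ℝ) + 1 / 2)) ℂ (p := 2) (by norm_num)).induction_on with
  | hp =>
    refine isClosed_le (continuous_const.mul (continuous_norm.comp ?_))
      (continuous_const.mul continuous_norm)
    exact (solve ω N).continuous.comp ((win κ N).continuous.comp
      ((conjMultiply hc).continuous.comp ((solve ω N).continuous.comp (win κ N).continuous)))
  | ih g =>
    have hgm : MemLp g 2 (weight ((N : ℝ) + 1 / 2)) :=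
      (memLp_congr_ae (BoundedContinuousFunction.coeFn_toLp 2 (weight ((N : ℝ) + 1 / 2)) ℂ g)).1
        (Lp.memLp _)
    have hgeq : BoundedContinuousFunction.toLp 2 (weight ((N : ℝ) + 1 / 2)) ℂ g = hgm.toLp :=
      Lp.ext ((BoundedContinuousFunction.coeFn_toLp 2 (weight ((N : ℝ) + 1 / 2)) ℂ g).trans
        hgm.coeFn_toLp.symm)
    rw [hgeq]
    obtain ⟨u, hu, heq⟩ := exists_win_conjMultiply_eq (ω := ω) hN hΦ hΦ' hc hc' g.continuous hgm
    set f := hgm.toLp with hf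
    set w := win κ N (conjMultiply hc (solve ω N (win κ N f))) with hw
    set R := remainder ω κ hc hc' f with hR
    have h1 : (2 * Complex.I * ω * N) • solve ω N w = w - free ω N u - solve ω N R := by
      rw [map_add, map_smul] at heq
      rw [eq_sub_iff_add_eq, eq_sub_iff_add_eq]
      refine Eq.trans ?_ heq.symm
      abel
    have h2 : ‖(2 * Complex.I * ω * N : ℂ)‖ = 2 * |ω| * N := by simp
    rw [← h2, ← norm_smul, h1]
    have h3 : ‖w‖ ≤ c * (4 * ‖f‖) := by
      refine (norm_win_le _).trans ((norm_conjMultiply_le hc _).trans ?_)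
      gcongr
      refine (norm_solve_apply_le ω N _).trans ?_
      gcongr
      exact norm_win_le f
    calc _ ≤ ‖w‖ + ‖free ω N u‖ + ‖solve ω N R‖ :=
          (norm_sub_le _ _).trans (add_le_add (norm_sub_le _ _) le_rfl)
      _ ≤ c * (4 * ‖f‖) + 2 * c * ‖f‖ + 4 * (c * (5 + 8 * κ * (1 + |ω|)) * ‖f‖) := by
          refine add_le_add (add_le_add h3 ((norm_free_le ω N u).trans hu))
            ((norm_solve_apply_le ω N R).trans ?_)
          gcongr
          exact norm_remainder_le hc hc' f
      _ = _ := by ring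

end Temporal

/-! ### Solution of the perturbed problem -/

/-- The affine equation `v = f - M v` has a unique solution if `M²` is a contraction. -/
theorem existsUnique_of_sq_contraction {E : Type*} [NormedAddCommGroup E] [NormedSpace ℝ E]
    [CompleteSpace E] (M : E →L[ℝ] E) {m : ℝ} (hM : ∀ x, ‖M x‖ ≤ m * ‖x‖)
    (hM2 : ∀ x, ‖M (M x)‖ ≤ 1 / 2 * ‖x‖) (f : E) :
    (∃! v, v = f - M v) ∧ ∀ v, v = f - M v → ‖v‖ ≤ 2 * (1 + m) * ‖f‖ := by
  have hest : ∀ f v, v = f - M v → ‖v‖ ≤ 2 * (1 + m) * ‖f‖ := by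
    intro f v hv
    have h1 : v = f - M f + M (M v) := by
      have h2 : M v = M f - M (M v) := by
        rw [← map_sub, ← hv]
      refine (hv.trans (congrArg (f - ·) h2)).trans ?_
      abel
    have h2 : ‖v‖ ≤ ‖f‖ + m * ‖f‖ + 1 / 2 * ‖v‖ := by
      calc ‖v‖ = ‖f - M f + M (M v)‖ := by rw [← h1]
        _ ≤ ‖f‖ + ‖M f‖ + ‖M (M v)‖ := (norm_add_le _ _).trans (add_le_add (norm_sub_le _ _) le_rfl)
        _ ≤ _ := add_le_add (add_le_add le_rfl (hM f)) (hM2 v)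
    linarith
  refine ⟨?_, hest f⟩
  have hlt : ‖M * M‖ < 1 :=
    (ContinuousLinearMap.opNorm_le_bound _ (by norm_num) hM2).trans_lt (by norm_num)
  obtain ⟨U, hU⟩ := isUnit_one_sub_of_norm_lt_one hlt
  set x := (↑U⁻¹ : E →L[ℝ] E) f with hx
  have hxf : x - M (M x) = f := by
    have h1 : ((U : E →L[ℝ] E) * (↑U⁻¹ : E →L[ℝ] E)) f = f := by rw [Units.mul_inv]; rfl
    rw [hU] at h1
    exact h1
  refine ⟨x - M x, ?_, fun v hv => ?_⟩
  · simp only [map_sub]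
    nth_rewrite 1 [← hxf]
    abel
  · have h2 : x - M x = f - M (x - M x) := by
      rw [map_sub]
      nth_rewrite 1 [← hxf]
      abel
    have h3 : v - (x - M x) = 0 - M (v - (x - M x)) := by
      rw [map_sub]
      nth_rewrite 1 [hv]
      nth_rewrite 1 [h2]
      abel
    have h4 := hest 0 _ h3
    rw [norm_zero, mul_zero] at h4
    exact sub_eq_zero.1 (norm_le_zero_iff.1 h4)

section Final

variable {a b : ℝ → E3 → ℂ} {K : ℝ≥0} {ω : ℝ} {κ N : ℕ} {ε : ℝ}

/-- The combined effect of the spectral gap outside the window, of spatial averaging and of temporal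
averaging. -/
theorem norm_solve_perturbation_solve_le (hN : κ < N) (hω : ω ≠ 0) (ha : IsC1 a) (hb : IsC1 b)
    (hbK : c1Norm b ≤ K) (hac : ∀ p, ‖ha.toMap p‖ ≤ K) (hbc : ∀ p, ‖hb.toMap p‖ ≤ K)
    (hε : 0 ≤ ε)
    (hsp : ∀ (t : ℝ) (g : H),
      ‖winProj κ N (mulOp (slice ha.toMap t) (winProj κ N g))‖ ≤ ε * ‖g‖)
    (g : WeightedL2 ((N : ℝ) + 1 / 2)) :
    ‖solve ω N (multiply hac (solve ω N g) + conjMultiply hbc (solve ω N g))‖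
      ≤ (32 * K / (κ + 1 / 2) + 16 * ε + K * (26 + 32 * κ * (1 + |ω|)) / (2 * |ω| * N)) * ‖g‖ := by
  set B : WeightedL2 ((N : ℝ) + 1 / 2) →L[ℝ] WeightedL2 ((N : ℝ) + 1 / 2) :=
    multiply hac + conjMultiply hbc with hB
  have hBn : ∀ w, ‖B w‖ ≤ 2 * K * ‖w‖ := fun w => by
    rw [hB, add_apply]
    refine (norm_add_le _ _).trans ?_
    linarith [norm_multiply_le hac w, norm_conjMultiply_le hbc w]
  have hgap : ∀ w, ‖solve ω N (w - win κ N w)‖ ≤ 2 / (κ + 1 / 2) * ‖w‖ := norm_solve_sub_win_le ω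
  have hLn : ∀ w, ‖solve ω N w‖ ≤ 4 * ‖w‖ := norm_solve_apply_le ω N
  set y := solve ω N (win κ N g) with hy
  have hyn : ‖y‖ ≤ 4 * ‖g‖ := (hLn _).trans (by linarith [norm_win_le (κ := κ) (N := N) g])
  have hwy : win κ N y = y := by
    refine weightedL2_ext fun k => ?_
    rw [hy, coef_win, coef_solve, coef_win, winSymbol]
    split_ifs <;> simp
  have hsplit : solve ω N (multiply hac (solve ω N g) + conjMultiply hbc (solve ω N g))
      = solve ω N (B (solve ω N g) - win κ N (B (solve ω N g)))
        + solve ω N (win κ N (B (solve ω N (g - win κ N g))))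
        + solve ω N (win κ N (multiply hac y)) + solve ω N (win κ N (conjMultiply hbc y)) := by
    have h1 : solve ω N g = solve ω N (g - win κ N g) + y := by rw [hy, ← map_add, sub_add_cancel]
    have h2 : win κ N (B (solve ω N g)) = win κ N (B (solve ω N (g - win κ N g)))
        + win κ N (multiply hac y) + win κ N (conjMultiply hbc y) := by
      conv_lhs => rw [h1]
      rw [map_add, map_add, add_assoc, ← map_add (win κ N) (multiply hac y)]
      rfl
    show solve ω N (B (solve ω N g)) = _
    rw [map_sub, h2]
    simp only [map_add]
    abel
  have e1 : ‖solve ω N (B (solve ω N g) - win κ N (B (solve ω N g)))‖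
      ≤ 2 / (κ + 1 / 2) * (2 * K * (4 * ‖g‖)) := by
    refine (hgap _).trans ?_
    gcongr
    refine (hBn _).trans ?_
    gcongr
    exact hLn g
  have e2 : ‖solve ω N (win κ N (B (solve ω N (g - win κ N g))))‖
      ≤ 4 * (2 * K * (2 / (κ + 1 / 2) * ‖g‖)) := by
    refine (hLn _).trans ?_
    gcongr
    refine (norm_win_le _).trans ((hBn _).trans ?_)
    gcongr
    exact hgap g
  have e3 : ‖solve ω N (win κ N (multiply hac y))‖ ≤ 4 * (ε * (4 * ‖g‖)) := by
    refine (hLn _).trans ?_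
    gcongr
    refine le_trans ?_ (mul_le_mul_of_nonneg_left hyn hε)
    refine Lp.norm_le_mul_norm_of_ae_le_mul ?_
    have h1 := coeFn_win hN y
    rw [hwy] at h1
    filter_upwards [coeFn_win hN (multiply hac y), h1,
      coeFn_pointwise (continuous_mulAt ha.toMap) (norm_mulAt_le hac) y] with t h2 h3 h4
    have h5 : multiply hac y t = mulOp (slice ha.toMap t) (y t) := h4
    rw [h2, h5]
    have h6 := hsp t (y t)
    rwa [← h3] at h6
  have e4 : ‖solve ω N (win κ N (conjMultiply hbc y))‖
      ≤ K * (26 + 32 * κ * (1 + |ω|)) / (2 * |ω| * N) * ‖g‖ := by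
    have hN0 : (0 : ℝ) < N := by exact_mod_cast Nat.zero_lt_of_lt hN
    have hω0 : 0 < |ω| := abs_pos.2 hω
    rw [div_mul_eq_mul_div, le_div_iff₀ (by positivity), mul_comm]
    exact temporal_averaging (Φ' := ⟨timeDeriv hb.toMap, continuous_timeDeriv hb.1⟩) hN hb.1
      (fun p => rfl) hbc (norm_timeDeriv_le hbK) g
  rw [hsplit]
  calc _ ≤ _ := (norm_add_le _ _).trans (add_le_add ((norm_add_le _ _).trans
        (add_le_add ((norm_add_le _ _).trans (add_le_add e1 e2)) e3)) e4)
    _ = _ := by ring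

end Final

end CGL

end

theorem theorem2 (K : ℝ≥0) :
    ∃ C : ℝ, ∀ ω : ℝ, ω ≠ 0 →
      ∃ S : Set ℕ, S.Infinite ∧
        ∀ N ∈ S, ∀ a b : ℝ → CGL.E3 → ℂ,
          CGL.IsC1 a → CGL.IsC1 b → CGL.c1Norm a + CGL.c1Norm b ≤ (K : ℝ≥0∞) →
          (∀ t, CGL.mean (a t) = 0) →
          ∀ (h : CGL.WeightedL2 ((N : ℝ) + 1 / 2)) (u : CGL.H), u ∈ CGL.HN N →
            (∃! v : CGL.WeightedL2 ((N : ℝ) + 1 / 2),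
                CGL.IsBackwardSolution ω a b N h u v) ∧
            ∀ v : CGL.WeightedL2 ((N : ℝ) + 1 / 2),
              CGL.IsBackwardSolution ω a b N h u v → ‖v‖ ≤ C * (‖h‖ + ‖u‖) := by
  -- `κ`, `ε` and `N₀` are chosen so that the terms outside the window, the spatial average and the
  -- temporal average each contribute at most `1 / 6` to the norm of `(L B)²`
  obtain ⟨κ, hκ⟩ := exists_nat_ge (384 * (K : ℝ) ^ 2)
  set ε : ℝ := 1 / (192 * (K + 1)) with hε
  have hε0 : 0 < ε := by positivity
  obtain ⟨R, hR⟩ := CGL.spatial_averaging K hε0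
  refine ⟨8 * (1 + 8 * K), fun ω hω => ?_⟩
  have hω0 : 0 < |ω| := abs_pos.2 hω
  obtain ⟨N₀, hN₀⟩ := exists_nat_ge (6 * K * (K * (26 + 32 * κ * (1 + |ω|))) / |ω|)
  refine ⟨{N | CGL.Separated κ R N} \ Iic (max κ N₀),
    (CGL.infinite_setOf_separated κ R).sdiff (finite_Iic _), ?_⟩
  rintro N ⟨hsep, hNN⟩ a b ha hb hab hmean h u hu
  have hN : max κ N₀ < N := not_le.1 hNN
  have hκN : κ < N := (le_max_left _ _).trans_lt hN
  have hN₀N : (N₀ : ℝ) ≤ N := by exact_mod_cast ((le_max_right _ _).trans_lt hN).le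
  have hN0 : (0 : ℝ) < N := by exact_mod_cast Nat.zero_lt_of_lt hκN
  have haK : CGL.c1Norm a ≤ K := le_self_add.trans hab
  have hbK : CGL.c1Norm b ≤ K := le_add_self.trans hab
  have hac : ∀ p, ‖ha.toMap p‖ ≤ K := fun p => CGL.norm_le_of_c1Norm haK p.1 p.2
  have hbc : ∀ p, ‖hb.toMap p‖ ≤ K := fun p => CGL.norm_le_of_c1Norm hbK p.1 p.2
  have hsp := fun t => hR κ N hκN hsep (CGL.slice ha.toMap t) (ha.lipschitzWith haK t) (ha.2 t)
    (fun x => hac (t, x)) (hmean t)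
  set B : CGL.WeightedL2 ((N : ℝ) + 1 / 2) →L[ℝ] CGL.WeightedL2 ((N : ℝ) + 1 / 2) :=
    CGL.multiply hac + CGL.conjMultiply hbc with hB
  set M := ((CGL.solve ω N).restrictScalars ℝ).comp B with hM
  have hBn : ∀ w, ‖B w‖ ≤ 2 * K * ‖w‖ := fun w => by
    rw [hB, add_apply]
    refine (norm_add_le _ _).trans ?_
    linarith [CGL.norm_multiply_le hac w, CGL.norm_conjMultiply_le hbc w]
  have hMn : ∀ w, ‖M w‖ ≤ 8 * K * ‖w‖ := fun w =>
    (CGL.norm_solve_apply_le ω N (B w)).trans (by linarith [hBn w])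
  have hM2 : ∀ w, ‖M (M w)‖ ≤ 1 / 2 * ‖w‖ := fun w => by
    refine (CGL.norm_solve_perturbation_solve_le hκN hω ha hb hbK hac hbc hε0.le hsp (B w)).trans ?_
    have t1 : 32 * (K : ℝ) / (κ + 1 / 2) * (2 * K) ≤ 1 / 6 := by
      rw [div_mul_eq_mul_div, div_le_iff₀ (by positivity)]
      linarith
    have t2 : 16 * ε * (2 * K) ≤ 1 / 6 := by
      rw [hε, mul_one_div, div_mul_eq_mul_div, div_le_iff₀ (by positivity)]
      linarith
    have t3 : K * (26 + 32 * κ * (1 + |ω|)) / (2 * |ω| * N) * (2 * K) ≤ 1 / 6 := by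
      have := (div_le_iff₀ hω0).1 (hN₀.trans hN₀N)
      rw [div_mul_eq_mul_div, div_le_iff₀ (by positivity)]
      linarith
    refine (mul_le_mul_of_nonneg_left (hBn w) (by positivity)).trans ?_
    rw [← mul_assoc]
    refine mul_le_mul_of_nonneg_right ?_ (norm_nonneg w)
    linarith
  set f := CGL.free ω N u + CGL.solve ω N h with hf
  have hiff : ∀ v, CGL.IsBackwardSolution ω a b N h u v ↔ v = f - M v := fun v => by
    rw [CGL.IsBackwardSolution, CGL.solvesEquation_iff (by positivity) ha hb hac hbc,
      CGL.weakSol_and_hasFinalValue_iff hu, map_sub, ← add_sub_assoc]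
    rfl
  have hfn : ‖f‖ ≤ 4 * (‖h‖ + ‖u‖) := by
    refine (norm_add_le _ _).trans ?_
    linarith [CGL.norm_free_le ω N u, CGL.norm_solve_apply_le ω N h, norm_nonneg u]
  obtain ⟨hex, hest⟩ := CGL.existsUnique_of_sq_contraction M hMn hM2 f
  simp only [hiff]
  refine ⟨hex, fun v hv => (hest v hv).trans ?_⟩
  calc _ ≤ 2 * (1 + 8 * (K : ℝ)) * (4 * (‖h‖ + ‖u‖)) := by gcongr
    _ = _ := by ring
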